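/- \textbf{Notation.} An \emph{arithmetic term} is a term built from the variable $n$ and numerals by $+$, bounded subtraction $a\dot- b=\max(a-b,0)$, $\cdot$, integer division $/$, and $x^y$. $\operatorname{HW}(m)$ is the number of $1$s in the binary representation of $m$, and $p(n)$ is the $n$-th prime ($p(1)=2$). Let $G_r(q,t)=\sum_{j=0}^{t-1}j^rq^j$ (with $0^0=1$). \textbf{Hypercube term.} Let $P(\vec x)$, $\vec x=(x_1,\dots,x_k)$, be a finite sum of monomials $c\prod_{i=1}^k v_i^{x_i}x_i^{r_i}$ with $c\in\mathbb Z$, $r_i\ge 0$, and each $v_i\ge1$ a power of $2$, like monomials being collected, and let $c_0$ be its free term (the coefficient of the monomial with all $v_i=1$, $r_i=0$). The integer built by the hypercube method from $P$ with the parameters $k,t,u$ is $$\frac{(2^u-c_0+1)(2^{2ut^k}-1)}{2^u+1}-\sum (2^u-1)\,c\prod_{i=1}^kG_{r_i}\!\left(2^{2ut^{i-1}}v_i,\,t\right),$$ the sum being over the other monomials of $P$. \textbf{The exponential Diophantine equation.} Put \begin{align*} E_/(x_1,x_2;y_1,y_2;x_3)&=(x_1-x_2x_3-y_1)^2+(y_1+y_2+1-x_2)^2,\\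 E_{\bmod}(x_1,x_2;y_1,y_2;x_3)&=(x_1-x_2y_1-x_3)^2+(x_3+y_2+1-x_2)^2,\\ E_\nu(x_1;y_1,\dots,y_4;x_2)&=(x_1-2^{x_2}y_1)^2+(x_1-2^{x_2+1}y_2-y_3-1)^2+(y_3+y_4+2-2^{x_2+1})^2,\\ E_{\mathrm{bin}}(x_1,x_2;y_1,\dots,y_7;x_3)&=(y_1-(2x_1^3+8x_1^2+2x_1x_2+12x_1+4x_2+8))^2+(y_2-(2x_1^2+8x_1+8))^2\\ &\quad+E_/(2^{y_1},2^{y_2}-2^{2x_1+4}-1;y_4,y_5;y_3)+E_{\bmod}(y_3,2^{2x_1+4};y_6,y_7;x_3),\\ E_!(x_1;y_1,\dots,y_{13};x_2)&=(y_1-x_1^2)^2+(y_2-2^{3y_1})^2+(y_3-x_1y_1)^2+E_{\mathrm{bin}}(y_2,x_1;y_5,\dots,y_{11};y_4)\\ &\quad+E_/(2^{3y_3},y_4;y_{12},y_{13};x_2),\\ E_{\mathrm{HW}}(x_1;y_1,\dots,y_{12};x_2)&=E_{\mathrm{bin}}(2x_1,x_1;y_2,\dots,y_8;y_1)+E_\nu(y_1;y_9,\dots,y_{12};x_2).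 \end{align*} For variables $f_1,f_2,f_3,f_4,m$ and $(q_{1,1},q_{2,1},g_{0,1},g_{2,1},g_{4,1},g_{0,2},g_{1,2},g_{2,2},C)$ abbreviate $t_1=4f_1$, $U=2^{4f_1+5}$, $h=1-U$, $q_1=2^{8f_1+10}$, $q_2=2^{32f_2+48f_1+10}$, $q_1'=2^{32f_2+40f_1}$, $q_2'=2^{128f_3+192f_2+40f_1}$, $q_2''=2^{128f_3+224f_2+88f_1+10}$, and let $E_{M4}(f_1,f_2,f_3,f_4;q_{1,1},\dots,C;m)$ be the sum of the squares of the ten expressions \begin{align*} &m-\bigl(C+hg_{4,1}g_{0,2}-2hg_{2,1}g_{0,2}-8f_1hg_{2,1}g_{1,2}+16f_1^2hg_{0,1}g_{2,2}+8f_1hg_{0,1}g_{1,2}\bigr),\\ &C(U+1)-U(q_2''-1),\qquad q_{1,1}-q_1+1,\qquad q_{2,1}-q_2+1,\\ &g_{0,1}q_{1,1}-q_{2,1},\qquad g_{0,2}q_{2,1}-(q_2''-1),\qquad g_{1,2}q_{2,1}^2-q_2(t_1q_2''-f_4q_2'+1),\\ &g_{2,1}q_{1,1}^3-q_1\bigl(t_1^2q_1'q_1^2-(2t_1^2+2t_1-1)q_2+f_4^2q_1'-q_1-1\bigr),\\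 &g_{2,2}q_{2,1}^3-q_2\bigl(t_1^2q_2'q_2^2-(2t_1^2+2t_1-1)q_2''+f_4^2q_2'-q_2-1\bigr),\\ &g_{4,1}q_{1,1}^5-q_1\bigl(t_1^4q_1'q_1^4+(-4t_1^4-12t_1^3-6t_1^2+12t_1+11)q_2+(6t_1^4+12t_1^3-6t_1^2-12t_1+11)q_1'q_1^2\\ &\qquad+(-4t_1^4-4t_1^3+6t_1^2-4t_1+1)q_1'q_1^3+f_4^4q_1'-q_1^3-11q_1^2-11q_1-1\bigr). \end{align*} (If $f_2=f_1^2$, $f_3=f_1^3$, $f_4=t=4f_1+1$, then $q_2=q_1^t$, $q_i'=q_i^{t-1}$, $q_2''=q_2^t$, and the squares say that $g_{r,i}=G_r(q_i,t)$.) With $\vec x=(x_1,\dots,x_{42})$ and $(x_1,\dots,x_8)=(a,f_1,f_2,f_3,f_4,m,b,d)$ put \begin{align*} \hat F(n,\vec x)&=E_!(a;x_9,\dots,x_{21};f_1)+(f_2-f_1^2)^2+(f_3-f_1f_2)^2+(f_4-4f_1-1)^2\\ &\quad+E_{M4}(f_1,f_2,f_3,f_4;x_{22},\dots,x_{30};m)+E_{\mathrm{HW}}(m;x_{31},\dots,x_{42};b)\\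 &\quad+\bigl(b+(4f_1+5)(-f_4^2+d-2^n)\bigr)^2 . \end{align*} \textbf{Theorem.} Let $$t(n)=2^{2^{2^{2n^4+16}}},\qquad u(n)=2^{2^{9t(n)+8}+9},$$ and let $\hat Q(n)$ be the integer built by the hypercube method from the monomial expansion of $\hat F(n,\vec x)$ with the parameters $k=42$, $t(n)$, $u(n)$. Then for every positive integer $n$ we have $\hat Q(n)\ge 0$, and the $n$-th prime is $$p(n)=\frac{\operatorname{HW}(\hat Q(n))}{u(n)}-t(n)^{42}.$$ Moreover $t(n)$, $u(n)$, $\max(\hat Q(n),0)$ and the right-hand side (with $\max(\hat Q(n),0)$ for $\hat Q(n)$, integer division and bounded subtraction) are each given by one fixed arithmetic term, valid for all $n\in\mathbb N$. -/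

import Mathlib

noncomputable section

namespace NthPrime

/-! ### Arithmetic terms -/

/-- Terms in one variable over the language `{+, ∸, ·, /, x^y}` (with numerals), where `∸` is
bounded subtraction and `/` is integer division. -/
inductive ArithTerm : Type
  | var : ArithTerm
  | const (c : ℕ) : ArithTerm
  | add (a b : ArithTerm) : ArithTerm
  | monus (a b : ArithTerm) : ArithTerm
  | mul (a b : ArithTerm) : ArithTerm
  | div (a b : ArithTerm) : ArithTerm
  | pow (a b : ArithTerm) : ArithTerm

/-- The value of a term at `n`. -/
def ArithTerm.eval (n : ℕ) : ArithTerm → ℕ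
  | .var => n
  | .const c => c
  | .add a b => a.eval n + b.eval n
  | .monus a b => a.eval n - b.eval n
  | .mul a b => a.eval n * b.eval n
  | .div a b => a.eval n / b.eval n
  | .pow a b => a.eval n ^ b.eval n

/-- `f` is given by one fixed arithmetic term. -/
def IsArithmeticTerm (f : ℕ → ℕ) : Prop :=
  ∃ τ : ArithTerm, ∀ n, τ.eval n = f n

/-- Hamming weight: the number of `1`s in the binary representation. -/
def HW (m : ℕ) : ℕ := (Nat.digits 2 m).count 1

/-! ### Exponential polynomials -/

/-- Exponential polynomials in `x₁, …, x_k`, simple in these variables, with base `2`, in expanded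
form. The indeterminate `Sum.inl i` stands for the variable `xᵢ` and `Sum.inr i` for `2 ^ xᵢ`, so the
monomial with exponent `m` is `∏ᵢ xᵢ ^ rᵢ * vᵢ ^ xᵢ` with `rᵢ = m (Sum.inl i)` and
`vᵢ = 2 ^ m (Sum.inr i)`. -/
abbrev ExpPoly (k : ℕ) : Type := MvPolynomial (Fin k ⊕ Fin k) ℤ

/-- Linear forms `const + ∑ᵢ coeffᵢ xᵢ` with natural coefficients: the allowed exponents of `2`. -/
structure LinForm (k : ℕ) : Type where
  const : ℕ
  coeff : Fin k → ℕ

namespace LinForm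

variable {k : ℕ}

/-- The variable `xᵢ`. -/
def var (i : Fin k) : LinForm k := ⟨0, Pi.single i 1⟩

/-- The constant `c`. -/
def cst (c : ℕ) : LinForm k := ⟨c, 0⟩

instance : Add (LinForm k) := ⟨fun a b => ⟨a.const + b.const, a.coeff + b.coeff⟩⟩

instance : SMul ℕ (LinForm k) := ⟨fun c a => ⟨c * a.const, c • a.coeff⟩⟩

/-- A linear form as an exponential polynomial. -/
def val (l : LinForm k) : ExpPoly k :=
  MvPolynomial.C (l.const : ℤ) +
    ∑ i, MvPolynomial.C (l.coeff i : ℤ) * MvPolynomial.X (Sum.inl i)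

/-- The exponential polynomial `2 ^ l`. -/
def pow2 (l : LinForm k) : ExpPoly k :=
  MvPolynomial.C ((2 : ℤ) ^ l.const) * ∏ i, MvPolynomial.X (Sum.inr i) ^ l.coeff i

end LinForm

open LinForm

/-! ### The hypercube method -/

/-- Generalized geometric progression of the `r`-th kind, `∑_{j < t} j ^ r * q ^ j`. -/
def geomG (r : ℕ) (q : ℤ) (t : ℕ) : ℤ :=
  ∑ j ∈ Finset.range t, (j : ℤ) ^ r * q ^ j

/-- The contribution of the nonconstant monomial `c * ∏ᵢ vᵢ ^ xᵢ * xᵢ ^ rᵢ` (with exponent `m`).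
The index `i : Fin k` runs from `0`, so the digit position of the `i`-th coordinate is `t ^ i`. -/
def hypercubeA (k : ℕ) (c : ℤ) (m : Fin k ⊕ Fin k →₀ ℕ) (t u : ℕ) : ℤ :=
  -((2 : ℤ) ^ u - 1) * c *
    ∏ i : Fin k, geomG (m (Sum.inl i)) (2 ^ (2 * u * t ^ (i : ℕ)) * 2 ^ m (Sum.inr i)) t

/-- The contribution of the free term `c`. The division is exact. -/
def hypercubeC (k : ℕ) (c : ℤ) (t u : ℕ) : ℤ :=
  (2 ^ u - c + 1) * (2 ^ (2 * u * t ^ k) - 1) / (2 ^ u + 1)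

/-- The integer that the hypercube method builds from the monomial expansion of `F` with the
parameters `k`, `t`, `u`. -/
def hypercubeTerm {k : ℕ} (F : ExpPoly k) (t u : ℕ) : ℤ :=
  hypercubeC k (F.coeff 0) t u + ∑ m ∈ F.support.erase 0, hypercubeA k (F.coeff m) m t u

/-! ### The single-fold relations

In each relation with quantified variables, `y j` is the `j`-th of them (`j ≥ 1`). -/

section Relations

variable {k : ℕ}

/-- `x₃ = ⌊x₁ / x₂⌋`; two quantified variables. -/
def EDiv (x₁ x₂ : ExpPoly k) (y : ℕ → LinForm k) (x₃ : ExpPoly k) : ExpPoly k :=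
  (x₁ - x₂ * x₃ - (y 1).val) ^ 2 + ((y 1).val + (y 2).val + 1 - x₂) ^ 2

/-- `x₃ = x₁ mod x₂`; two quantified variables. -/
def EMod (x₁ x₂ : ExpPoly k) (y : ℕ → LinForm k) (x₃ : ExpPoly k) : ExpPoly k :=
  (x₁ - x₂ * (y 1).val - x₃) ^ 2 + (x₃ + (y 2).val + 1 - x₂) ^ 2

/-- `x₂ ∣ x₁`; one quantified variable. -/
def EDvd (x₁ : ExpPoly k) (y : ℕ → LinForm k) (x₂ : ExpPoly k) : ExpPoly k :=
  (x₁ - x₂ * (y 1).val) ^ 2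

/-- `x₂ ∤ x₁`; three quantified variables. -/
def ENotDvd (x₁ : ExpPoly k) (y : ℕ → LinForm k) (x₂ : ExpPoly k) : ExpPoly k :=
  (x₁ - x₂ * (y 1).val - (y 2).val - 1) ^ 2 + ((y 2).val + (y 3).val + 2 - x₂) ^ 2

/-- `x₂ = ν₂(x₁)`; four quantified variables. -/
def ENu (x₁ : ExpPoly k) (y : ℕ → LinForm k) (x₂ : LinForm k) : ExpPoly k :=
  EDvd x₁ y (pow2 x₂) + ENotDvd x₁ (fun j => y (1 + j)) (pow2 (x₂ + cst 1))

/-- `x₃ = binom(x₁, x₂)`; seven quantified variables. -/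
def EBinom (x₁ x₂ : LinForm k) (y : ℕ → LinForm k) (x₃ : ExpPoly k) : ExpPoly k :=
  ((y 1).val - (2 * x₁.val ^ 3 + 8 * x₁.val ^ 2 + 2 * x₁.val * x₂.val + 12 * x₁.val
      + 4 * x₂.val + 8)) ^ 2
  + ((y 2).val - (2 * x₁.val ^ 2 + 8 * x₁.val + 8)) ^ 2
  + EDiv (pow2 (y 1)) (pow2 (y 2) - pow2 (2 • x₁ + cst 4) - 1) (fun j => y (3 + j)) (y 3).val
  + EMod (y 3).val (pow2 (2 • x₁ + cst 4)) (fun j => y (5 + j)) x₃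

/-- `x₂ = x₁!`; thirteen quantified variables. -/
def EFact (x₁ : LinForm k) (y : ℕ → LinForm k) (x₂ : ExpPoly k) : ExpPoly k :=
  ((y 1).val - x₁.val ^ 2) ^ 2
  + ((y 2).val - pow2 (3 • y 1)) ^ 2
  + ((y 3).val - x₁.val * (y 1).val) ^ 2
  + EBinom (y 2) x₁ (fun j => y (4 + j)) (y 4).val
  + EDiv (pow2 (3 • y 3)) (y 4).val (fun j => y (11 + j)) x₂

/-- `x₂ = HW(x₁)`; twelve quantified variables. -/
def EHW (x₁ : LinForm k) (y : ℕ → LinForm k) (x₂ : LinForm k) : ExpPoly k :=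
  EBinom (2 • x₁) x₁ (fun j => y (1 + j)) (y 1).val
  + ENu (y 1).val (fun j => y (8 + j)) x₂

/-- `m = M(4 f₁)` given `f₂ = f₁²`, `f₃ = f₁³`, `f₄ = 4 f₁ + 1`; nine quantified variables. Here
`M(n)` is the hypercube term of `(x₁² - n x₂ - 1)²` with parameters `2`, `t = n + 1`, `u = n + 5`,
and the quantified variables are, for `n = 4 f₁`, `q₁ = 2^(2u)`, `q₂ = 2^(2tu)`: the numbers `q₁ - 1`,
`q₂ - 1`, `g_{r,i} = G_r(qᵢ, t)` and the contribution `C` of the free term. The squares define the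
`g_{r,i}` by the closed forms of `G_r`, cleared of denominators. -/
def EM4 (f₁ f₂ f₃ : LinForm k) (f₄ : ExpPoly k) (y : ℕ → LinForm k) (m : ExpPoly k) : ExpPoly k :=
  let u : LinForm k := 4 • f₁ + cst 5
  let t₁ : ExpPoly k := 4 * f₁.val
  let q₁ : ExpPoly k := pow2 (2 • u)
  let q₂ : ExpPoly k := pow2 (32 • f₂ + 48 • f₁ + cst 10)
  -- `q₁ ^ (t - 1)`, `q₂ ^ (t - 1)` and `q₂ ^ t`; also `q₁ ^ t = q₂`
  let q₁t₁ : ExpPoly k := pow2 (32 • f₂ + 40 • f₁)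
  let q₂t₁ : ExpPoly k := pow2 (128 • f₃ + 192 • f₂ + 40 • f₁)
  let q₂t : ExpPoly k := pow2 (128 • f₃ + 224 • f₂ + 88 • f₁ + cst 10)
  let q₁₁ : ExpPoly k := (y 1).val
  let q₂₁ : ExpPoly k := (y 2).val
  let g₀₁ : ExpPoly k := (y 3).val
  let g₂₁ : ExpPoly k := (y 4).val
  let g₄₁ : ExpPoly k := (y 5).val
  let g₀₂ : ExpPoly k := (y 6).val
  let g₁₂ : ExpPoly k := (y 7).val
  let g₂₂ : ExpPoly k := (y 8).val
  let C : ExpPoly k := (y 9).val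
  let h : ExpPoly k := 1 - pow2 u
  (m - (C + h * g₄₁ * g₀₂ - 2 * (h * g₂₁ * g₀₂) - 2 * (4 * f₁.val) * (h * g₂₁ * g₁₂)
      + (4 * f₁.val) ^ 2 * (h * g₀₁ * g₂₂) + 2 * (4 * f₁.val) * (h * g₀₁ * g₁₂))) ^ 2
  + (C * (pow2 u + 1) - pow2 u * (q₂t - 1)) ^ 2
  + (q₁₁ - q₁ + 1) ^ 2
  + (q₂₁ - q₂ + 1) ^ 2
  + (g₀₁ * q₁₁ - q₂₁) ^ 2
  + (g₀₂ * q₂₁ - (q₂t - 1)) ^ 2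
  + (g₁₂ * q₂₁ ^ 2 - q₂ * (t₁ * q₂t - f₄ * q₂t₁ + 1)) ^ 2
  + (g₂₁ * q₁₁ ^ 3 - q₁ * (t₁ ^ 2 * (q₁t₁ * q₁ ^ 2) - (2 * t₁ ^ 2 + 2 * t₁ - 1) * q₂
      + f₄ ^ 2 * q₁t₁ - q₁ - 1)) ^ 2
  + (g₂₂ * q₂₁ ^ 3 - q₂ * (t₁ ^ 2 * (q₂t₁ * q₂ ^ 2) - (2 * t₁ ^ 2 + 2 * t₁ - 1) * q₂t
      + f₄ ^ 2 * q₂t₁ - q₂ - 1)) ^ 2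
  + (g₄₁ * q₁₁ ^ 5 - q₁ * (t₁ ^ 4 * (q₁t₁ * q₁ ^ 4)
      + (-4 * t₁ ^ 4 - 12 * t₁ ^ 3 - 6 * t₁ ^ 2 + 12 * t₁ + 11) * q₂
      + (6 * t₁ ^ 4 + 12 * t₁ ^ 3 - 6 * t₁ ^ 2 - 12 * t₁ + 11) * (q₁t₁ * q₁ ^ 2)
      + (-4 * t₁ ^ 4 - 4 * t₁ ^ 3 + 6 * t₁ ^ 2 - 4 * t₁ + 1) * (q₁t₁ * q₁ ^ 3)
      + f₄ ^ 4 * q₁t₁ - q₁ ^ 3 - 11 * q₁ ^ 2 - 11 * q₁ - 1)) ^ 2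

end Relations

/-! ### The equation for the `n`-th prime and its hypercube term -/

/-- The variable `x_i`, for `1 ≤ i ≤ 42`. -/
def x (i : ℕ) : LinForm 42 := LinForm.var (Fin.ofNat 42 (i - 1))

/-- The exponential polynomial `F̂(n, x₁, …, x₄₂)`, where `(x₁, …, x₈) = (a, f₁, f₂, f₃, f₄, m, b, d)`
and the quantified variables of the factorial, `M4` and Hamming weight relations are
`x₉, …, x₂₁`, then `x₂₂, …, x₃₀`, then `x₃₁, …, x₄₂`. -/
def Fhat (n : ℕ) : ExpPoly 42 :=
  let a := x 1
  let f₁ := x 2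
  let f₂ := x 3
  let f₃ := x 4
  let f₄ := x 5
  let m := x 6
  let b := x 7
  let d := x 8
  EFact a (fun j => x (8 + j)) f₁.val
  + (f₂.val - f₁.val ^ 2) ^ 2
  + (f₃.val - f₁.val * f₂.val) ^ 2
  + (f₄.val - 4 * f₁.val - 1) ^ 2
  + EM4 f₁ f₂ f₃ f₄.val (fun j => x (21 + j)) m.val
  + EHW m (fun j => x (30 + j)) b
  + (b.val + (4 * f₁.val + 5) * (-f₄.val ^ 2 + d.val - 2 ^ n)) ^ 2

/-- `t(n)` -/
def tPar (n : ℕ) : ℕ := 2 ^ 2 ^ 2 ^ (2 * n ^ 4 + 16)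

/-- `u(n)` -/
def uPar (n : ℕ) : ℕ := 2 ^ (2 ^ (9 * tPar n + 8) + 9)

/-- `Q̂(n)` -/
def Qhat (n : ℕ) : ℤ := hypercubeTerm (Fhat n) (tPar n) (uPar n)

end NthPrime

end

noncomputable section

namespace NthPrime

open LinForm

/-! ### Hamming weights -/

/-! The hypercube method turns counting zeros into a Hamming weight. Expanding every `geomG` as a
sum, the integer built from `F` becomes a sum over the points of `[0,t)^k` of blocks of `2u` binary
digits, the block of a point being `(2^u-1)(2^u+1-v)` with `v` the value of `F` there
(`hypercubeTerm_eq_sum`). If `0 ≤ v ≤ 2^u`, such a block has weight `2u` when `v = 0` and `u`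
otherwise (`HW_block`), so the weight of the whole integer is `u` times `t^k` plus the number of
zeros (`HW_sum_cube_int`).

It remains to see that `F̂(n, ·)` has exactly `p(n)` zeros in the cube. Put `f = a!`. The congruence
`x² ≡ 1` modulo `4f` has `2^(π(a)+1)` solutions (`sqrtOneCount_four_mul_factorial`). The method
itself, applied to `(x₁² - 4f x₂ - 1)²`, yields an integer `m` whose weight `b` reveals this number
(`mInt_spec`), and the last square of `F̂` says `2^(π(a)+1) + d = 2^n`. Each relation in `F̂` is
single-fold: its auxiliary unknowns are determined uniquely. So the zeros correspond to the `a` with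
`π(a) + 1 ≤ n`, that is to `a = 0, …, p(n)-1` (`ev_Fhat_eq_zero_iff`, `card_zeros`). The relations
rest on quotient formulas for binomial coefficients and factorials (`choose_eq_div_mod`,
`factorial_eq_div`) and on Kummer's theorem, by which `HW m` is the exponent of `2` in the central
binomial coefficient.

Two estimates make the parameters admissible. A Chebyshev bound gives `a ≤ n²`, and then all
coordinates of the zeros are below `t(n)` (`zeroW_lt`); and `F̂ ≤ 2^u(n)` on the cube
(`ev_Fhat_le`).

For the arithmetic terms, binomial coefficients, gcds and hence Hamming weights are obtained by
reading off digits of suitable integers, and `Q̂` is a sum over a fixed finite set of monomials with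
coefficients polynomial in `2^n`. -/

theorem HW_zero : HW 0 = 0 := by simp [HW]

theorem HW_bit (m b : ℕ) (hb : b < 2) : HW (b + 2 * m) = b + HW m := by
  rcases Nat.eq_zero_or_pos (b + 2 * m) with h | h
  · obtain ⟨rfl, rfl⟩ : b = 0 ∧ m = 0 := by omega
    simp [HW]
  · unfold HW
    rw [Nat.digits_def' (by norm_num) h]
    have h1 : (b + 2 * m) % 2 = b := by omega
    have h2 : (b + 2 * m) / 2 = m := by omega
    rw [h1, h2, List.count_cons]
    interval_cases b <;> simp [add_comm]

theorem HW_add_pow_mul (k : ℕ) : ∀ a b : ℕ, a < 2 ^ k → HW (a + 2 ^ k * b) = HW a + HW b := by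
  induction k with
  | zero =>
    intro a b h
    obtain rfl : a = 0 := by simpa using h
    simp [HW_zero]
  | succ k ih =>
    intro a b h
    have h1 : a + 2 ^ (k + 1) * b = a % 2 + 2 * (a / 2 + 2 ^ k * b) := by
      rw [pow_succ]; have := Nat.mod_add_div a 2; linarith
    have h2 : HW a = a % 2 + HW (a / 2) := by
      conv_lhs => rw [← Nat.mod_add_div a 2]
      exact HW_bit _ _ (Nat.mod_lt _ (by norm_num))
    rw [h1, HW_bit _ _ (Nat.mod_lt _ (by norm_num)), ih _ _ (by rw [pow_succ] at h; omega), h2]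
    ring

theorem HW_compl (u : ℕ) : ∀ a < 2 ^ u, HW a + HW (2 ^ u - 1 - a) = u := by
  induction u with
  | zero =>
    intro a h
    obtain rfl : a = 0 := by simpa using h
    simp [HW_zero]
  | succ u ih =>
    intro a h
    rw [pow_succ] at h
    have h1 : 2 ^ (u + 1) - 1 - a = (1 - a % 2) + 2 * (2 ^ u - 1 - a / 2) := by
      rw [pow_succ]; omega
    have h2 : HW a = a % 2 + HW (a / 2) := by
      conv_lhs => rw [← Nat.mod_add_div a 2]
      exact HW_bit _ _ (Nat.mod_lt _ (by norm_num))
    rw [h1, HW_bit _ _ (by omega), h2]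
    have := ih (a / 2) (by omega)
    omega

theorem HW_two_pow_sub_one (u : ℕ) : HW (2 ^ u - 1) = u := by
  simpa [HW_zero] using HW_compl u 0 (by positivity)

/-- With `s = r + 1` the product is `2^u * r + (2^u - 1 - r)`: the upper half of its digits is `r`
and the lower half is the bitwise complement of `r`, so together they contain exactly `u` ones. -/
theorem HW_sub_one_mul (u s : ℕ) (h1 : 1 ≤ s) (h2 : s ≤ 2 ^ u) : HW ((2 ^ u - 1) * s) = u := by
  obtain ⟨r, rfl⟩ : ∃ r, s = r + 1 := ⟨s - 1, by omega⟩
  obtain ⟨w, hw⟩ : ∃ w, 2 ^ u = r + 1 + w := ⟨2 ^ u - (r + 1), by omega⟩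
  have e : (2 ^ u - 1) * (r + 1) = (2 ^ u - 1 - r) + 2 ^ u * r := by
    have h3 : 2 ^ u - 1 = r + w := by omega
    have h4 : 2 ^ u - 1 - r = w := by omega
    rw [h4, h3, hw]; ring
  rw [e, HW_add_pow_mul _ _ _ (by omega), add_comm]
  exact HW_compl u r (by omega)

/-- The block of `2 * u` binary digits that encodes the value `p`. -/
def block (u p : ℕ) : ℕ := (2 ^ u - 1) * (2 ^ u + 1 - p)

theorem block_lt (u p : ℕ) : block u p < 2 ^ (2 * u) := by
  have h : 1 ≤ 2 ^ u := Nat.one_le_two_pow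
  have h0 : block u p ≤ (2 ^ u - 1) * (2 ^ u + 1) := Nat.mul_le_mul_left _ (by omega)
  obtain ⟨w, hw⟩ : ∃ w, 2 ^ u = w + 1 := ⟨2 ^ u - 1, by omega⟩
  have h2 : (2 : ℕ) ^ (2 * u) = 2 ^ u * 2 ^ u := by rw [two_mul, pow_add]
  rw [h2]
  rw [hw] at h0 ⊢
  simp only [Nat.add_sub_cancel] at h0
  nlinarith

/-- For `p = 0` the block is `2^(2u) - 1`, all ones. For `1 ≤ p ≤ 2^u` the second factor lies
between `1` and `2^u`, and `HW_sub_one_mul` applies. -/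
theorem HW_block (u p : ℕ) (hp : p ≤ 2 ^ u) :
    HW (block u p) = u + if p = 0 then u else 0 := by
  unfold block
  split_ifs with h
  · subst h
    have h2 : (2 ^ u - 1) * (2 ^ u + 1 - 0) = 2 ^ (2 * u) - 1 := by
      rw [two_mul, pow_add]
      obtain ⟨w, hw⟩ : ∃ w, 2 ^ u = w + 1 := ⟨2 ^ u - 1, by have : 1 ≤ 2 ^ u := Nat.one_le_two_pow; omega⟩
      rw [hw]
      have : (w + 1) * (w + 1) - 1 = w * (w + 2) := by
        rw [Nat.sub_eq_iff_eq_add (by nlinarith)]; ring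
      rw [this]; simp
    rw [h2, HW_two_pow_sub_one, two_mul]
  · rw [HW_sub_one_mul _ _ (by omega) (by omega), add_zero]

theorem sum_block_lt (u T : ℕ) (p : ℕ → ℕ) :
    ∑ j ∈ Finset.range T, block u (p j) * 2 ^ (2 * u * j) < 2 ^ (2 * u * T) := by
  induction T with
  | zero => simp
  | succ T ih =>
    rw [Finset.sum_range_succ, mul_add, pow_add, mul_one]
    have h := block_lt u (p T)
    have h2 : 0 < 2 ^ (2 * u * T) := by positivity
    have : (block u (p T) + 1) * 2 ^ (2 * u * T) ≤ 2 ^ (2 * u) * 2 ^ (2 * u * T) :=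
      Nat.mul_le_mul_right _ h
    linarith

theorem HW_sum_block (u T : ℕ) (p : ℕ → ℕ) (hp : ∀ j < T, p j ≤ 2 ^ u) :
    HW (∑ j ∈ Finset.range T, block u (p j) * 2 ^ (2 * u * j)) =
      u * (T + ((Finset.range T).filter fun j => p j = 0).card) := by
  induction T with
  | zero => simp [HW_zero]
  | succ T ih =>
    rw [Finset.sum_range_succ, mul_comm (block u (p T)), HW_add_pow_mul _ _ _ (sum_block_lt u T p),
      ih fun j hj => hp j (by omega), HW_block _ _ (hp T (by omega)), Finset.range_add_one,
      Finset.filter_insert]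
    split_ifs with h
    · rw [Finset.card_insert_of_notMem (by simp)]; ring
    · ring

/-- The position of a point of the cube `[0, t) ^ k` in the enumeration of the cube. -/
def cubeIdx {k t : ℕ} (x : Fin k → Fin t) : ℕ := ∑ i, (x i : ℕ) * t ^ (i : ℕ)

theorem HW_sum_cube (k t u : ℕ) (p : (Fin k → Fin t) → ℕ) (hp : ∀ x, p x ≤ 2 ^ u) :
    HW (∑ x, block u (p x) * 2 ^ (2 * u * cubeIdx x)) =
      u * (t ^ k + (Finset.univ.filter fun x => p x = 0).card) := by
  classical
  let e := finFunctionFinEquiv (m := t) (n := k)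
  -- The value `0` outside the range is harmless: only indices below `t ^ k` are summed or counted.
  let p' : ℕ → ℕ := fun j => if h : j < t ^ k then p (e.symm ⟨j, h⟩) else 0
  have hp' : ∀ j : Fin (t ^ k), p' j = p (e.symm j) := fun j => by simp [p']
  have h1 : ∑ x, block u (p x) * 2 ^ (2 * u * cubeIdx x) =
      ∑ j ∈ Finset.range (t ^ k), block u (p' j) * 2 ^ (2 * u * j) := by
    rw [Finset.sum_range, ← Equiv.sum_comp e]
    refine Finset.sum_congr rfl fun x _ => ?_
    rw [hp', Equiv.symm_apply_apply, finFunctionFinEquiv_apply]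
    rfl
  have h2 : (Finset.univ.filter fun x => p x = 0).card =
      ((Finset.range (t ^ k)).filter fun j => p' j = 0).card := by
    rw [Finset.card_filter, Finset.card_filter, Finset.sum_range, ← Equiv.sum_comp e]
    refine Finset.sum_congr rfl fun x _ => ?_
    rw [hp', Equiv.symm_apply_apply]
  rw [h1, h2]
  exact HW_sum_block _ _ _ fun j hj => by simp only [p', hj, dif_pos]; exact hp _

theorem sum_cube_pow (k t : ℕ) (q : ℤ) :
    (∑ x : Fin k → Fin t, q ^ cubeIdx x) = ∑ j ∈ Finset.range (t ^ k), q ^ j := by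
  rw [Finset.sum_range, ← Equiv.sum_comp (finFunctionFinEquiv (m := t) (n := k))]
  refine Finset.sum_congr rfl fun x _ => ?_
  rw [finFunctionFinEquiv_apply]
  rfl

/-! ### The hypercube method -/

/-- The value of an exponential polynomial at a point with natural coordinates. -/
def ev {k : ℕ} (x : Fin k → ℕ) : ExpPoly k →+* ℤ :=
  MvPolynomial.eval (Sum.elim (fun i => (x i : ℤ)) fun i => 2 ^ x i)

/-- The free term puts the same content into every block. The division is exact because `2^(2uT) -
1` is `(2^u + 1)(2^u - 1)` times a geometric sum. -/
theorem hypercubeC_eq (k : ℕ) (c : ℤ) (t u : ℕ) :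
    hypercubeC k c t u =
      ∑ j ∈ Finset.range (t ^ k), (2 ^ u - 1) * (2 ^ u - c + 1) * ((2 : ℤ) ^ (2 * u)) ^ j := by
  have h1 : ((2 : ℤ) ^ u + 1) ≠ 0 := by positivity
  have h2 : (2 : ℤ) ^ (2 * u * t ^ k) - 1 =
      (2 ^ u + 1) * ((2 ^ u - 1) * ∑ j ∈ Finset.range (t ^ k), ((2 : ℤ) ^ (2 * u)) ^ j) := by
    have := geom_sum_mul ((2 : ℤ) ^ (2 * u)) (t ^ k)
    rw [pow_mul, ← this, two_mul, pow_add]; ring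
  rw [hypercubeC, h2, ← Finset.mul_sum]
  rw [show ((2 : ℤ) ^ u - c + 1) * ((2 ^ u + 1) *
    ((2 ^ u - 1) * ∑ j ∈ Finset.range (t ^ k), ((2 : ℤ) ^ (2 * u)) ^ j)) =
    ((2 ^ u - 1) * (2 ^ u - c + 1) * ∑ j ∈ Finset.range (t ^ k), ((2 : ℤ) ^ (2 * u)) ^ j) *
      (2 ^ u + 1) by ring]
  exact Int.mul_ediv_cancel _ h1

theorem hypercubeC_mul (k : ℕ) (c : ℤ) (t u : ℕ) :
    hypercubeC k c t u * (2 ^ u + 1) = (2 ^ u - c + 1) * (2 ^ (2 * u * t ^ k) - 1) := by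
  rw [hypercubeC_eq, ← Finset.mul_sum]
  have := geom_sum_mul ((2 : ℤ) ^ (2 * u)) (t ^ k)
  rw [pow_mul 2 (2 * u), ← this, two_mul, pow_add]
  ring

/-- Multiplying out chooses one summand `x i` from each factor. The chosen powers of `2^(2u)`
combine to the exponent `∑ xᵢ tⁱ`, the base-`t` index of the point, and the rest is the monomial
evaluated there. -/
theorem prod_geomG (k t u : ℕ) (m : Fin k ⊕ Fin k →₀ ℕ) :
    ∏ i : Fin k, geomG (m (Sum.inl i)) (2 ^ (2 * u * t ^ (i : ℕ)) * 2 ^ m (Sum.inr i)) t =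
      ∑ x : Fin k → Fin t, (∏ i, ((x i : ℕ) : ℤ) ^ m (Sum.inl i) * ((2 : ℤ) ^ (x i : ℕ)) ^ m (Sum.inr i)) *
        ((2 : ℤ) ^ (2 * u)) ^ cubeIdx x := by
  simp only [geomG, Finset.sum_range]
  rw [Finset.prod_univ_sum, Fintype.piFinset_univ]
  refine Finset.sum_congr rfl fun x _ => ?_
  rw [cubeIdx, ← Finset.prod_pow_eq_pow_sum, ← Finset.prod_mul_distrib]
  refine Finset.prod_congr rfl fun i _ => ?_
  rw [mul_pow, ← pow_mul, ← pow_mul, ← pow_mul, ← pow_mul]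
  ring_nf

theorem eval_monomial_eq {k : ℕ} (x : Fin k → ℕ) (F : ExpPoly k) :
    ev x F = ∑ m ∈ F.support, F.coeff m *
      ∏ i, (x i : ℤ) ^ m (Sum.inl i) * ((2 : ℤ) ^ x i) ^ m (Sum.inr i) := by
  rw [ev, MvPolynomial.eval_eq']
  refine Finset.sum_congr rfl fun m _ => ?_
  rw [Fintype.prod_sum_type, Finset.prod_mul_distrib]
  rfl

/-- Exchange the sum over monomials with the sum over points: at each point the monomials reassemble
to the value of `F`. -/
theorem hypercubeTerm_eq_sum {k : ℕ} (F : ExpPoly k) (t u : ℕ) :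
    hypercubeTerm F t u = ∑ x : Fin k → Fin t,
      (2 ^ u - 1) * (2 ^ u + 1 - ev (fun i => (x i : ℕ)) F) * ((2 : ℤ) ^ (2 * u)) ^ cubeIdx x := by
  classical
  have h0 : ∀ x : Fin k → ℕ, ev x F = F.coeff 0 + ∑ m ∈ F.support.erase 0, F.coeff m *
      ∏ i, (x i : ℤ) ^ m (Sum.inl i) * ((2 : ℤ) ^ x i) ^ m (Sum.inr i) := by
    intro x
    rw [eval_monomial_eq]
    by_cases h : (0 : Fin k ⊕ Fin k →₀ ℕ) ∈ F.support
    · rw [← Finset.add_sum_erase _ _ h]; simp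
    · rw [Finset.erase_eq_of_notMem h, MvPolynomial.notMem_support_iff.1 h, zero_add]
  rw [hypercubeTerm, hypercubeC_eq, ← Finset.mul_sum, ← sum_cube_pow]
  simp only [hypercubeA, prod_geomG, Finset.mul_sum]
  rw [Finset.sum_comm, ← Finset.sum_add_distrib]
  refine Finset.sum_congr rfl fun x _ => ?_
  rw [h0]
  have : ∀ S : ℤ, (2 ^ u - 1) * (2 ^ u + 1 - (F.coeff 0 + S)) * ((2 : ℤ) ^ (2 * u)) ^ cubeIdx x
      = (2 ^ u - 1) * (2 ^ u - F.coeff 0 + 1) * ((2 : ℤ) ^ (2 * u)) ^ cubeIdx x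
        + S * (-(2 ^ u - 1) * ((2 : ℤ) ^ (2 * u)) ^ cubeIdx x) := fun S => by ring
  rw [this, Finset.sum_mul]
  congr 1
  refine Finset.sum_congr rfl fun m _ => ?_
  ring

theorem sum_cube_eq_cast (k t u : ℕ) (p : (Fin k → Fin t) → ℤ)
    (hp : ∀ x, 0 ≤ p x ∧ p x ≤ 2 ^ u) :
    ∑ x, (2 ^ u - 1) * (2 ^ u + 1 - p x) * ((2 : ℤ) ^ (2 * u)) ^ cubeIdx x =
      ((∑ x, block u (p x).toNat * 2 ^ (2 * u * cubeIdx x) : ℕ) : ℤ) := by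
  rw [Nat.cast_sum]
  refine Finset.sum_congr rfl fun x _ => ?_
  obtain ⟨h1, h2⟩ := hp x
  obtain ⟨a, ha⟩ := Int.eq_ofNat_of_zero_le h1
  rw [ha] at h2 ⊢
  have h3 : a ≤ 2 ^ u := by exact_mod_cast h2
  rw [block, Int.toNat_natCast, pow_mul 2 (2 * u) (cubeIdx x)]
  push_cast [Nat.one_le_two_pow, show a ≤ 2 ^ u + 1 by omega]
  ring

/-- The Hamming weight of an integer built by the hypercube method. -/
theorem HW_sum_cube_int (k t u : ℕ) (p : (Fin k → Fin t) → ℤ)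
    (hp : ∀ x, 0 ≤ p x ∧ p x ≤ 2 ^ u) (Q : ℤ)
    (hQ : Q = ∑ x, (2 ^ u - 1) * (2 ^ u + 1 - p x) * ((2 : ℤ) ^ (2 * u)) ^ cubeIdx x) :
    0 ≤ Q ∧ HW Q.toNat = u * (t ^ k + (Finset.univ.filter fun x => p x = 0).card) ∧
      Q < 2 ^ (2 * u * t ^ k) := by
  rw [sum_cube_eq_cast k t u p hp] at hQ
  refine ⟨hQ ▸ Int.natCast_nonneg _, ?_, ?_⟩
  · rw [hQ, Int.toNat_natCast, HW_sum_cube]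
    · congr 3
      refine Finset.filter_congr fun x _ => ?_
      have := hp x
      omega
    · intro x
      have := hp x
      zify
      rw [Int.toNat_of_nonneg this.1]
      exact this.2
  · rw [hQ]
    have h : ∀ x : Fin k → Fin t, block u (p x).toNat ≤ 2 ^ (2 * u) - 1 := fun x =>
      Nat.le_sub_one_of_lt (block_lt _ _)
    have h3 : ((∑ x, block u (p x).toNat * 2 ^ (2 * u * cubeIdx x) : ℕ) : ℤ) ≤
        ∑ x : Fin k → Fin t, (2 ^ (2 * u) - 1) * ((2 : ℤ) ^ (2 * u)) ^ cubeIdx x := by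
      rw [Nat.cast_sum]
      refine Finset.sum_le_sum fun x _ => ?_
      rw [Nat.cast_mul, Nat.cast_pow, Nat.cast_ofNat, pow_mul 2 (2 * u) (cubeIdx x)]
      refine mul_le_mul_of_nonneg_right ?_ (by positivity)
      have := h x
      zify [Nat.one_le_two_pow] at this
      exact this
    refine h3.trans_lt ?_
    rw [← Finset.mul_sum, sum_cube_pow, mul_comm, geom_sum_mul, ← pow_mul]
    linarith

/-! ### Digit extraction, binomial coefficients, Hamming weights -/

theorem sum_digits_lt {B : ℕ} {c : ℕ → ℕ} (hc : ∀ i, c i < B) (k : ℕ) :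
    ∑ i ∈ Finset.range k, c i * B ^ i < B ^ k := by
  induction k with
  | zero => simp
  | succ k ih =>
    rw [Finset.sum_range_succ, pow_succ]
    have := Nat.mul_le_mul_right (B ^ k) (hc k)
    rw [Nat.succ_eq_add_one] at this
    linarith

theorem digit_extract {B : ℕ} {c : ℕ → ℕ} (hc : ∀ i, c i < B) {k M : ℕ} (hk : k < M) :
    (∑ i ∈ Finset.range M, c i * B ^ i) / B ^ k % B = c k := by
  obtain ⟨r, rfl⟩ : ∃ r, M = k + 1 + r := ⟨M - (k + 1), by omega⟩
  have hB : 0 < B := (Nat.zero_le _).trans_lt (hc 0)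
  have h : ∑ i ∈ Finset.range (k + 1 + r), c i * B ^ i = ∑ i ∈ Finset.range k, c i * B ^ i
      + B ^ k * (c k + B * ∑ i ∈ Finset.range r, c (k + 1 + i) * B ^ i) := by
    rw [Finset.sum_range_add, Finset.sum_range_succ, mul_add, Finset.mul_sum, Finset.mul_sum,
      add_assoc, mul_comm (c k)]
    congr 2
    refine Finset.sum_congr rfl fun i _ => ?_
    ring
  rw [h, Nat.add_mul_div_left _ _ (by positivity), Nat.div_eq_of_lt (sum_digits_lt hc k), zero_add,
    Nat.add_mul_mod_self_left, Nat.mod_eq_of_lt (hc k)]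

/-- In base `B > 2^a` the expansion of `(1 + B)^a` has no carries, so its digits are the binomial
coefficients. -/
theorem choose_eq_digit {B a b : ℕ} (hB : 2 ^ a < B) (hb : b ≤ a) :
    (1 + B) ^ a / B ^ b % B = a.choose b := by
  have h : (1 + B) ^ a = ∑ i ∈ Finset.range (a + 1), a.choose i * B ^ i := by
    rw [add_comm, add_pow]
    refine Finset.sum_congr rfl fun i _ => ?_
    simp [mul_comm]
  rw [h]
  exact digit_extract (c := fun i => a.choose i) (fun i => (Nat.choose_le_two_pow a i).trans_lt hB)
    (Nat.lt_succ_of_le hb)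

/-! ### The Hamming weight as a 2-adic valuation -/

theorem HW_eq_sum_digits (m : ℕ) : HW m = (Nat.digits 2 m).sum := by
  have : ∀ l : List ℕ, (∀ d ∈ l, d < 2) → l.count 1 = l.sum := by
    intro l
    induction l with
    | nil => simp
    | cons d l ih =>
      intro h
      have hd := h d (by simp)
      rw [List.count_cons, List.sum_cons, ih fun e he => h e (by simp [he])]
      interval_cases d <;> simp [add_comm]
  exact this _ fun d hd => Nat.digits_lt_base (by norm_num) hd

theorem HW_two_mul (m : ℕ) : HW (2 * m) = HW m := by
  simpa using HW_bit m 0 (by norm_num)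

/-- Kummer's theorem: the exponent is `s(m) + s(m) - s(2m)` with `s` the binary digit sum, and
doubling does not change `s`. -/
theorem padicValNat_centralBinom (m : ℕ) : padicValNat 2 ((2 * m).choose m) = HW m := by
  have h := sub_one_mul_padicValNat_choose_eq_sub_sum_digits' (p := 2) (k := m) (n := m)
  rw [← two_mul, ← HW_eq_sum_digits, ← HW_eq_sum_digits, HW_two_mul] at h
  omega

theorem two_pow_HW_dvd (m : ℕ) : 2 ^ HW m ∣ (2 * m).choose m := by
  rw [← padicValNat_centralBinom]; exact pow_padicValNat_dvd

theorem not_two_pow_HW_succ_dvd (m : ℕ) : ¬ 2 ^ (HW m + 1) ∣ (2 * m).choose m := by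
  rw [← padicValNat_centralBinom]
  exact pow_succ_padicValNat_not_dvd (Nat.choose_pos (by omega)).ne'

theorem HW_le_choose (m : ℕ) : HW m ≤ (2 * m).choose m :=
  (Nat.lt_two_pow_self).le.trans (Nat.le_of_dvd (Nat.choose_pos (by omega)) (two_pow_HW_dvd m))

/-- The exponent of the second argument exceeds the valuation by far, so the gcd is the full power
of `2` dividing the binomial coefficient. This expresses `2 ^ HW m` through operations available to
arithmetic terms. -/
theorem gcd_two_pow_eq (m : ℕ) :
    Nat.gcd ((2 * m).choose m) (2 ^ (2 * m).choose m) = 2 ^ HW m := by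
  obtain ⟨j, -, hj⟩ := (Nat.dvd_prime_pow Nat.prime_two).1
    (Nat.gcd_dvd_right ((2 * m).choose m) (2 ^ (2 * m).choose m))
  rw [hj]
  congr 1
  refine le_antisymm ?_ ?_
  · by_contra h
    refine not_two_pow_HW_succ_dvd m ((pow_dvd_pow 2 (Nat.lt_of_not_le h)).trans ?_)
    rw [← hj]; exact Nat.gcd_dvd_left _ _
  · have : 2 ^ HW m ∣ 2 ^ j := by
      rw [← hj]
      exact Nat.dvd_gcd (two_pow_HW_dvd m) (pow_dvd_pow 2 (HW_le_choose m))
    exact (Nat.pow_dvd_pow_iff_le_right (by norm_num)).1 this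

/-- The number of solutions of `a * i + b * j = a * b`. -/
theorem card_lattice_points {a b : ℕ} (ha : 0 < a) (hb : 0 < b) :
    ((Finset.range (b + 1) ×ˢ Finset.range (a + 1)).filter
      fun p => a * p.1 + b * p.2 = a * b).card = Nat.gcd a b + 1 := by
  obtain ⟨g, a', b', hg, hco, ha', hb'⟩ := Nat.exists_coprime' (Nat.gcd_pos_of_pos_left b ha)
  have hgg : Nat.gcd a b = g := by
    rw [ha', hb', Nat.gcd_mul_right, hco.gcd_eq_one, one_mul]
  rw [hgg]
  have ha0 : 0 < a' := Nat.pos_of_mul_pos_right (ha' ▸ ha)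
  have hb0 : 0 < b' := Nat.pos_of_mul_pos_right (hb' ▸ hb)
  rw [← Finset.card_range (g + 1)]
  symm
  -- Writing `a = a' g`, `b = b' g` with `a'`, `b'` coprime, the solutions are the `g + 1` points
  -- `(s b', (g - s) a')`.
  refine Finset.card_bij (fun s _ => (s * b', (g - s) * a')) ?_ ?_ ?_
  · intro s hs
    obtain ⟨w, rfl⟩ : ∃ w, g = s + w := ⟨g - s, by simp at hs; omega⟩
    simp only [Finset.mem_filter, Finset.mem_product, Finset.mem_range, ha', hb',
      Nat.add_sub_cancel_left]
    refine ⟨⟨?_, ?_⟩, by ring⟩ <;> nlinarith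
  · intro s _ s' _ h
    simp only [Prod.mk.injEq] at h
    exact Nat.eq_of_mul_eq_mul_right hb0 h.1
  · rintro ⟨i, j⟩ h
    simp only [Finset.mem_filter, ha', hb'] at h
    have h1 : a' * i + b' * j = g * (a' * b') := by
      have := h.2
      have h2 : g * (a' * i + b' * j) = g * (g * (a' * b')) := by linarith
      exact Nat.eq_of_mul_eq_mul_left hg h2
    have h2 : b' ∣ i := by
      refine hco.symm.dvd_of_dvd_mul_left ?_
      rw [← Nat.dvd_add_left (Nat.dvd_mul_right b' j), h1]
      exact ⟨g * a', by ring⟩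
    obtain ⟨s, rfl⟩ := h2
    have h3 : a' * s + j = g * a' := by
      refine Nat.eq_of_mul_eq_mul_left hb0 ?_
      linarith
    have h4 : s ≤ g := by
      refine Nat.le_of_mul_le_mul_left (?_ : a' * s ≤ a' * g) ha0
      linarith
    refine ⟨s, by simp; omega, ?_⟩
    obtain ⟨w, rfl⟩ : ∃ w, g = s + w := ⟨g - s, by omega⟩
    rw [Nat.add_sub_cancel_left]
    ext
    · simp [mul_comm]
    · simp; linarith

/-- The product is the generating function of the values `a i + b j` over the rectangle, and the
coefficient at `a b` is counted by `card_lattice_points`. The base `2^(a+b+1)` exceeds the number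
`(a+1)(b+1)` of all pairs, so coefficients are digits. -/
theorem gcd_eq_digit {a b : ℕ} (ha : 0 < a) (hb : 0 < b) :
    (∑ i ∈ Finset.range (b + 1), (2 ^ (a + b + 1)) ^ (a * i)) *
      (∑ j ∈ Finset.range (a + 1), (2 ^ (a + b + 1)) ^ (b * j)) / (2 ^ (a + b + 1)) ^ (a * b)
      % 2 ^ (a + b + 1) = Nat.gcd a b + 1 := by
  set X := 2 ^ (a + b + 1) with hX
  let S := Finset.range (b + 1) ×ˢ Finset.range (a + 1)
  let c : ℕ → ℕ := fun n => (S.filter fun p => a * p.1 + b * p.2 = n).card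
  have hc : ∀ n, c n < X := by
    intro n
    refine (Finset.card_filter_le _ _).trans_lt ?_
    rw [Finset.card_product, Finset.card_range, Finset.card_range, hX, pow_succ, pow_add]
    have h1 : a + 1 ≤ 2 ^ a := Nat.lt_two_pow_self
    have h2 : b + 1 ≤ 2 ^ b := Nat.lt_two_pow_self
    have := Nat.mul_le_mul h1 h2
    have h3 : 0 < 2 ^ a * 2 ^ b := by positivity
    linarith
  have hM : ∀ p ∈ S, a * p.1 + b * p.2 ∈ Finset.range (2 * (a * b) + 1) := by
    rintro ⟨i, j⟩ h
    simp only [S, Finset.mem_product, Finset.mem_range] at h ⊢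
    have := Nat.mul_le_mul_left a (Nat.le_of_lt_succ h.1)
    have := Nat.mul_le_mul_left b (Nat.le_of_lt_succ h.2)
    linarith
  have h : (∑ i ∈ Finset.range (b + 1), X ^ (a * i)) * (∑ j ∈ Finset.range (a + 1), X ^ (b * j)) =
      ∑ n ∈ Finset.range (2 * (a * b) + 1), c n * X ^ n := by
    rw [Finset.sum_mul_sum, ← Finset.sum_product', ← Finset.sum_fiberwise_of_maps_to hM]
    refine Finset.sum_congr rfl fun n _ => ?_
    rw [← smul_eq_mul (c n), ← Finset.sum_const]
    refine Finset.sum_congr rfl fun p hp => ?_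
    rw [← (Finset.mem_filter.1 hp).2, pow_add]
  rw [h, digit_extract hc (by linarith [Nat.zero_le (a * b)])]
  exact card_lattice_points ha hb

/-- Recovers `k` from `2^k`. With `M = 2^(n+2) - 1` the power is `(M + 1)^k`, which is `1 + k M`
modulo `M²`, and `1 + k M < M²` because `k ≤ n < M`. -/
theorem log_eq_mod_div {k n : ℕ} (hk : k ≤ n) :
    (2 ^ k) ^ (n + 2) % ((2 ^ (n + 2) - 1) * (2 ^ (n + 2) - 1)) / (2 ^ (n + 2) - 1) = k := by
  obtain ⟨M, hM⟩ : ∃ M, 2 ^ (n + 2) = M + 1 := ⟨2 ^ (n + 2) - 1, by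
    have : 1 ≤ 2 ^ (n + 2) := Nat.one_le_two_pow
    omega⟩
  have hn : n + 2 < M + 1 := hM ▸ Nat.lt_two_pow_self
  have h : ∀ k : ℕ, ∃ s, (M + 1) ^ k = 1 + k * M + s * (M * M) := by
    intro k
    induction k with
    | zero => exact ⟨0, by simp⟩
    | succ k ih =>
      obtain ⟨s, hs⟩ := ih
      exact ⟨s + s * M + k, by rw [pow_succ, hs]; ring⟩
  obtain ⟨s, hs⟩ := h k
  rw [← pow_mul, mul_comm, pow_mul, hM, hs, Nat.add_sub_cancel, Nat.add_mul_mod_self_right,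
    Nat.mod_eq_of_lt (by nlinarith), Nat.add_mul_div_right _ _ (by omega),
    Nat.div_eq_of_lt (by omega), zero_add]

/-! ### Closure properties of arithmetic terms -/

namespace IsArithmeticTerm

variable {f g : ℕ → ℕ}

theorem const (c : ℕ) : IsArithmeticTerm fun _ => c := ⟨.const c, fun _ => rfl⟩

theorem var : IsArithmeticTerm fun n => n := ⟨.var, fun _ => rfl⟩

theorem add (hf : IsArithmeticTerm f) (hg : IsArithmeticTerm g) :
    IsArithmeticTerm fun n => f n + g n := by
  obtain ⟨a, ha⟩ := hf
  obtain ⟨b, hb⟩ := hg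
  exact ⟨.add a b, fun n => by rw [ArithTerm.eval, ha, hb]⟩

theorem monus (hf : IsArithmeticTerm f) (hg : IsArithmeticTerm g) :
    IsArithmeticTerm fun n => f n - g n := by
  obtain ⟨a, ha⟩ := hf
  obtain ⟨b, hb⟩ := hg
  exact ⟨.monus a b, fun n => by rw [ArithTerm.eval, ha, hb]⟩

theorem mul (hf : IsArithmeticTerm f) (hg : IsArithmeticTerm g) :
    IsArithmeticTerm fun n => f n * g n := by
  obtain ⟨a, ha⟩ := hf
  obtain ⟨b, hb⟩ := hg
  exact ⟨.mul a b, fun n => by rw [ArithTerm.eval, ha, hb]⟩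

theorem div (hf : IsArithmeticTerm f) (hg : IsArithmeticTerm g) :
    IsArithmeticTerm fun n => f n / g n := by
  obtain ⟨a, ha⟩ := hf
  obtain ⟨b, hb⟩ := hg
  exact ⟨.div a b, fun n => by rw [ArithTerm.eval, ha, hb]⟩

theorem pow (hf : IsArithmeticTerm f) (hg : IsArithmeticTerm g) :
    IsArithmeticTerm fun n => f n ^ g n := by
  obtain ⟨a, ha⟩ := hf
  obtain ⟨b, hb⟩ := hg
  exact ⟨.pow a b, fun n => by rw [ArithTerm.eval, ha, hb]⟩

theorem mod (hf : IsArithmeticTerm f) (hg : IsArithmeticTerm g) :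
    IsArithmeticTerm fun n => f n % g n := by
  have h : (fun n => f n % g n) = fun n => f n - g n * (f n / g n) := by
    funext n
    have := Nat.mod_add_div (f n) (g n)
    omega
  rw [h]
  exact hf.monus (hg.mul (hf.div hg))

theorem two_pow (hf : IsArithmeticTerm f) : IsArithmeticTerm fun n => 2 ^ f n := (const 2).pow hf

theorem choose (hf : IsArithmeticTerm f) (hg : IsArithmeticTerm g) (h : ∀ n, g n ≤ f n) :
    IsArithmeticTerm fun n => (f n).choose (g n) := by
  have h1 : (fun n => (f n).choose (g n)) = fun n =>
      (1 + 2 ^ (f n + 1)) ^ f n / (2 ^ (f n + 1)) ^ g n % 2 ^ (f n + 1) := by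
    funext n
    rw [choose_eq_digit (Nat.pow_lt_pow_right (by norm_num) (by omega)) (h n)]
  have hB := (hf.add (const 1)).two_pow
  rw [h1]
  exact ((((const 1).add hB).pow hf).div (hB.pow hg)).mod hB

theorem geomSum (hf : IsArithmeticTerm f) (hg : IsArithmeticTerm g) (h : ∀ n, 2 ≤ f n) :
    IsArithmeticTerm fun n => ∑ i ∈ Finset.range (g n), f n ^ i := by
  have h1 : (fun n => ∑ i ∈ Finset.range (g n), f n ^ i) = fun n =>
      (f n ^ g n - 1) / (f n - 1) := by
    funext n
    exact Nat.geomSum_eq (h n) _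
  rw [h1]
  exact ((hf.pow hg).monus (const 1)).div (hf.monus (const 1))

theorem gcd (hf : IsArithmeticTerm f) (hg : IsArithmeticTerm g) (hf0 : ∀ n, 0 < f n)
    (hg0 : ∀ n, 0 < g n) : IsArithmeticTerm fun n => Nat.gcd (f n) (g n) := by
  have h1 : (fun n => Nat.gcd (f n) (g n)) = fun n =>
      (∑ i ∈ Finset.range (g n + 1), ((2 ^ (f n + g n + 1)) ^ f n) ^ i) *
      (∑ j ∈ Finset.range (f n + 1), ((2 ^ (f n + g n + 1)) ^ g n) ^ j) /
        (2 ^ (f n + g n + 1)) ^ (f n * g n) % 2 ^ (f n + g n + 1) - 1 := by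
    funext n
    simp only [← pow_mul (2 ^ (f n + g n + 1))]
    rw [gcd_eq_digit (hf0 n) (hg0 n), Nat.add_sub_cancel]
  have hX := ((hf.add hg).add (const 1)).two_pow
  have hge : ∀ k l : ℕ, 0 < l → 2 ≤ (2 ^ (k + 1)) ^ l := fun k l hl => by
    rw [← pow_mul]
    exact (pow_one 2).symm.le.trans (Nat.pow_le_pow_right (by norm_num) (Nat.mul_pos k.succ_pos hl))
  rw [h1]
  exact (((((hX.pow hf).geomSum (hg.add (const 1)) fun n => hge _ _ (hf0 n)).mul
    ((hX.pow hg).geomSum (hf.add (const 1)) fun n => hge _ _ (hg0 n))).div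
    (hX.pow (hf.mul hg))).mod hX).monus (const 1)

theorem hw (hf : IsArithmeticTerm f) : IsArithmeticTerm fun n => HW (f n) := by
  have hN : IsArithmeticTerm fun n => (2 * f n).choose (f n) :=
    ((const 2).mul hf).choose hf fun n => by omega
  have hN0 : ∀ n, 0 < (2 * f n).choose (f n) := fun n => Nat.choose_pos (by omega)
  have hg := hN.gcd hN.two_pow hN0 fun n => by positivity
  have hM := (hN.add (const 2)).two_pow.monus (const 1)
  have h1 : (fun n => HW (f n)) = fun n =>
      Nat.gcd ((2 * f n).choose (f n)) (2 ^ (2 * f n).choose (f n)) ^ ((2 * f n).choose (f n) + 2)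
        % ((2 ^ ((2 * f n).choose (f n) + 2) - 1) * (2 ^ ((2 * f n).choose (f n) + 2) - 1))
        / (2 ^ ((2 * f n).choose (f n) + 2) - 1) := by
    funext n
    rw [gcd_two_pow_eq, log_eq_mod_div (HW_le_choose _)]
  rw [h1]
  exact ((hg.pow (hN.add (const 2))).mod (hM.mul hM)).div hM

end IsArithmeticTerm

/-- Differences of two functions given by arithmetic terms. -/
def IsIntTerm (f : ℕ → ℤ) : Prop :=
  ∃ a b : ℕ → ℕ, IsArithmeticTerm a ∧ IsArithmeticTerm b ∧ ∀ n, f n = a n - b n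

/-! ### Closure properties of integer-valued terms -/

namespace IsIntTerm

variable {f g : ℕ → ℤ}

theorem ofNat {a : ℕ → ℕ} (ha : IsArithmeticTerm a) : IsIntTerm fun n => (a n : ℤ) :=
  ⟨a, fun _ => 0, ha, .const 0, fun n => by simp⟩

theorem const (c : ℤ) : IsIntTerm fun _ => c :=
  ⟨fun _ => c.toNat, fun _ => (-c).toNat, .const _, .const _, fun _ => by simp only; omega⟩

theorem add (hf : IsIntTerm f) (hg : IsIntTerm g) : IsIntTerm fun n => f n + g n := by
  obtain ⟨a, b, ha, hb, h⟩ := hf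
  obtain ⟨c, d, hc, hd, h'⟩ := hg
  exact ⟨_, _, ha.add hc, hb.add hd, fun n => by simp only [h, h']; push_cast; ring⟩

theorem neg (hf : IsIntTerm f) : IsIntTerm fun n => -f n := by
  obtain ⟨a, b, ha, hb, h⟩ := hf
  exact ⟨b, a, hb, ha, fun n => by simp only [h]; ring⟩

theorem sub (hf : IsIntTerm f) (hg : IsIntTerm g) : IsIntTerm fun n => f n - g n := by
  simpa only [sub_eq_add_neg] using hf.add hg.neg

theorem mul (hf : IsIntTerm f) (hg : IsIntTerm g) : IsIntTerm fun n => f n * g n := by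
  obtain ⟨a, b, ha, hb, h⟩ := hf
  obtain ⟨c, d, hc, hd, h'⟩ := hg
  exact ⟨_, _, (ha.mul hc).add (hb.mul hd), (ha.mul hd).add (hb.mul hc),
    fun n => by simp only [h, h']; push_cast; ring⟩

theorem pow (hf : IsIntTerm f) (r : ℕ) : IsIntTerm fun n => f n ^ r := by
  induction r with
  | zero => simpa using const 1
  | succ r ih => simpa only [pow_succ] using ih.mul hf

theorem sum {ι : Type*} (s : Finset ι) {F : ι → ℕ → ℤ} (h : ∀ i ∈ s, IsIntTerm (F i)) :
    IsIntTerm fun n => ∑ i ∈ s, F i n := by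
  classical
  induction s using Finset.induction_on with
  | empty => simpa using const 0
  | insert i s hi ih =>
    simp only [Finset.sum_insert hi]
    exact (h i (by simp)).add (ih fun j hj => h j (by simp [hj]))

theorem prod {ι : Type*} (s : Finset ι) {F : ι → ℕ → ℤ} (h : ∀ i ∈ s, IsIntTerm (F i)) :
    IsIntTerm fun n => ∏ i ∈ s, F i n := by
  classical
  induction s using Finset.induction_on with
  | empty => simpa using const 1
  | insert i s hi ih =>
    simp only [Finset.prod_insert hi]
    exact (h i (by simp)).mul (ih fun j hj => h j (by simp [hj]))

theorem toNat (hf : IsIntTerm f) : IsArithmeticTerm fun n => (f n).toNat := by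
  obtain ⟨a, b, ha, hb, h⟩ := hf
  have : (fun n => (f n).toNat) = fun n => a n - b n := by funext n; rw [h]; omega
  rw [this]
  exact ha.monus hb

/-- An exact quotient needs no sign convention: the positive and the negative part of the numerator
are divided separately, and one of them is zero. -/
theorem of_mul_eq {d : ℕ → ℕ} (hf : IsIntTerm f) (hd : IsArithmeticTerm d) (hd0 : ∀ n, 0 < d n)
    (h : ∀ n, g n * d n = f n) : IsIntTerm g := by
  refine ⟨_, _, hf.toNat.div hd, hf.neg.toNat.div hd, fun n => ?_⟩
  rw [← h]
  have hp := hd0 n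
  rcases Int.eq_nat_or_neg (g n) with ⟨k, hk | hk⟩
  · rw [hk, ← Nat.cast_mul, Int.toNat_natCast, Int.toNat_neg_natCast, Nat.mul_div_cancel _ hp]
    simp
  · rw [hk, neg_mul, neg_neg, ← Nat.cast_mul, Int.toNat_natCast, Int.toNat_neg_natCast,
      Nat.mul_div_cancel _ hp]
    simp

end IsIntTerm

/-- Telescope `(j+1)^r q^(j+1) - j^r q^j` over `j < t` and expand `(j+1)^r`. This recursion
expresses `geomG r` by the lower `geomG s` and one exact division by `q - 1`, so each fixed `r`
gives a term. -/
theorem geomG_succ_eq (r : ℕ) (q : ℤ) (t : ℕ) :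
    geomG r q t * (q - 1) = (t : ℤ) ^ r * q ^ t - 0 ^ r
      - q * ∑ s ∈ Finset.range r, (r.choose s : ℤ) * geomG s q t := by
  induction t with
  | zero => simp [geomG]
  | succ t ih =>
    have h : ∀ s, geomG s q (t + 1) = geomG s q t + (t : ℤ) ^ s * q ^ t := fun s => by
      rw [geomG, Finset.sum_range_succ]; rfl
    simp only [h, mul_add, Finset.sum_add_distrib, add_mul]
    rw [ih]
    have h2 : ((t + 1 : ℕ) : ℤ) ^ r = (t : ℤ) ^ r + ∑ s ∈ Finset.range r, (r.choose s : ℤ) * t ^ s := by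
      rw [Nat.cast_add, Nat.cast_one, add_pow, Finset.sum_range_succ, add_comm]
      simp [mul_comm]
    have h3 : ∑ s ∈ Finset.range r, (r.choose s : ℤ) * ((t : ℤ) ^ s * q ^ t) =
        (∑ s ∈ Finset.range r, (r.choose s : ℤ) * t ^ s) * q ^ t := by
      rw [Finset.sum_mul]
      exact Finset.sum_congr rfl fun s _ => by ring
    rw [h2, h3]
    ring

theorem IsIntTerm.geomG {q t : ℕ → ℕ} (hq : IsArithmeticTerm q) (ht : IsArithmeticTerm t)
    (hq2 : ∀ n, 2 ≤ q n) (r : ℕ) : IsIntTerm fun n => geomG r (q n) (t n) := by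
  induction r using Nat.strong_induction_on with
  | _ r ih =>
    have hs : IsIntTerm fun n => ((t n : ℕ) : ℤ) ^ r * ((q n ^ t n : ℕ) : ℤ) - 0 ^ r
        - (q n : ℤ) * ∑ s ∈ Finset.range r, (r.choose s : ℤ) * NthPrime.geomG s (q n) (t n) :=
      ((((ofNat ht).pow r).mul (ofNat (hq.pow ht))).sub (const _)).sub ((ofNat hq).mul
        (sum _ fun s hs => (const _).mul (ih s (Finset.mem_range.1 hs))))
    refine hs.of_mul_eq (hq.monus (.const 1)) (fun n => by have := hq2 n; omega) fun n => ?_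
    rw [Nat.cast_sub (by have := hq2 n; omega), Nat.cast_one, geomG_succ_eq, Nat.cast_pow]

/-! ### The arithmetic terms of the theorem -/

theorem isArithmeticTerm_tPar : IsArithmeticTerm tPar :=
  (((((IsArithmeticTerm.const 2).mul (IsArithmeticTerm.var.pow (.const 4))).add
    (.const 16)).two_pow).two_pow).two_pow

theorem isArithmeticTerm_uPar : IsArithmeticTerm uPar :=
  (((((IsArithmeticTerm.const 9).mul isArithmeticTerm_tPar).add (.const 8)).two_pow).add
    (.const 9)).two_pow

theorem IsIntTerm.hypercubeC (k : ℕ) {c : ℕ → ℤ} {t u : ℕ → ℕ} (hc : IsIntTerm c)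
    (ht : IsArithmeticTerm t) (hu : IsArithmeticTerm u) :
    IsIntTerm fun n => hypercubeC k (c n) (t n) (u n) := by
  have h : IsIntTerm fun n => (((2 ^ u n : ℕ) : ℤ) - c n + 1) *
      (((2 ^ (2 * u n * t n ^ k) : ℕ) : ℤ) - 1) :=
    (((ofNat hu.two_pow).sub hc).add (const 1)).mul
      ((ofNat (((IsArithmeticTerm.const 2).mul hu).mul (ht.pow (.const k))).two_pow).sub (const 1))
  refine h.of_mul_eq (hu.two_pow.add (.const 1)) (fun n => by positivity) fun n => ?_
  push_cast
  exact hypercubeC_mul k (c n) (t n) (u n)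

theorem IsIntTerm.hypercubeA (k : ℕ) (m : Fin k ⊕ Fin k →₀ ℕ) {c : ℕ → ℤ} {t u : ℕ → ℕ}
    (hc : IsIntTerm c) (ht : IsArithmeticTerm t) (hu : IsArithmeticTerm u)
    (hq : ∀ n i, 1 ≤ 2 * u n * t n ^ i) :
    IsIntTerm fun n => hypercubeA k (c n) m (t n) (u n) := by
  refine IsIntTerm.mul (IsIntTerm.mul ?_ hc) (IsIntTerm.prod _ fun i _ => ?_)
  · simpa using ((ofNat hu.two_pow).sub (const 1)).neg
  · have hX := (((IsArithmeticTerm.const 2).mul hu).mul (ht.pow (.const (i : ℕ)))).two_pow.mul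
      (.const (2 ^ m (Sum.inr i)))
    have := IsIntTerm.geomG hX ht (fun n => ?_) (m (Sum.inl i))
    · simpa using this
    · have h1 : 2 ^ 1 ≤ 2 ^ (2 * u n * t n ^ (i : ℕ)) := Nat.pow_le_pow_right (by norm_num) (hq n i)
      have h2 : 1 ≤ 2 ^ m (Sum.inr i) := Nat.one_le_two_pow
      nlinarith

/-- The variable `n` enters only through `2^n` in the last square, so every coefficient is a fixed
quadratic polynomial in `2^n`. -/
theorem Fhat_eq : ∃ A B D : ExpPoly 42, ∀ n, Fhat n =
    A + MvPolynomial.C (2 ^ n) * B + MvPolynomial.C ((2 ^ n) ^ 2) * D := by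
  obtain ⟨R, S, T, h⟩ : ∃ R S T : ExpPoly 42, ∀ n, Fhat n = R + (S - MvPolynomial.C (2 ^ n) * T) ^ 2 := by
    refine ⟨EFact (x 1) (fun j => x (8 + j)) (x 2).val + ((x 3).val - (x 2).val ^ 2) ^ 2
      + ((x 4).val - (x 2).val * (x 3).val) ^ 2 + ((x 5).val - 4 * (x 2).val - 1) ^ 2
      + EM4 (x 2) (x 3) (x 4) (x 5).val (fun j => x (21 + j)) (x 6).val
      + EHW (x 6) (fun j => x (30 + j)) (x 7), (x 7).val + (4 * (x 2).val + 5) * (-(x 5).val ^ 2 + (x 8).val), 4 * (x 2).val + 5,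
      fun n => ?_⟩
    unfold Fhat
    refine congrArg₂ (· + ·) rfl ?_
    rw [map_pow, show (MvPolynomial.C 2 : ExpPoly 42) = 2 from map_ofNat _ 2]
    ring
  refine ⟨R + S ^ 2, -2 * S * T, T ^ 2, fun n => ?_⟩
  rw [h, map_pow MvPolynomial.C (2 ^ n) 2]
  ring

/-- The support of `Fhat n` might depend on `n`. Monomials with coefficient zero contribute nothing,
so one fixed finite set serves for all `n`. -/
theorem hypercubeTerm_eq_of_subset {k : ℕ} (F : ExpPoly k) (t u : ℕ)
    {s : Finset (Fin k ⊕ Fin k →₀ ℕ)} (hs : F.support ⊆ s) :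
    hypercubeTerm F t u = hypercubeC k (F.coeff 0) t u +
      ∑ m ∈ s.erase 0, hypercubeA k (F.coeff m) m t u := by
  classical
  rw [hypercubeTerm]
  congr 1
  refine Finset.sum_subset (Finset.erase_subset_erase _ hs) fun m h1 h2 => ?_
  have : F.coeff m = 0 := by
    by_contra h
    exact h2 (Finset.mem_erase.2 ⟨(Finset.mem_erase.1 h1).1, MvPolynomial.mem_support_iff.2 h⟩)
  simp [hypercubeA, this]

theorem tPar_pos (n : ℕ) : 0 < tPar n := Nat.pow_pos (by norm_num)

theorem uPar_pos (n : ℕ) : 0 < uPar n := Nat.pow_pos (by norm_num)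

theorem isIntTerm_Qhat : IsIntTerm Qhat := by
  classical
  obtain ⟨A, B, D, h⟩ := Fhat_eq
  have hcoeff : ∀ n m, (Fhat n).coeff m = A.coeff m + ((2 ^ n : ℕ) : ℤ) * B.coeff m +
      ((2 ^ n : ℕ) : ℤ) ^ 2 * D.coeff m := fun n m => by
    rw [h, MvPolynomial.coeff_add, MvPolynomial.coeff_add, MvPolynomial.coeff_C_mul,
      MvPolynomial.coeff_C_mul, Nat.cast_pow, Nat.cast_ofNat]
  have hc : ∀ m, IsIntTerm fun n => (Fhat n).coeff m := fun m => by
    simp only [hcoeff]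
    have h2 := IsIntTerm.ofNat IsArithmeticTerm.var.two_pow
    exact ((IsIntTerm.const _).add (h2.mul (.const _))).add ((h2.pow 2).mul (.const _))
  have hQ : Qhat = fun n => hypercubeC 42 ((Fhat n).coeff 0) (tPar n) (uPar n) +
      ∑ m ∈ (A.support ∪ B.support ∪ D.support).erase 0,
        hypercubeA 42 ((Fhat n).coeff m) m (tPar n) (uPar n) := by
    funext n
    refine hypercubeTerm_eq_of_subset _ _ _ fun m hm => ?_
    by_contra hn
    simp only [Finset.mem_union, MvPolynomial.mem_support_iff, not_or, not_not] at hn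
    rw [MvPolynomial.mem_support_iff, hcoeff, hn.1.1, hn.1.2, hn.2] at hm
    simp at hm
  rw [hQ]
  refine IsIntTerm.add (IsIntTerm.hypercubeC _ (hc 0) isArithmeticTerm_tPar isArithmeticTerm_uPar)
    (IsIntTerm.sum _ fun m _ => IsIntTerm.hypercubeA _ _ (hc m) isArithmeticTerm_tPar
      isArithmeticTerm_uPar fun n i => ?_)
  exact Nat.mul_pos (Nat.mul_pos (by norm_num) (uPar_pos n)) (Nat.pow_pos (tPar_pos n))

theorem isArithmeticTerm_rhs :
    IsArithmeticTerm (fun n => HW (Qhat n).toNat / uPar n - tPar n ^ 42) :=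
  (isIntTerm_Qhat.toNat.hw.div isArithmeticTerm_uPar).monus (isArithmeticTerm_tPar.pow (.const 42))

/-! ### Integer division formulas for binomial coefficients and factorials -/

/-- The cofactor of `D = (D + y) - y` in `(D + y)^(N+1) - y^(N+1)` has last term `y^N`, all others
being multiples of `D + y`. Only this shape of the quotient matters in `choose_eq_div_mod`. -/
theorem pow_succ_eq_mul_add (D y N : ℕ) :
    ∃ S, (D + y) ^ (N + 1) = D * (y ^ N + (D + y) * S) + y ^ (N + 1) := by
  induction N with
  | zero => exact ⟨0, by ring⟩
  | succ N ih =>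
    obtain ⟨S, hS⟩ := ih
    exact ⟨y ^ N + (D + y) * S, by rw [pow_succ, hS]; ring⟩

/-- With `B = 2^(2N+4)`, this says `(B+1)^(N+1) < B^(N+2) - B - 1`: the power is a genuine remainder
for the divisor in `choose_eq_div_mod`. -/
theorem choose_aux_lt (N : ℕ) :
    (2 ^ (2 * N + 4) + 1) ^ (N + 1) + 2 ^ (2 * N + 4) + 1 < (2 ^ (2 * N + 4)) ^ (N + 2) := by
  set B := 2 ^ (2 * N + 4) with hB
  have h1 : 2 ^ (N + 1) * 2 ≤ B := by
    rw [← pow_succ, hB]; exact Nat.pow_le_pow_right (by norm_num) (by omega)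
  have h16 : 16 ≤ B := by
    rw [hB, pow_add]; have : 1 ≤ 2 ^ (2 * N) := Nat.one_le_two_pow
    omega
  have h2 : (B + 1) ^ (N + 1) ≤ 2 ^ (N + 1) * B ^ (N + 1) := by
    rw [← mul_pow]; exact Nat.pow_le_pow_left (by omega) _
  have h3 : B ≤ B ^ (N + 1) := Nat.le_self_pow (by omega) _
  have h4 : 2 ≤ 2 ^ (N + 1) := Nat.le_self_pow (by omega) _
  have h5 : B ^ (N + 2) = B * B ^ (N + 1) := by ring
  have h6 : 2 * B ≤ 2 ^ (N + 1) * B ^ (N + 1) := Nat.mul_le_mul h4 h3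
  have h7 : 2 ^ (N + 1) * 2 * B ^ (N + 1) ≤ B * B ^ (N + 1) := Nat.mul_le_mul_right _ h1
  rw [h5]
  linarith

/-- A formula using powers of `2` only, since `(1 + B)^N` is not available as an exponential
polynomial with base `2`. Let `D = B^(N+2) - B - 1`. Dividing `(B^(N+2))^(N+1) = (D + B + 1)^(N+1)`
by `D` leaves `(B+1)^N` plus a multiple of `B^(N+2)`. The numerator here is that power divided by
`B^(N-k)`, so reduction modulo `B` yields digit `N - k` of `(B+1)^N`. -/
theorem choose_eq_div_mod {N k : ℕ} (hk : k ≤ N) :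
    (2 ^ (2 * N + 4)) ^ (N ^ 2 + 2 * N + k + 2) /
      ((2 ^ (2 * N + 4)) ^ (N + 2) - 2 ^ (2 * N + 4) - 1) % 2 ^ (2 * N + 4) = N.choose k := by
  have hlt := choose_aux_lt N
  have hB2 : 2 ^ N < 2 ^ (2 * N + 4) := Nat.pow_lt_pow_right (by norm_num) (by omega)
  set B := 2 ^ (2 * N + 4) with hB
  have hB0 : 0 < B := by positivity
  obtain ⟨D, hD⟩ : ∃ D, B ^ (N + 2) = D + (B + 1) := ⟨B ^ (N + 2) - (B + 1), by omega⟩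
  have hD' : B ^ (N + 2) - B - 1 = D := by omega
  have hDlt : (B + 1) ^ (N + 1) < D := by omega
  obtain ⟨S, hS⟩ := pow_succ_eq_mul_add D (B + 1) N
  have he : B ^ (N ^ 2 + 2 * N + k + 2) * B ^ (N - k) = (D + (B + 1)) ^ (N + 1) := by
    rw [← hD, ← pow_mul B, ← pow_add B]
    congr 1
    obtain ⟨w, rfl⟩ := Nat.exists_eq_add_of_le hk
    rw [Nat.add_sub_cancel_left]; ring
  have h1 : B ^ (N ^ 2 + 2 * N + k + 2) / D =
      ((B + 1) ^ N + (D + (B + 1)) * S) / B ^ (N - k) := by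
    rw [← Nat.mul_div_mul_right (B ^ (N ^ 2 + 2 * N + k + 2)) D (Nat.pow_pos hB0 : 0 < B ^ (N - k)),
      he, hS, ← Nat.div_div_eq_div_mul, add_comm (D * _), Nat.add_mul_div_left _ _ (by omega),
      Nat.div_eq_of_lt hDlt, zero_add]
  have h2 : (D + (B + 1)) * S = B ^ (N - k) * (B * (B ^ (k + 1) * S)) := by
    rw [← hD, ← mul_assoc, ← mul_assoc, ← pow_succ, ← pow_add]
    congr 2
    omega
  rw [hD', h1, h2, Nat.add_mul_div_left _ _ (Nat.pow_pos hB0), Nat.add_mul_mod_self_left,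
    add_comm B 1, choose_eq_digit hB2 (Nat.sub_le _ _), Nat.choose_symm hk]

/-- The estimate `r^k - r(r-1)⋯(r-k+1) ≤ k² r^(k-1)`, multiplied by `r` and rearranged to avoid
subtraction. -/
theorem pow_mul_le_descFactorial (r k : ℕ) (hk : k ≤ r) :
    r ^ k * r ≤ r * r.descFactorial k + k ^ 2 * r ^ k := by
  induction k with
  | zero => simp
  | succ k ih =>
    have h := ih (by omega)
    have h1 : r.descFactorial k ≤ r ^ k := Nat.descFactorial_le_pow r k
    rw [Nat.descFactorial_succ]
    obtain ⟨w, hw⟩ := Nat.exists_eq_add_of_le (show k ≤ r by omega)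
    have h2 : r - k = w := by omega
    rw [h2]
    have h3 : r * r.descFactorial k = k * r.descFactorial k + w * r.descFactorial k := by
      rw [← add_mul, ← hw]
    have h4 := Nat.mul_le_mul_left (k * r) h1
    calc r ^ (k + 1) * r = r * (r ^ k * r) := by ring
      _ ≤ r * (r * r.descFactorial k + k ^ 2 * r ^ k) := Nat.mul_le_mul_left _ h
      _ = r * (w * r.descFactorial k) + k * r * r.descFactorial k + k ^ 2 * r ^ (k + 1) := by
          rw [h3]; ring
      _ ≤ r * (w * r.descFactorial k) + k * r * r ^ k + k ^ 2 * r ^ (k + 1) := by gcongr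
      _ ≤ r * (w * r.descFactorial k) + (k + 1) ^ 2 * r ^ (k + 1) := by
          have : k * r * r ^ k = k * r ^ (k + 1) := by ring
          rw [this]
          nlinarith [Nat.zero_le (r ^ (k + 1)), Nat.zero_le (k * r ^ (k + 1))]

theorem sq_mul_factorial_lt {a : ℕ} (ha : 1 ≤ a) : a ^ 2 * (a.factorial + 1) < 2 ^ (3 * a ^ 2) := by
  have h1 : a.factorial ≤ 2 ^ (a ^ 2) := by
    refine (Nat.factorial_le_pow a).trans ?_
    rw [sq, pow_mul]
    exact Nat.pow_le_pow_left Nat.lt_two_pow_self.le _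
  have h2 : a ^ 2 < 2 ^ (a ^ 2) := Nat.lt_two_pow_self
  have h3 : 2 ≤ 2 ^ (a ^ 2) := Nat.le_self_pow (by positivity) _
  rw [mul_comm 3, pow_mul]
  set X := 2 ^ (a ^ 2) with hX
  calc a ^ 2 * (a.factorial + 1) ≤ a ^ 2 * (X + X) := Nat.mul_le_mul_left _ (by omega)
    _ < X * (X + X) := Nat.mul_lt_mul_of_pos_right h2 (by omega)
    _ = X * X * 2 := by ring
    _ ≤ X * X * X := Nat.mul_le_mul_left _ h3
    _ = X ^ 3 := by ring

/-- With `r = 2^(3a²)` the fraction is `r^a / choose r a = a! * r^a / (r(r-1)⋯(r-a+1))`, slightly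
above `a!`. Since `r > a²(a! + 1)`, the excess is less than `1`. -/
theorem factorial_eq_div (a : ℕ) :
    2 ^ (3 * a ^ 3) / (2 ^ (3 * a ^ 2)).choose a = a.factorial := by
  rcases Nat.eq_zero_or_pos a with rfl | ha
  · simp
  have hlt := sq_mul_factorial_lt ha
  have hr : 2 ^ (3 * a ^ 3) = (2 ^ (3 * a ^ 2)) ^ a := by rw [← pow_mul]; congr 1; ring
  rw [hr]
  set r := 2 ^ (3 * a ^ 2) with hrdef
  have hfac : 1 ≤ a.factorial := Nat.factorial_pos a
  have har : a ≤ r := by nlinarith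
  have hd := pow_mul_le_descFactorial r a har
  have h1 : r.descFactorial a = a.factorial * r.choose a := Nat.descFactorial_eq_factorial_mul_choose r a
  have h2 : r.descFactorial a ≤ r ^ a := Nat.descFactorial_le_pow r a
  have hr0 : 0 < r := by positivity
  have hra : 0 < r ^ a := by positivity
  refine Nat.div_eq_of_lt_le (by rw [← h1]; exact h2) ?_
  rw [add_mul, one_mul, ← h1]
  have h3 : a ^ 2 * (a.factorial + 1) * r ^ a < r * r ^ a := Nat.mul_lt_mul_of_pos_right hlt hra
  have h4 : a.factorial * (r ^ a * r) ≤ a.factorial * (r * r.descFactorial a + a ^ 2 * r ^ a) :=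
    Nat.mul_le_mul_left _ hd
  -- Multiplying by `a! * r` turns the binomial coefficient into a descending factorial, to which
  -- `hd` applies.
  refine Nat.lt_of_mul_lt_mul_left (a := a.factorial * r) ?_
  have h5 : a.factorial * r * (r.descFactorial a + r.choose a) =
      a.factorial * (r * r.descFactorial a) + r * r.descFactorial a := by rw [h1]; ring
  rw [h5]
  nlinarith

/-! ### Closed forms of the generalized geometric progressions -/

theorem geomG_succ (r : ℕ) (q : ℤ) (t : ℕ) :
    geomG r q (t + 1) = geomG r q t + (t : ℤ) ^ r * q ^ t := by
  rw [geomG, Finset.sum_range_succ]; rfl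

theorem geomG_nonneg (r : ℕ) {q : ℤ} (hq : 0 ≤ q) (t : ℕ) : 0 ≤ geomG r q t :=
  Finset.sum_nonneg fun _ _ => by positivity

theorem geomG_zero_mul (q : ℤ) (t : ℕ) : geomG 0 q t * (q - 1) = q ^ t - 1 := by
  simpa [geomG] using geom_sum_mul q t

/-- This and the next closed forms are written for `t = s + 1`, with the power `q^(t-1)` visible, so
that they match the squares of `EM4` literally. -/
theorem geomG_one_mul (q : ℤ) (s : ℕ) :
    geomG 1 q (s + 1) * (q - 1) ^ 2 = q * (s * q ^ (s + 1) - (s + 1) * q ^ s + 1) := by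
  induction s with
  | zero => simp [geomG]
  | succ s ih =>
    rw [geomG_succ, add_mul, ih]
    push_cast
    ring

theorem geomG_two_mul (q : ℤ) (s : ℕ) :
    geomG 2 q (s + 1) * (q - 1) ^ 3 = q * (s ^ 2 * (q ^ s * q ^ 2)
      - (2 * s ^ 2 + 2 * s - 1) * q ^ (s + 1) + (s + 1) ^ 2 * q ^ s - q - 1) := by
  induction s with
  | zero => simp [geomG]
  | succ s ih =>
    rw [geomG_succ, add_mul, ih]
    push_cast
    ring

theorem geomG_four_mul (q : ℤ) (s : ℕ) :
    geomG 4 q (s + 1) * (q - 1) ^ 5 = q * (s ^ 4 * (q ^ s * q ^ 4)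
      + (-4 * s ^ 4 - 12 * s ^ 3 - 6 * s ^ 2 + 12 * s + 11) * q ^ (s + 1)
      + (6 * s ^ 4 + 12 * s ^ 3 - 6 * s ^ 2 - 12 * s + 11) * (q ^ s * q ^ 2)
      + (-4 * s ^ 4 - 4 * s ^ 3 + 6 * s ^ 2 - 4 * s + 1) * (q ^ s * q ^ 3)
      + (s + 1) ^ 4 * q ^ s - q ^ 3 - 11 * q ^ 2 - 11 * q - 1) := by
  induction s with
  | zero =>
    simp only [geomG, Finset.sum_range_succ, Finset.sum_range_zero]
    push_cast
    ring
  | succ s ih =>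
    rw [geomG_succ, add_mul, ih]
    push_cast
    ring

/-! ### Square roots of `1` modulo `4 * a !` -/

/-- The number of square roots of `1` modulo `n`. -/
def sqrtOneCount (n : ℕ) : ℕ := Nat.card {x : ZMod n // x ^ 2 = 1}

theorem sqrtOneCount_mul {m n : ℕ} (h : m.Coprime n) :
    sqrtOneCount (m * n) = sqrtOneCount m * sqrtOneCount n := by
  unfold sqrtOneCount
  rw [← Nat.card_prod]
  let e := ZMod.chineseRemainder h
  refine Nat.card_congr ((e.toEquiv.subtypeEquiv (q := fun p => p.1 ^ 2 = 1 ∧ p.2 ^ 2 = 1) ?_).trans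
    (Equiv.subtypeProdEquivProd (p := fun x : ZMod m => x ^ 2 = 1) (q := fun x : ZMod n => x ^ 2 = 1)))
  intro x
  rw [← map_eq_one_iff e e.injective, map_pow, Prod.ext_iff]
  rfl

theorem sqrtOneCount_one : sqrtOneCount 1 = 1 := by
  rw [sqrtOneCount, Nat.card_eq_one_iff_unique]
  exact ⟨⟨fun a b => Subtype.ext (Subsingleton.elim _ _)⟩, ⟨⟨1, one_pow 2⟩⟩⟩

/-- An odd prime cannot divide both `z - 1` and `z + 1`, so `p^k` divides one of them. -/
theorem sqrtOneCount_prime_pow {p k : ℕ} (hp : p.Prime) (hp2 : p ≠ 2) (hk : k ≠ 0) :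
    sqrtOneCount (p ^ k) = 2 := by
  have hp3 : 2 < p := lt_of_le_of_ne hp.two_le (Ne.symm hp2)
  have h2 : 2 < p ^ k := hp3.trans_le (Nat.le_self_pow hk p)
  have : Fact (2 < p ^ k) := ⟨h2⟩
  have hset : {x : ZMod (p ^ k) | x ^ 2 = 1} = {1, -1} := by
    ext x
    obtain ⟨z, rfl⟩ := ZMod.intCast_surjective x
    simp only [Set.mem_ofPred_eq, Set.mem_insert_iff, Set.mem_singleton_iff]
    refine ⟨fun h => ?_, by rintro (h | h) <;> rw [h] <;> ring⟩
    have h1 : ((p : ℤ) ^ k) ∣ (z - 1) * (z + 1) := by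
      have : (((z - 1) * (z + 1) : ℤ) : ZMod (p ^ k)) = 0 := by push_cast; linear_combination h
      rw [ZMod.intCast_zmod_eq_zero_iff_dvd] at this
      exact_mod_cast this
    have hpi : Prime (p : ℤ) := Nat.prime_iff_prime_int.1 hp
    by_cases hd : (p : ℤ) ∣ z - 1
    · left
      have h3 : ¬ (p : ℤ) ∣ z + 1 := fun h => by
        have := Int.le_of_dvd (by norm_num) ((show (2 : ℤ) = (z + 1) - (z - 1) by ring) ▸ dvd_sub h hd)
        omega
      have h4 : IsCoprime ((p : ℤ) ^ k) (z + 1) := ((hpi.coprime_iff_not_dvd).2 h3).pow_left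
      have h5 := h4.dvd_of_dvd_mul_right h1
      have : ((z - 1 : ℤ) : ZMod (p ^ k)) = 0 := by
        rw [ZMod.intCast_zmod_eq_zero_iff_dvd]; exact_mod_cast h5
      push_cast at this
      linear_combination this
    · right
      have h4 : IsCoprime ((p : ℤ) ^ k) (z - 1) := ((hpi.coprime_iff_not_dvd).2 hd).pow_left
      have h5 := h4.dvd_of_dvd_mul_left h1
      have : ((z + 1 : ℤ) : ZMod (p ^ k)) = 0 := by
        rw [ZMod.intCast_zmod_eq_zero_iff_dvd]; exact_mod_cast h5
      push_cast at this
      linear_combination this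
  change Nat.card ({x : ZMod (p ^ k) | x ^ 2 = 1} : Set _) = 2
  rw [hset, Nat.card_coe_set_eq, Set.ncard_pair (ZMod.neg_one_ne_one).symm]

/-- Write the modulus as `8J`. A root is odd, `z = 2y + 1`, and the condition becomes `2J ∣ y(y+1)`.
By coprimality the power of two `2J` divides `y` or `y + 1`, which gives the four classes `±1` and
`4J ± 1`. -/
theorem sqrtOneCount_two_pow {k : ℕ} (hk : 3 ≤ k) : sqrtOneCount (2 ^ k) = 4 := by
  obtain ⟨j, rfl⟩ := Nat.exists_eq_add_of_le' hk
  have hdvd : ∀ z : ℤ, ((z : ℤ) : ZMod (2 ^ (j + 3))) = 0 ↔ 8 * (2 : ℤ) ^ j ∣ z := fun z => by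
    rw [ZMod.intCast_zmod_eq_zero_iff_dvd, Nat.cast_pow, Nat.cast_ofNat, pow_add]; norm_num [mul_comm]
  have hJ : (0 : ℤ) < 2 ^ j := by positivity
  have hJ1 : (1 : ℤ) ≤ 2 ^ j := by exact_mod_cast Nat.one_le_two_pow
  set J : ℤ := 2 ^ j with hJdef
  have hne : ∀ z w : ℤ, 0 < |z - w| → |z - w| < 8 * J →
      ((z : ℤ) : ZMod (2 ^ (j + 3))) ≠ ((w : ℤ) : ZMod (2 ^ (j + 3))) := by
    intro z w h1 h2 h
    have h3 : ((z - w : ℤ) : ZMod (2 ^ (j + 3))) = 0 := by rw [Int.cast_sub, h, sub_self]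
    rw [hdvd, ← dvd_abs] at h3
    exact absurd (Int.le_of_dvd h1 h3) (not_le.2 h2)
  have hset : {x : ZMod (2 ^ (j + 3)) | x ^ 2 = 1} =
      (({1, -1, 4 * J + 1, 4 * J - 1} : Finset ℤ).image
        (fun z : ℤ => (z : ZMod (2 ^ (j + 3)))) : Set _) := by
    ext x
    obtain ⟨z, rfl⟩ := ZMod.intCast_surjective x
    simp only [Set.mem_ofPred_eq, Finset.coe_image, Set.mem_image, Finset.mem_coe,
      Finset.mem_insert, Finset.mem_singleton, exists_eq_or_imp, exists_eq_left]
    have hsq : (z : ZMod (2 ^ (j + 3))) ^ 2 = 1 ↔ 8 * J ∣ z ^ 2 - 1 := by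
      rw [← hdvd]; push_cast; exact sub_eq_zero.symm
    have heq : ∀ w : ℤ, ((w : ℤ) : ZMod (2 ^ (j + 3))) = (z : ZMod (2 ^ (j + 3))) ↔ 8 * J ∣ z - w := by
      intro w
      rw [← hdvd]; push_cast; rw [sub_eq_zero]; exact eq_comm
    rw [hsq, heq, heq, heq, heq]
    constructor
    · intro h
      have hodd : z % 2 = 1 := by
        have h2 : (2 : ℤ) ∣ z ^ 2 - 1 := ((show (2:ℤ) ∣ 8 * J from ⟨4 * J, by ring⟩)).trans h
        rcases Int.emod_two_eq_zero_or_one z with h0 | h0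
        · exfalso
          obtain ⟨y, rfl⟩ := Int.dvd_of_emod_eq_zero h0
          obtain ⟨w, hw⟩ := h2
          have : 2 * (2 * y ^ 2 - w) = 1 := by linarith
          omega
        · exact h0
      obtain ⟨y, rfl⟩ : ∃ y, z = 2 * y + 1 := ⟨z / 2, by omega⟩
      have h1 : 2 * J ∣ y * (y + 1) := by
        refine (mul_dvd_mul_iff_left (show (4 : ℤ) ≠ 0 by norm_num)).1 ?_
        have e1 : 4 * (2 * J) = 8 * J := by ring
        have e2 : 4 * (y * (y + 1)) = (2 * y + 1) ^ 2 - 1 := by ring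
        rwa [e1, e2]
      have h2J : 2 * J = 2 ^ (j + 1) := by rw [pow_succ, mul_comm]
      -- Knowing `w` modulo `2J` leaves two possibilities for `2w` modulo `8J`, namely `0` and `4J`.
      have hsplit : ∀ w, 2 * J ∣ w → (8 * J ∣ 2 * w ∨ 8 * J ∣ 2 * w - 4 * J) := by
        rintro w ⟨c, rfl⟩
        rcases Int.even_or_odd' c with ⟨d, rfl | rfl⟩
        · left; exact ⟨d, by ring⟩
        · right; exact ⟨d, by ring⟩
      have hcop : IsCoprime y (y + 1) := ⟨-1, 1, by ring⟩
      rcases Int.even_or_odd y with he | ho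
      · have hc : IsCoprime (2 * J) (y + 1) := by
          rw [h2J]
          refine IsCoprime.pow_left ?_
          exact Int.isCoprime_two_left.2 he.add_one
        rcases hsplit y (hc.dvd_of_dvd_mul_right h1) with h | h
        · left; convert h using 1; ring
        · right; right; left; convert h using 1; ring
      · have hc : IsCoprime (2 * J) y := by
          rw [h2J]
          refine IsCoprime.pow_left ?_
          exact Int.isCoprime_two_left.2 ho
        rcases hsplit (y + 1) (hc.dvd_of_dvd_mul_left h1) with h | h
        · right; left; convert h using 1; ring
        · right; right; right; convert h using 1; ring
    · have hcomb : ∀ w, 8 * J ∣ z - w → 8 * J ∣ w ^ 2 - 1 → 8 * J ∣ z ^ 2 - 1 := by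
        intro w h1 h2
        have := dvd_add (h1.mul_right (z + w)) h2
        rwa [show (z - w) * (z + w) + (w ^ 2 - 1) = z ^ 2 - 1 by ring] at this
      rintro (h | h | h | h) <;> refine hcomb _ h ?_
      · simp
      · simp
      · exact ⟨2 * J + 1, by ring⟩
      · exact ⟨2 * J - 1, by ring⟩
  change Nat.card ({x : ZMod (2 ^ (j + 3)) | x ^ 2 = 1} : Set _) = 4
  rw [hset, Nat.card_coe_set_eq, Set.ncard_coe_finset, Finset.card_image_of_injOn]
  · rw [Finset.card_insert_of_notMem, Finset.card_insert_of_notMem, Finset.card_insert_of_notMem,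
      Finset.card_singleton] <;> simp only [Finset.mem_insert, Finset.mem_singleton] <;> omega
  · intro z hz w hw h
    by_contra hzw
    refine hne z w (abs_pos.2 (sub_ne_zero.2 hzw)) ?_ h
    simp only [Finset.coe_insert, Finset.coe_singleton, Set.mem_insert_iff,
      Set.mem_singleton_iff] at hz hw
    rw [abs_lt]
    omega

theorem sqrtOneCount_four : sqrtOneCount 4 = 2 := by
  rw [sqrtOneCount, Nat.card_eq_fintype_card]; decide

/-- By the Chinese remainder theorem each odd prime up to `a` contributes a factor `2`. The factor
`4` in the modulus ensures that for `a ≥ 2` it is divisible by `8`, so the prime `2` contributes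
`4`; for `a < 2` the modulus is `4`, with two roots, which fits the same formula. -/
theorem sqrtOneCount_four_mul_factorial (a : ℕ) :
    sqrtOneCount (4 * a.factorial) = 2 ^ (Nat.primeCounting a + 1) := by
  rcases Nat.lt_or_ge a 2 with ha | ha
  · have h1 : Nat.primeCounting a = 0 := Nat.primeCounting_eq_zero_iff.2 (by omega)
    have h2 : a.factorial = 1 := Nat.factorial_eq_one.2 (by omega)
    rw [h1, h2]
    exact sqrtOneCount_four
  have hN : 4 * a.factorial ≠ 0 := by positivity
  rw [Nat.multiplicative_factorization sqrtOneCount (fun m n h => sqrtOneCount_mul h)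
    sqrtOneCount_one hN, Finsupp.prod, Nat.support_factorization]
  have hpf : (4 * a.factorial).primeFactors = Nat.primesLE a := by
    ext p
    rw [Nat.mem_primeFactors, Nat.mem_primesLE]
    constructor
    · rintro ⟨hp, hd, -⟩
      refine ⟨?_, hp⟩
      rcases hp.dvd_mul.1 hd with h | h
      · have : p ∣ 2 := hp.dvd_of_dvd_pow (show p ∣ 2 ^ 2 from h)
        exact (Nat.le_of_dvd (by norm_num) this).trans ha
      · exact (hp.dvd_factorial).1 h
    · rintro ⟨h, hp⟩
      exact ⟨hp, ((hp.dvd_factorial).2 h).mul_left 4, hN⟩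
  have hval : ∀ p ∈ Nat.primesLE a,
      sqrtOneCount (p ^ (4 * a.factorial).factorization p) = 2 * if p = 2 then 2 else 1 := by
    intro p hp
    have hp' := (Nat.mem_primesLE.1 hp)
    split_ifs with h
    · subst h
      refine sqrtOneCount_two_pow ?_
      refine (hp'.2.pow_dvd_iff_le_factorization hN).1 ?_
      exact mul_dvd_mul (show 4 ∣ 4 from dvd_rfl) (hp'.2.dvd_factorial.2 ha)
    · refine sqrtOneCount_prime_pow hp'.2 h ?_
      rw [← Finsupp.mem_support_iff, Nat.support_factorization, hpf]
      exact hp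
  rw [hpf, Finset.prod_congr rfl hval, Finset.prod_mul_distrib, Finset.prod_const,
    Nat.primesLE_card_eq_primeCounting, Finset.prod_ite_eq' , if_pos, pow_succ]
  exact Nat.mem_primesLE.2 ⟨ha, Nat.prime_two⟩

/-! ### Evaluation of linear forms -/

namespace LinForm

variable {k : ℕ}

/-- The value of a linear form at a point with natural coordinates. -/
def nval (x : Fin k → ℕ) (l : LinForm k) : ℕ := l.const + ∑ i, l.coeff i * x i

theorem nval_add (x : Fin k → ℕ) (l l' : LinForm k) : nval x (l + l') = nval x l + nval x l' := by
  change (l.const + l'.const) + ∑ i, (l.coeff i + l'.coeff i) * x i = _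
  simp only [nval, add_mul, Finset.sum_add_distrib]
  ring

theorem nval_smul (x : Fin k → ℕ) (c : ℕ) (l : LinForm k) : nval x (c • l) = c * nval x l := by
  change c * l.const + ∑ i, (c * l.coeff i) * x i = _
  simp only [nval, mul_add, Finset.mul_sum, mul_assoc]

theorem nval_cst (x : Fin k → ℕ) (c : ℕ) : nval x (cst c) = c := by
  simp [nval, cst]

theorem nval_var (x : Fin k → ℕ) (i : Fin k) : nval x (var i) = x i := by
  simp [nval, var, Pi.single_apply]

end LinForm

/-! ### Evaluation of the relations; quotient and remainder -/

section Relations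

variable {k : ℕ}

theorem ev_val (x : Fin k → ℕ) (l : LinForm k) : ev x l.val = (nval x l : ℤ) := by
  simp [ev, val, nval]

theorem ev_pow2 (x : Fin k → ℕ) (l : LinForm k) : ev x (pow2 l) = 2 ^ nval x l := by
  simp only [ev, pow2, nval, map_mul, map_prod, map_pow, MvPolynomial.eval_C, MvPolynomial.eval_X,
    Sum.elim_inr, pow_add]
  rw [← Finset.prod_pow_eq_pow_sum]
  congr 1
  refine Finset.prod_congr rfl fun i _ => ?_
  rw [← pow_mul, mul_comm]

theorem ev_EDiv (x : Fin k → ℕ) {x₁ x₂ x₃ : ExpPoly k} {a b c : ℕ} (h₁ : ev x x₁ = a)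
    (h₂ : ev x x₂ = b) (h₃ : ev x x₃ = c) (y : ℕ → LinForm k) :
    ev x (EDiv x₁ x₂ y x₃) = ((a : ℤ) - b * c - nval x (y 1)) ^ 2
      + ((nval x (y 1) : ℤ) + nval x (y 2) + 1 - b) ^ 2 := by
  simp only [EDiv, map_add, map_sub, map_mul, map_pow, map_one, h₁, h₂, h₃, ev_val]

theorem ev_EMod (x : Fin k → ℕ) {x₁ x₂ x₃ : ExpPoly k} {a b c : ℕ} (h₁ : ev x x₁ = a)
    (h₂ : ev x x₂ = b) (h₃ : ev x x₃ = c) (y : ℕ → LinForm k) :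
    ev x (EMod x₁ x₂ y x₃) = ((a : ℤ) - b * nval x (y 1) - c) ^ 2
      + ((c : ℤ) + nval x (y 2) + 1 - b) ^ 2 := by
  simp only [EMod, map_add, map_sub, map_mul, map_pow, map_one, h₁, h₂, h₃, ev_val]

theorem sq_add_sq_eq_zero (p q : ℤ) : p ^ 2 + q ^ 2 = 0 ↔ p = 0 ∧ q = 0 := by
  rw [add_eq_zero_iff_of_nonneg (sq_nonneg p) (sq_nonneg q), sq_eq_zero_iff, sq_eq_zero_iff]

theorem sq_add_sq_add_eq_zero (p q : ℤ) {a b : ℤ} (ha : 0 ≤ a) (hb : 0 ≤ b) :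
    p ^ 2 + q ^ 2 + a + b = 0 ↔ p = 0 ∧ q = 0 ∧ a = 0 ∧ b = 0 := by
  have hp := sq_nonneg p
  have hq := sq_nonneg q
  rw [← sq_eq_zero_iff (a := p), ← sq_eq_zero_iff (a := q)]
  omega

theorem sq_add_sq_add_sq_add_eq_zero (p q r : ℤ) {a b : ℤ} (ha : 0 ≤ a) (hb : 0 ≤ b) :
    p ^ 2 + q ^ 2 + r ^ 2 + a + b = 0 ↔ p = 0 ∧ q = 0 ∧ r = 0 ∧ a = 0 ∧ b = 0 := by
  have hp := sq_nonneg p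
  have hq := sq_nonneg q
  have hr := sq_nonneg r
  rw [← sq_eq_zero_iff (a := p), ← sq_eq_zero_iff (a := q), ← sq_eq_zero_iff (a := r)]
  omega

theorem add_sq_add_sq_add_sq_eq_zero (p q r : ℤ) {a : ℤ} (ha : 0 ≤ a) :
    a + (p ^ 2 + (q ^ 2 + r ^ 2)) = 0 ↔ a = 0 ∧ p = 0 ∧ q = 0 ∧ r = 0 := by
  have hp := sq_nonneg p
  have hq := sq_nonneg q
  have hr := sq_nonneg r
  rw [← sq_eq_zero_iff (a := p), ← sq_eq_zero_iff (a := q), ← sq_eq_zero_iff (a := r)]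
  omega

/-- The squares of division with remainder vanish exactly for quotient and remainder. -/
theorem div_rem_iff (a b c r s : ℕ) (hb : 0 < b) :
    ((a : ℤ) - b * c - r) ^ 2 + ((r : ℤ) + s + 1 - b) ^ 2 = 0 ↔
      c = a / b ∧ r = a % b ∧ s = b - 1 - a % b := by
  rw [sq_add_sq_eq_zero]
  constructor
  · rintro ⟨h1, h2⟩
    have h3 : a = r + b * c := by zify; linarith
    have h4 : r + s + 1 = b := by zify; linarith
    have hr : r < b := by omega
    have e1 : a / b = c := by
      rw [h3, Nat.add_mul_div_left _ _ hb, Nat.div_eq_of_lt hr, zero_add]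
    have e2 : a % b = r := by
      rw [h3, Nat.add_mul_mod_self_left, Nat.mod_eq_of_lt hr]
    exact ⟨e1.symm, e2.symm, by omega⟩
  · rintro ⟨rfl, rfl, rfl⟩
    have h1 := Nat.mod_add_div a b
    have h2 := Nat.mod_lt a hb
    constructor
    · have h3 : (a : ℤ) = ((a % b + b * (a / b) : ℕ) : ℤ) := by rw [h1]
      push_cast at h3 ⊢
      linarith
    · omega

theorem ev_EDiv_nonneg (x : Fin k → ℕ) (x₁ x₂ x₃ : ExpPoly k) (y : ℕ → LinForm k) :
    0 ≤ ev x (EDiv x₁ x₂ y x₃) := by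
  rw [EDiv, map_add, map_pow, map_pow]; exact add_nonneg (sq_nonneg _) (sq_nonneg _)

theorem ev_EMod_nonneg (x : Fin k → ℕ) (x₁ x₂ x₃ : ExpPoly k) (y : ℕ → LinForm k) :
    0 ≤ ev x (EMod x₁ x₂ y x₃) := by
  rw [EMod, map_add, map_pow, map_pow]; exact add_nonneg (sq_nonneg _) (sq_nonneg _)

theorem ev_EDiv_eq_zero_iff (x : Fin k → ℕ) {x₁ x₂ x₃ : ExpPoly k} {a b c : ℕ} (h₁ : ev x x₁ = a)
    (h₂ : ev x x₂ = b) (h₃ : ev x x₃ = c) (hb : 0 < b) (y : ℕ → LinForm k) :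
    ev x (EDiv x₁ x₂ y x₃) = 0 ↔
      c = a / b ∧ nval x (y 1) = a % b ∧ nval x (y 2) = b - 1 - a % b := by
  rw [ev_EDiv x h₁ h₂ h₃, div_rem_iff _ _ _ _ _ hb]

theorem ev_EMod_eq_zero_iff (x : Fin k → ℕ) {x₁ x₂ x₃ : ExpPoly k} {a b c : ℕ} (h₁ : ev x x₁ = a)
    (h₂ : ev x x₂ = b) (h₃ : ev x x₃ = c) (hb : 0 < b) (y : ℕ → LinForm k) :
    ev x (EMod x₁ x₂ y x₃) = 0 ↔
      c = a % b ∧ nval x (y 1) = a / b ∧ nval x (y 2) = b - 1 - a % b := by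
  rw [ev_EMod x h₁ h₂ h₃, div_rem_iff _ _ _ _ _ hb]
  tauto

/-! ### The binomial coefficient -/

/-- The first exponent in the relation for the binomial coefficient. -/
def binE₁ (N j : ℕ) : ℕ := 2 * N ^ 3 + 8 * N ^ 2 + 2 * N * j + 12 * N + 4 * j + 8

/-- The second exponent in the relation for the binomial coefficient. -/
def binE₂ (N : ℕ) : ℕ := 2 * N ^ 2 + 8 * N + 8

/-- The divisor in the relation for the binomial coefficient. -/
def binD (N : ℕ) : ℕ := 2 ^ binE₂ N - 2 ^ (2 * N + 4) - 1

/-- The witnesses of the relation for the binomial coefficient. -/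
def binW (N j : ℕ) : ℕ → ℕ
  | 1 => binE₁ N j
  | 2 => binE₂ N
  | 3 => 2 ^ binE₁ N j / binD N
  | 4 => 2 ^ binE₁ N j % binD N
  | 5 => binD N - 1 - 2 ^ binE₁ N j % binD N
  | 6 => 2 ^ binE₁ N j / binD N / 2 ^ (2 * N + 4)
  | _ => 2 ^ (2 * N + 4) - 1 - 2 ^ binE₁ N j / binD N % 2 ^ (2 * N + 4)

theorem two_pow_binE₂ (N : ℕ) : 2 ^ binE₂ N = (2 ^ (2 * N + 4)) ^ (N + 2) := by
  rw [← pow_mul]; congr 1; unfold binE₂; ring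

theorem binD_add (N : ℕ) : binD N + 2 ^ (2 * N + 4) + 1 = 2 ^ binE₂ N ∧ 0 < binD N := by
  have h := choose_aux_lt N
  rw [← two_pow_binE₂] at h
  have h2 : 0 < (2 ^ (2 * N + 4) + 1) ^ (N + 1) := by positivity
  unfold binD
  omega

theorem bin_eq_choose {N j : ℕ} (hj : j ≤ N) :
    2 ^ binE₁ N j / binD N % 2 ^ (2 * N + 4) = N.choose j := by
  rw [← choose_eq_div_mod hj, binD, two_pow_binE₂]
  congr 2
  rw [← pow_mul]; congr 1; unfold binE₁; ring

theorem ev_EBinom_nonneg (x : Fin k → ℕ) (x₁ x₂ : LinForm k) (y : ℕ → LinForm k) (x₃ : ExpPoly k) :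
    0 ≤ ev x (EBinom x₁ x₂ y x₃) := by
  rw [EBinom, map_add, map_add, map_add, map_pow, map_pow]
  have h1 := ev_EDiv_nonneg x (pow2 (y 1)) (pow2 (y 2) - pow2 (2 • x₁ + cst 4) - 1) (y 3).val
    (fun j => y (3 + j))
  have h2 := ev_EMod_nonneg x (y 3).val (pow2 (2 • x₁ + cst 4)) x₃ (fun j => y (5 + j))
  exact add_nonneg (add_nonneg (add_nonneg (sq_nonneg _) (sq_nonneg _)) h1) h2

/-- Single-foldness: the squares hold exactly when the binomial coefficient is correct and every
auxiliary unknown has its prescribed value. -/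
theorem ev_EBinom_eq_zero_iff (x : Fin k → ℕ) (x₁ x₂ : LinForm k) (y : ℕ → LinForm k)
    {x₃ : ExpPoly k} {c : ℕ} (h₃ : ev x x₃ = c) (hle : nval x x₂ ≤ nval x x₁) :
    ev x (EBinom x₁ x₂ y x₃) = 0 ↔
      (∀ j, 1 ≤ j → j ≤ 7 → nval x (y j) = binW (nval x x₁) (nval x x₂) j) ∧
        c = (nval x x₁).choose (nval x x₂) := by
  set N := nval x x₁ with hN
  set l := nval x x₂ with hl
  have hB : ev x (pow2 (2 • x₁ + cst 4)) = ((2 ^ (2 * N + 4) : ℕ) : ℤ) := by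
    rw [ev_pow2, nval_add, nval_smul, nval_cst]; push_cast; rfl
  have h1 : ev x (((y 1).val - (2 * x₁.val ^ 3 + 8 * x₁.val ^ 2 + 2 * x₁.val * x₂.val + 12 * x₁.val
      + 4 * x₂.val + 8)) ^ 2) = ((nval x (y 1) : ℤ) - (binE₁ N l : ℕ)) ^ 2 := by
    simp only [map_pow, map_sub, map_add, map_mul, ev_val, map_ofNat, binE₁]
    push_cast
    rfl
  have h2 : ev x (((y 2).val - (2 * x₁.val ^ 2 + 8 * x₁.val + 8)) ^ 2) =
      ((nval x (y 2) : ℤ) - (binE₂ N : ℕ)) ^ 2 := by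
    simp only [map_pow, map_sub, map_add, map_mul, ev_val, map_ofNat, binE₂]
    push_cast
    rfl
  have n3 := ev_EDiv_nonneg x (pow2 (y 1)) (pow2 (y 2) - pow2 (2 • x₁ + cst 4) - 1) (y 3).val
    (fun j => y (3 + j))
  have n4 := ev_EMod_nonneg x (y 3).val (pow2 (2 • x₁ + cst 4)) x₃ (fun j => y (5 + j))
  rw [EBinom, map_add, map_add, map_add, h1, h2, sq_add_sq_add_eq_zero _ _ n3 n4, sub_eq_zero,
    sub_eq_zero, Nat.cast_inj, Nat.cast_inj]
  -- The divisor is known to be the positive number `binD N` only after the first two squares have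
  -- fixed the exponents, so the two division relations are analysed under these equations.
  have key : nval x (y 1) = binE₁ N l → nval x (y 2) = binE₂ N →
      (ev x (EDiv (pow2 (y 1)) (pow2 (y 2) - pow2 (2 • x₁ + cst 4) - 1) (fun j => y (3 + j)) (y 3).val) = 0 ∧
        ev x (EMod (y 3).val (pow2 (2 • x₁ + cst 4)) (fun j => y (5 + j)) x₃) = 0 ↔
      (nval x (y 3) = binW N l 3 ∧ nval x (y 4) = binW N l 4 ∧ nval x (y 5) = binW N l 5 ∧
        nval x (y 6) = binW N l 6 ∧ nval x (y 7) = binW N l 7) ∧ c = N.choose l) := by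
    intro e1 e2
    have hD : ev x (pow2 (y 2) - pow2 (2 • x₁ + cst 4) - 1) = (binD N : ℕ) := by
      rw [map_sub, map_sub, hB, ev_pow2, e2, map_one]
      have := (binD_add N).1
      zify at this
      push_cast
      linarith
    have hP : ev x (pow2 (y 1)) = ((2 ^ binE₁ N l : ℕ) : ℤ) := by
      rw [ev_pow2, e1]; push_cast; rfl
    rw [ev_EDiv_eq_zero_iff x hP hD (ev_val x (y 3)) (binD_add N).2,
      ev_EMod_eq_zero_iff x (ev_val x (y 3)) hB h₃ (by positivity), ← bin_eq_choose hle]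
    simp only [binW, Nat.reduceAdd]
    constructor
    · rintro ⟨⟨g1, g2, g3⟩, g4, g5, g6⟩
      rw [g1] at g4 g5 g6
      exact ⟨⟨g1, g2, g3, g5, g6⟩, g4⟩
    · rintro ⟨⟨g1, g2, g3, g4, g5⟩, g6⟩
      rw [g1]
      exact ⟨⟨rfl, g2, g3⟩, g6, g4, g5⟩
  constructor
  · rintro ⟨e1, e2, e3⟩
    obtain ⟨⟨g3, g4, g5, g6, g7⟩, g8⟩ := (key e1 e2).1 e3
    refine ⟨fun j hj1 hj2 => ?_, g8⟩
    interval_cases j <;> assumption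
  · rintro ⟨h, h8⟩
    have e1 := h 1 (by norm_num) (by norm_num)
    have e2 := h 2 (by norm_num) (by norm_num)
    exact ⟨e1, e2, (key e1 e2).2 ⟨⟨h 3 (by norm_num) (by norm_num), h 4 (by norm_num) (by norm_num),
      h 5 (by norm_num) (by norm_num), h 6 (by norm_num) (by norm_num),
      h 7 (by norm_num) (by norm_num)⟩, h8⟩⟩

/-! ### The factorial -/

/-- The witnesses of the relation for the factorial. -/
def factW (a : ℕ) : ℕ → ℕ
  | 1 => a ^ 2
  | 2 => 2 ^ (3 * a ^ 2)
  | 3 => a ^ 3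
  | 4 => (2 ^ (3 * a ^ 2)).choose a
  | 12 => 2 ^ (3 * a ^ 3) % (2 ^ (3 * a ^ 2)).choose a
  | 13 => (2 ^ (3 * a ^ 2)).choose a - 1 - 2 ^ (3 * a ^ 3) % (2 ^ (3 * a ^ 2)).choose a
  | j => binW (2 ^ (3 * a ^ 2)) a (j - 4)

theorem le_two_pow_three_mul_sq (a : ℕ) : a ≤ 2 ^ (3 * a ^ 2) := by
  have h1 : a ≤ 3 * a ^ 2 := by nlinarith
  exact h1.trans Nat.lt_two_pow_self.le

theorem ev_EFact_nonneg (x : Fin k → ℕ) (x₁ : LinForm k) (y : ℕ → LinForm k) (x₂ : ExpPoly k) :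
    0 ≤ ev x (EFact x₁ y x₂) := by
  rw [EFact, map_add, map_add, map_add, map_add, map_pow, map_pow, map_pow]
  have h1 := ev_EBinom_nonneg x (y 2) x₁ (fun j => y (4 + j)) (y 4).val
  have h2 := ev_EDiv_nonneg x (pow2 (3 • y 3)) (y 4).val x₂ (fun j => y (11 + j))
  exact add_nonneg (add_nonneg (add_nonneg (add_nonneg (sq_nonneg _) (sq_nonneg _))
    (sq_nonneg _)) h1) h2

theorem ev_EFact_eq_zero_iff (x : Fin k → ℕ) (x₁ : LinForm k) (y : ℕ → LinForm k)
    {x₂ : ExpPoly k} {c : ℕ} (h₂ : ev x x₂ = c) :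
    ev x (EFact x₁ y x₂) = 0 ↔
      (∀ j, 1 ≤ j → j ≤ 13 → nval x (y j) = factW (nval x x₁) j) ∧ c = (nval x x₁).factorial := by
  set a := nval x x₁ with ha
  have n1 := ev_EBinom_nonneg x (y 2) x₁ (fun j => y (4 + j)) (y 4).val
  have n2 := ev_EDiv_nonneg x (pow2 (3 • y 3)) (y 4).val x₂ (fun j => y (11 + j))
  rw [EFact, map_add, map_add, map_add, map_add, map_pow, map_pow, map_pow,
    sq_add_sq_add_sq_add_eq_zero _ _ _ n1 n2]
  simp only [map_sub, map_mul, map_pow, ev_val, ev_pow2, nval_smul, ← ha, sub_eq_zero]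
  have key : nval x (y 1) = a ^ 2 → nval x (y 2) = 2 ^ (3 * a ^ 2) → nval x (y 3) = a ^ 3 →
      (ev x (EBinom (y 2) x₁ (fun j => y (4 + j)) (y 4).val) = 0 ∧
        ev x (EDiv (pow2 (3 • y 3)) (y 4).val (fun j => y (11 + j)) x₂) = 0 ↔
      (∀ j, 1 ≤ j → j ≤ 13 → nval x (y j) = factW a j) ∧ c = a.factorial) := by
    intro e1 e2 e3
    rw [ev_EBinom_eq_zero_iff x _ _ _ (ev_val x (y 4))
      -- The binomial relation is meaningful only for a lower argument at most the upper one, here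
      -- `a ≤ 2^(3a²)`.
      (by rw [e2, ← ha]; exact le_two_pow_three_mul_sq a), e2, ← ha]
    have hP : ev x (pow2 (3 • y 3)) = ((2 ^ (3 * a ^ 3) : ℕ) : ℤ) := by
      rw [ev_pow2, nval_smul, e3]; push_cast; rfl
    have hC : 0 < (2 ^ (3 * a ^ 2)).choose a := Nat.choose_pos (le_two_pow_three_mul_sq a)
    constructor
    · rintro ⟨⟨g1, g2⟩, g3⟩
      rw [ev_EDiv_eq_zero_iff x hP (ev_val x (y 4)) h₂ (g2 ▸ hC), g2] at g3
      refine ⟨fun j hj1 hj2 => ?_, by rw [g3.1, factorial_eq_div]⟩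
      rcases le_or_gt j 4 with h | h
      · interval_cases j
        · exact e1
        · exact e2
        · exact e3
        · exact g2
      · rcases le_or_gt j 11 with h' | h'
        · obtain ⟨i, rfl⟩ := Nat.exists_eq_add_of_le (show 4 ≤ j by omega)
          rw [g1 i (by omega) (by omega)]
          have : 1 ≤ i := by omega
          have : i ≤ 7 := by omega
          interval_cases i <;> rfl
        · interval_cases j
          · exact g3.2.1
          · exact g3.2.2
    · rintro ⟨h, hc⟩
      have g2 := h 4 (by norm_num) (by norm_num)
      refine ⟨⟨fun i hi1 hi2 => ?_, g2⟩, ?_⟩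
      · rw [h (4 + i) (by omega) (by omega)]
        interval_cases i <;> rfl
      · rw [ev_EDiv_eq_zero_iff x hP (ev_val x (y 4)) h₂ (g2 ▸ hC), g2]
        refine ⟨?_, h 12 (by norm_num) (by norm_num), h 13 (by norm_num) (by norm_num)⟩
        rw [hc, ← factorial_eq_div]
        rfl
  constructor
  · rintro ⟨e1, e2, e3, e4, e5⟩
    have e1' : nval x (y 1) = a ^ 2 := by exact_mod_cast e1
    have e2' : nval x (y 2) = 2 ^ (3 * a ^ 2) := by rw [e1'] at e2; exact_mod_cast e2
    have e3' : nval x (y 3) = a ^ 3 := by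
      rw [e1'] at e3
      have : nval x (y 3) = a * a ^ 2 := by exact_mod_cast e3
      rw [this]; ring
    exact (key e1' e2' e3').1 ⟨e4, e5⟩
  · rintro ⟨h, hc⟩
    have e1 := h 1 (by norm_num) (by norm_num)
    have e2 := h 2 (by norm_num) (by norm_num)
    have e3 := h 3 (by norm_num) (by norm_num)
    simp only [factW] at e1 e2 e3
    have := (key e1 e2 e3).2 ⟨h, hc⟩
    refine ⟨?_, ?_, ?_, this.1, this.2⟩
    · rw [e1]; push_cast; rfl
    · rw [e1, e2]; push_cast; rfl
    · rw [e1, e3]; push_cast; ring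

/-! ### The Hamming weight -/

/-- The witnesses of the relation for the Hamming weight. -/
def hwW (m : ℕ) : ℕ → ℕ
  | 1 => (2 * m).choose m
  | 9 => (2 * m).choose m / 2 ^ HW m
  | 10 => (2 * m).choose m / 2 ^ (HW m + 1)
  | 11 => (2 * m).choose m % 2 ^ (HW m + 1) - 1
  | 12 => 2 ^ (HW m + 1) - 1 - (2 * m).choose m % 2 ^ (HW m + 1)
  | j => binW (2 * m) m (j - 1)

theorem ev_EHW_nonneg (x : Fin k → ℕ) (x₁ : LinForm k) (y : ℕ → LinForm k) (x₂ : LinForm k) :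
    0 ≤ ev x (EHW x₁ y x₂) := by
  rw [EHW, ENu, EDvd, ENotDvd, map_add, map_add, map_add, map_pow, map_pow, map_pow]
  have h1 := ev_EBinom_nonneg x (2 • x₁) x₁ (fun j => y (1 + j)) (y 1).val
  exact add_nonneg h1 (add_nonneg (sq_nonneg _) (add_nonneg (sq_nonneg _) (sq_nonneg _)))

theorem eq_HW_of_dvd {m b : ℕ} (h1 : 2 ^ b ∣ (2 * m).choose m)
    (h2 : ¬ 2 ^ (b + 1) ∣ (2 * m).choose m) : b = HW m := by
  refine le_antisymm ?_ ?_ <;> by_contra h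
  · exact not_two_pow_HW_succ_dvd m ((pow_dvd_pow 2 (by omega)).trans h1)
  · exact h2 ((pow_dvd_pow 2 (by omega)).trans (two_pow_HW_dvd m))

theorem ev_EHW_eq_zero_iff (x : Fin k → ℕ) (x₁ : LinForm k) (y : ℕ → LinForm k) (x₂ : LinForm k) :
    ev x (EHW x₁ y x₂) = 0 ↔
      (∀ j, 1 ≤ j → j ≤ 12 → nval x (y j) = hwW (nval x x₁) j) ∧ nval x x₂ = HW (nval x x₁) := by
  set m := nval x x₁ with hm
  set b := nval x x₂ with hb
  have n1 := ev_EBinom_nonneg x (2 • x₁) x₁ (fun j => y (1 + j)) (y 1).val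
  rw [EHW, ENu, EDvd, ENotDvd, map_add, map_add, map_add, map_pow, map_pow, map_pow,
    add_sq_add_sq_add_sq_eq_zero _ _ _ n1,
    ev_EBinom_eq_zero_iff x _ _ _ (ev_val x (y 1)) (by rw [nval_smul]; omega)]
  simp only [map_sub, map_add, map_mul, map_one, map_ofNat, ev_val, ev_pow2, nval_smul, nval_add,
    nval_cst, ← hm, ← hb, Nat.reduceAdd]
  constructor
  · rintro ⟨⟨g1, g2⟩, g3, g4, g5⟩
    rw [g2] at g3 g4
    have e1 : (2 * m).choose m = 2 ^ b * nval x (y 9) := by zify; linarith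
    have e2 : (2 * m).choose m = nval x (y 11) + 1 + 2 ^ (b + 1) * nval x (y 10) := by zify; linarith
    have e3 : nval x (y 11) + nval x (y 12) + 2 = 2 ^ (b + 1) := by zify; linarith
    have hlt : nval x (y 11) + 1 < 2 ^ (b + 1) := by omega
    have hmod : (2 * m).choose m % 2 ^ (b + 1) = nval x (y 11) + 1 := by
      rw [e2, Nat.add_mul_mod_self_left, Nat.mod_eq_of_lt hlt]
    have hdiv : (2 * m).choose m / 2 ^ (b + 1) = nval x (y 10) := by
      rw [e2, Nat.add_mul_div_left _ _ (by positivity), Nat.div_eq_of_lt hlt, zero_add]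
    -- The remainder modulo `2^(b+1)` is `y 11 + 1`, which is nonzero; hence `b` is the exact
    -- exponent of `2`.
    have hb' : b = HW m := eq_HW_of_dvd ⟨_, e1⟩ fun h => by
      rw [Nat.dvd_iff_mod_eq_zero, hmod] at h
      omega
    refine ⟨fun j hj1 hj2 => ?_, hb'⟩
    rcases le_or_gt j 8 with h | h
    · rcases Nat.lt_or_ge j 2 with h' | h'
      · obtain rfl : j = 1 := by omega
        exact g2
      · obtain ⟨i, rfl⟩ := Nat.exists_eq_add_of_le hj1
        rw [g1 i (by omega) (by omega)]
        have : 1 ≤ i := by omega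
        have : i ≤ 7 := by omega
        interval_cases i <;> rfl
    · interval_cases j <;> simp only [hwW, ← hb']
      · rw [e1, Nat.mul_div_cancel_left _ (by positivity)]
      · exact hdiv.symm
      · rw [hmod, Nat.add_sub_cancel]
      · rw [hmod]; omega
  · rintro ⟨h, hb'⟩
    have g1 := h 1 (by norm_num) (by norm_num)
    have g9 := h 9 (by norm_num) (by norm_num)
    have g10 := h 10 (by norm_num) (by norm_num)
    have g11 := h 11 (by norm_num) (by norm_num)
    have g12 := h 12 (by norm_num) (by norm_num)
    simp only [hwW] at g1 g9 g10 g11 g12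
    have e1 := Nat.mul_div_cancel' (two_pow_HW_dvd m)
    have e2 := Nat.mod_add_div ((2 * m).choose m) (2 ^ (HW m + 1))
    have e3 := Nat.mod_lt ((2 * m).choose m) (show 0 < 2 ^ (HW m + 1) by positivity)
    have e4 : (2 * m).choose m % 2 ^ (HW m + 1) ≠ 0 := fun h =>
      not_two_pow_HW_succ_dvd m (Nat.dvd_of_mod_eq_zero h)
    refine ⟨⟨fun i hi1 hi2 => ?_, g1⟩, ?_⟩
    · rw [h (1 + i) (by omega) (by omega)]
      interval_cases i <;> rfl
    · rw [g1, hb']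
      rw [← g9] at e1
      rw [← g10] at e2
      have f1 : nval x (y 11) + 1 = (2 * m).choose m % 2 ^ (HW m + 1) := by omega
      have f2 : nval x (y 11) + nval x (y 12) + 2 = 2 ^ (HW m + 1) := by omega
      rw [← f1] at e2
      zify at e1 e2 f2
      exact ⟨by linarith, by linarith, by linarith⟩

end Relations

/-! ### The hypercube term of `(x₁² - 4 f x₂ - 1)²` -/

/-- The integer that the hypercube method builds from `(x₁² - 4 f x₂ - 1)²` with the parameters
`2`, `t = 4 f + 1`, `u = 4 f + 5`. -/
def mInt (f : ℕ) : ℤ :=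
  ∑ x : Fin 2 → Fin (4 * f + 1), (2 ^ (4 * f + 5) - 1) *
    (2 ^ (4 * f + 5) + 1 - (((x 0 : ℕ) : ℤ) ^ 2 - 4 * f * ((x 1 : ℕ) : ℤ) - 1) ^ 2) *
      ((2 : ℤ) ^ (2 * (4 * f + 5))) ^ cubeIdx x

theorem geomG_mul_geomG (r r' t : ℕ) (q : ℤ) :
    geomG r q t * geomG r' (q ^ t) t =
      ∑ x : Fin 2 → Fin t, ((x 0 : ℕ) : ℤ) ^ r * ((x 1 : ℕ) : ℤ) ^ r' * q ^ cubeIdx x := by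
  rw [geomG, geomG, Finset.sum_range, Finset.sum_range, Finset.sum_mul_sum,
    ← Fintype.sum_prod_type', ← Equiv.sum_comp (finTwoArrowEquiv (Fin t))]
  refine Finset.sum_congr rfl fun x _ => ?_
  change ((x 0 : ℕ) : ℤ) ^ r * q ^ (x 0 : ℕ) * (((x 1 : ℕ) : ℤ) ^ r' * (q ^ t) ^ (x 1 : ℕ)) = _
  simp only [cubeIdx, Fin.sum_univ_two, Fin.val_zero, Fin.val_one, pow_zero,
    pow_one, mul_one]
  rw [pow_add, mul_comm (x 1 : ℕ) t, pow_mul]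
  ring

/-- The square is `x₁⁴ - 2x₁² - 2N x₁² x₂ + N² x₂² + 2N x₂ + 1` with `N = 4f`. Each nonconstant
monomial contributes a product of two `geomG`, and `1` is the free term. -/
theorem mInt_eq (f : ℕ) {q₁ q₂ h : ℤ} (h₁ : q₁ = 2 ^ (2 * (4 * f + 5)))
    (h₂ : q₂ = q₁ ^ (4 * f + 1)) (hh : h = 1 - 2 ^ (4 * f + 5)) :
    mInt f = hypercubeC 2 1 (4 * f + 1) (4 * f + 5)
      + h * geomG 4 q₁ (4 * f + 1) * geomG 0 q₂ (4 * f + 1)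
      - 2 * (h * geomG 2 q₁ (4 * f + 1) * geomG 0 q₂ (4 * f + 1))
      - 2 * (4 * f) * (h * geomG 2 q₁ (4 * f + 1) * geomG 1 q₂ (4 * f + 1))
      + (4 * f) ^ 2 * (h * geomG 0 q₁ (4 * f + 1) * geomG 2 q₂ (4 * f + 1))
      + 2 * (4 * f) * (h * geomG 0 q₁ (4 * f + 1) * geomG 1 q₂ (4 * f + 1)) := by
  subst h₂
  simp only [mul_assoc h, geomG_mul_geomG]
  rw [hypercubeC_eq, ← Finset.mul_sum, ← sum_cube_pow, ← h₁]
  simp only [Finset.mul_sum, ← Finset.sum_add_distrib, ← Finset.sum_sub_distrib]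
  rw [mInt, ← h₁]
  refine Finset.sum_congr rfl fun x _ => ?_
  rw [hh]
  ring

theorem sq_add_one_sq_le {N : ℕ} (hN : 8 ≤ N) : (N ^ 2 + 1) ^ 2 ≤ 2 ^ (N + 5) := by
  induction N, hN using Nat.le_induction with
  | base => norm_num
  | succ N hN ih =>
    have h : ((N + 1) ^ 2 + 1) ^ 2 ≤ 2 * (N ^ 2 + 1) ^ 2 := by
      obtain ⟨w, rfl⟩ := Nat.exists_eq_add_of_le hN
      ring_nf
      nlinarith [Nat.zero_le (w ^ 2), Nat.zero_le (w ^ 3), Nat.zero_le (w ^ 4)]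
    calc ((N + 1) ^ 2 + 1) ^ 2 ≤ 2 * (N ^ 2 + 1) ^ 2 := h
      _ ≤ 2 * 2 ^ (N + 5) := Nat.mul_le_mul_left _ ih
      _ = 2 ^ (N + 1 + 5) := by ring

theorem sq_le_two_pow {f : ℕ} (hf : 1 ≤ f) {a b : ℕ} (ha : a < 4 * f + 1) (hb : b < 4 * f + 1) :
    ((a : ℤ) ^ 2 - 4 * f * b - 1) ^ 2 ≤ 2 ^ (4 * f + 5) := by
  have h1 : ((4 * f) ^ 2 + 1) ^ 2 ≤ 2 ^ (4 * f + 5) := by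
    -- The value `4f` is either `4`, checked directly, or at least `8`, where the induction applies.
    rcases Nat.lt_or_ge f 2 with h | h
    · obtain rfl : f = 1 := by omega
      norm_num
    · exact sq_add_one_sq_le (by omega)
  have h2 : ((a : ℤ) ^ 2 - 4 * f * b - 1) ^ 2 ≤ ((4 * f) ^ 2 + 1) ^ 2 := by
    have ha' : (a : ℤ) ≤ 4 * f := by omega
    have hb' : (b : ℤ) ≤ 4 * f := by omega
    have e1 : (a : ℤ) ^ 2 ≤ (4 * f) ^ 2 := by gcongr
    have e2 : (4 * f : ℤ) * b ≤ 4 * f * (4 * f) := by gcongr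
    have e3 : (0 : ℤ) ≤ 4 * f * b := by positivity
    have e4 : (0 : ℤ) ≤ (a : ℤ) ^ 2 := by positivity
    refine sq_le_sq' ?_ ?_ <;> nlinarith
  exact h2.trans (by exact_mod_cast h1)

theorem card_roots {f : ℕ} (hf : 1 ≤ f) :
    (Finset.univ.filter fun x : Fin 2 → Fin (4 * f + 1) =>
      (((x 0 : ℕ) : ℤ) ^ 2 - 4 * f * ((x 1 : ℕ) : ℤ) - 1) ^ 2 = 0).card = sqrtOneCount (4 * f) := by
  have : NeZero (4 * f) := ⟨by omega⟩
  have hiff : ∀ x : Fin 2 → Fin (4 * f + 1),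
      (((x 0 : ℕ) : ℤ) ^ 2 - 4 * f * ((x 1 : ℕ) : ℤ) - 1) ^ 2 = 0 ↔
        (x 0 : ℕ) ^ 2 = 4 * f * (x 1 : ℕ) + 1 := by
    intro x
    rw [sq_eq_zero_iff]
    constructor
    · intro h; zify; linarith
    · intro h; zify at h; linarith
  -- The range of `x 0` contains both `0` and `4f`, which are the same residue. The value `4f` is
  -- never a root, since `4` does not divide `4f x₁ + 1`; so roots correspond to residues one to
  -- one.
  have hlt : ∀ x : Fin 2 → Fin (4 * f + 1), (x 0 : ℕ) ^ 2 = 4 * f * (x 1 : ℕ) + 1 →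
      (x 0 : ℕ) < 4 * f := by
    intro x h
    by_contra hn
    have h0 : (x 0 : ℕ) = 4 * f := by have := (x 0).2; omega
    rw [h0] at h
    have h1 : 4 ∣ 4 * f * (x 1 : ℕ) + 1 := h ▸ ⟨4 * f ^ 2, by ring⟩
    rw [mul_assoc] at h1
    omega
  rw [sqrtOneCount, Nat.card_eq_fintype_card, Fintype.card_subtype]
  refine Finset.card_bij (fun x _ => ((x 0 : ℕ) : ZMod (4 * f))) ?_ ?_ ?_
  · intro x hx
    simp only [Finset.mem_filter, Finset.mem_univ, true_and, hiff] at hx ⊢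
    have : (((x 0 : ℕ) ^ 2 : ℕ) : ZMod (4 * f)) = ((4 * f * (x 1 : ℕ) + 1 : ℕ) : ZMod (4 * f)) := by
      rw [hx]
    rw [Nat.cast_pow, Nat.cast_add, Nat.cast_mul (4 * f), ZMod.natCast_self] at this
    rw [this]; simp
  · intro x hx y hy hxy
    simp only [Finset.mem_filter, Finset.mem_univ, true_and, hiff] at hx hy
    have h0 : (x 0 : ℕ) = y 0 := by
      rw [ZMod.natCast_eq_natCast_iff] at hxy
      exact Nat.ModEq.eq_of_lt_of_lt hxy (hlt x hx) (hlt y hy)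
    have h1 : (x 1 : ℕ) = y 1 := by
      rw [h0, hy] at hx
      exact (Nat.eq_of_mul_eq_mul_left (show 0 < 4 * f by omega) (by omega)).symm
    funext i
    fin_cases i
    · exact Fin.ext h0
    · exact Fin.ext h1
  · intro z hz
    simp only [Finset.mem_filter, Finset.mem_univ, true_and] at hz
    have hzlt := ZMod.val_lt z
    have hmod : z.val ^ 2 % (4 * f) = 1 := by
      have : ((z.val ^ 2 : ℕ) : ZMod (4 * f)) = ((1 : ℕ) : ZMod (4 * f)) := by
        rw [Nat.cast_pow, ZMod.natCast_zmod_val, hz, Nat.cast_one]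
      rw [ZMod.natCast_eq_natCast_iff, Nat.ModEq] at this
      rw [this, Nat.mod_eq_of_lt (by omega)]
    have hdm := Nat.div_add_mod (z.val ^ 2) (4 * f)
    rw [hmod] at hdm
    have hq : z.val ^ 2 / (4 * f) < 4 * f + 1 := by
      refine Nat.lt_succ_of_le (Nat.div_le_of_le_mul ?_)
      nlinarith
    refine ⟨![⟨z.val, by omega⟩, ⟨z.val ^ 2 / (4 * f), hq⟩], ?_, ?_⟩
    · simp only [Finset.mem_filter, Finset.mem_univ, true_and, hiff]
      exact hdm.symm
    · simp

theorem mInt_spec {f : ℕ} (hf : 1 ≤ f) :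
    0 ≤ mInt f ∧ HW (mInt f).toNat = (4 * f + 5) * ((4 * f + 1) ^ 2 + sqrtOneCount (4 * f)) ∧
      mInt f < 2 ^ (2 * (4 * f + 5) * (4 * f + 1) ^ 2) := by
  have h := HW_sum_cube_int 2 (4 * f + 1) (4 * f + 5)
    (fun x => (((x 0 : ℕ) : ℤ) ^ 2 - 4 * f * ((x 1 : ℕ) : ℤ) - 1) ^ 2)
    (fun x => ⟨sq_nonneg _, sq_le_two_pow hf (x 0).2 (x 1).2⟩) (mInt f) rfl
  rwa [card_roots hf] at h

/-! ### The relation defining this integer -/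

/-- The witnesses of the relation `EM4`. -/
def m4W (f : ℕ) : ℕ → ℕ
  | 1 => 2 ^ (2 * (4 * f + 5)) - 1
  | 2 => 2 ^ (2 * (4 * f + 5) * (4 * f + 1)) - 1
  | 3 => (geomG 0 (2 ^ (2 * (4 * f + 5))) (4 * f + 1)).toNat
  | 4 => (geomG 2 (2 ^ (2 * (4 * f + 5))) (4 * f + 1)).toNat
  | 5 => (geomG 4 (2 ^ (2 * (4 * f + 5))) (4 * f + 1)).toNat
  | 6 => (geomG 0 (2 ^ (2 * (4 * f + 5) * (4 * f + 1))) (4 * f + 1)).toNat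
  | 7 => (geomG 1 (2 ^ (2 * (4 * f + 5) * (4 * f + 1))) (4 * f + 1)).toNat
  | 8 => (geomG 2 (2 ^ (2 * (4 * f + 5) * (4 * f + 1))) (4 * f + 1)).toNat
  | _ => (hypercubeC 2 1 (4 * f + 1) (4 * f + 5)).toNat

theorem hypercubeC_one_nonneg (k t u : ℕ) : 0 ≤ hypercubeC k 1 t u := by
  rw [hypercubeC_eq]
  refine Finset.sum_nonneg fun j _ => ?_
  have : (1 : ℤ) ≤ 2 ^ u := by exact_mod_cast Nat.one_le_two_pow
  have h1 : (0 : ℤ) ≤ 2 ^ u - 1 := by linarith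
  have h2 : (0 : ℤ) ≤ 2 ^ u - 1 + 1 := by linarith
  positivity

theorem ten_sq_eq_zero (a b c d e f g h i j : ℤ) :
    a ^ 2 + b ^ 2 + c ^ 2 + d ^ 2 + e ^ 2 + f ^ 2 + g ^ 2 + h ^ 2 + i ^ 2 + j ^ 2 = 0 ↔
      a = 0 ∧ b = 0 ∧ c = 0 ∧ d = 0 ∧ e = 0 ∧ f = 0 ∧ g = 0 ∧ h = 0 ∧ i = 0 ∧ j = 0 := by
  have ha := sq_nonneg a
  have hb := sq_nonneg b
  have hc := sq_nonneg c
  have hd := sq_nonneg d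
  have he := sq_nonneg e
  have hf := sq_nonneg f
  have hg := sq_nonneg g
  have hh := sq_nonneg h
  have hi := sq_nonneg i
  have hj := sq_nonneg j
  constructor
  · intro H
    refine ⟨?_, ?_, ?_, ?_, ?_, ?_, ?_, ?_, ?_, ?_⟩ <;> refine sq_eq_zero_iff.1 ?_ <;> linarith
  · rintro ⟨rfl, rfl, rfl, rfl, rfl, rfl, rfl, rfl, rfl, rfl⟩
    norm_num

section Relations

variable {k : ℕ}

theorem ev_EM4_nonneg (x : Fin k → ℕ) (f₁ f₂ f₃ : LinForm k) (f₄ : ExpPoly k) (y : ℕ → LinForm k)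
    (m : ExpPoly k) : 0 ≤ ev x (EM4 f₁ f₂ f₃ f₄ y m) := by
  simp only [EM4]
  iterate 9 rw [map_add, map_pow]
  rw [map_pow]
  exact add_nonneg (add_nonneg (add_nonneg (add_nonneg (add_nonneg (add_nonneg (add_nonneg
    (add_nonneg (add_nonneg (sq_nonneg _) (sq_nonneg _)) (sq_nonneg _)) (sq_nonneg _))
    (sq_nonneg _)) (sq_nonneg _)) (sq_nonneg _)) (sq_nonneg _)) (sq_nonneg _)) (sq_nonneg _)

/-- The equation cleared of its denominator `D` still determines the unknown, because `D ≠ 0`. -/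
theorem natCast_eq_iff_of_mul_eq {Y : ℕ} {G D R : ℤ} (hG : 0 ≤ G) (hD : D ≠ 0) (h : G * D = R) :
    (Y : ℤ) * D - R = 0 ↔ Y = G.toNat := by
  rw [← h, ← sub_mul, mul_eq_zero, or_iff_left hD]
  omega

/-- Exponents of `2` must be linear in the unknowns. Separate unknowns for `f²` and `f³` make
products such as `2u t = 32f² + 48f + 10` linear, and under the hypotheses on `f₁, f₂, f₃` the
powers become those of `q₁` and `q₂ = q₁^t`. -/
theorem ev_EM4_eq_zero_iff (x : Fin k → ℕ) {f₁ f₂ f₃ : LinForm k} {f₄ m : ExpPoly k}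
    (y : ℕ → LinForm k) {f μ : ℕ} (h₁ : nval x f₁ = f) (h₂ : nval x f₂ = f ^ 2)
    (h₃ : nval x f₃ = f ^ 3) (h₄ : ev x f₄ = 4 * f + 1) (hm : ev x m = μ) :
    ev x (EM4 f₁ f₂ f₃ f₄ y m) = 0 ↔
      (∀ j, 1 ≤ j → j ≤ 9 → nval x (y j) = m4W f j) ∧ (μ : ℤ) = mInt f := by
  set q₁ : ℤ := 2 ^ (2 * (4 * f + 5)) with hq₁
  set q₂ : ℤ := q₁ ^ (4 * f + 1) with hq₂
  have hq₂' : q₂ = 2 ^ (2 * (4 * f + 5) * (4 * f + 1)) := by rw [hq₂, hq₁, ← pow_mul]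
  have p₁ : ev x (pow2 (2 • (4 • f₁ + cst 5))) = q₁ := by
    rw [ev_pow2, nval_smul, nval_add, nval_smul, nval_cst, h₁]
  have p₂ : ev x (pow2 (32 • f₂ + 48 • f₁ + cst 10)) = q₁ ^ (4 * f + 1) := by
    simp only [ev_pow2, nval_add, nval_smul, nval_cst, h₁, h₂]
    rw [hq₁, ← pow_mul]; congr 1; ring
  have p₃ : ev x (pow2 (32 • f₂ + 40 • f₁)) = q₁ ^ (4 * f) := by
    simp only [ev_pow2, nval_add, nval_smul, h₁, h₂]
    rw [hq₁, ← pow_mul]; congr 1; ring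
  have p₄ : ev x (pow2 (128 • f₃ + 192 • f₂ + 40 • f₁)) = q₂ ^ (4 * f) := by
    simp only [ev_pow2, nval_add, nval_smul, h₁, h₂, h₃]
    rw [hq₂', ← pow_mul]; congr 1; ring
  have p₅ : ev x (pow2 (128 • f₃ + 224 • f₂ + 88 • f₁ + cst 10)) = q₂ ^ (4 * f + 1) := by
    simp only [ev_pow2, nval_add, nval_smul, nval_cst, h₁, h₂, h₃]
    rw [hq₂', ← pow_mul]; congr 1; ring
  have p₆ : ev x (pow2 (4 • f₁ + cst 5)) = 2 ^ (4 * f + 5) := by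
    rw [ev_pow2, nval_add, nval_smul, nval_cst, h₁]
  have hq₁1 : q₁ - 1 ≠ 0 := by
    have : (1 : ℤ) < 2 ^ (2 * (4 * f + 5)) := one_lt_pow₀ (by norm_num) (by omega)
    omega
  have hq₂1 : q₂ - 1 ≠ 0 := by
    have : (1 : ℤ) < 2 ^ (2 * (4 * f + 5) * (4 * f + 1)) := one_lt_pow₀ (by norm_num) (by positivity)
    omega
  have hq₁0 : 0 ≤ q₁ := by positivity
  have hq₂0 : 0 ≤ q₂ := by positivity
  have hs : ((4 * f : ℕ) : ℤ) = 4 * f := by push_cast; rfl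
  have hC := hypercubeC_mul 2 1 (4 * f + 1) (4 * f + 5)
  have hC0 := hypercubeC_one_nonneg 2 (4 * f + 1) (4 * f + 5)
  have hqq : (2 : ℤ) ^ (2 * (4 * f + 5) * (4 * f + 1) ^ 2) = q₂ ^ (4 * f + 1) := by
    rw [hq₂', ← pow_mul]; congr 1; ring
  rw [hqq] at hC
  have G01 := geomG_zero_mul q₁ (4 * f + 1)
  have G02 := geomG_zero_mul q₂ (4 * f + 1)
  have G12 := geomG_one_mul q₂ (4 * f)
  have G21 := geomG_two_mul q₁ (4 * f)
  have G22 := geomG_two_mul q₂ (4 * f)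
  have G41 := geomG_four_mul q₁ (4 * f)
  rw [hs] at G12 G21 G22 G41
  have hM := mInt_eq f hq₁ hq₂ rfl
  have t3 := natCast_eq_iff_of_mul_eq (Y := nval x (y 3)) (geomG_nonneg 0 hq₁0 _) hq₁1 G01
  have t4 := natCast_eq_iff_of_mul_eq (Y := nval x (y 4)) (geomG_nonneg 2 hq₁0 _)
    (pow_ne_zero 3 hq₁1) G21
  have t5 := natCast_eq_iff_of_mul_eq (Y := nval x (y 5)) (geomG_nonneg 4 hq₁0 _)
    (pow_ne_zero 5 hq₁1) G41
  have t6 := natCast_eq_iff_of_mul_eq (Y := nval x (y 6)) (geomG_nonneg 0 hq₂0 _) hq₂1 G02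
  have t7 := natCast_eq_iff_of_mul_eq (Y := nval x (y 7)) (geomG_nonneg 1 hq₂0 _)
    (pow_ne_zero 2 hq₂1) G12
  have t8 := natCast_eq_iff_of_mul_eq (Y := nval x (y 8)) (geomG_nonneg 2 hq₂0 _)
    (pow_ne_zero 3 hq₂1) G22
  have t9 := natCast_eq_iff_of_mul_eq (Y := nval x (y 9)) hC0
    (show (2 : ℤ) ^ (4 * f + 5) + 1 ≠ 0 by positivity) hC
  have key : ev x (EM4 f₁ f₂ f₃ f₄ y m) = 0 ↔ ((μ : ℤ) = mInt f ∧
      nval x (y 1) = m4W f 1 ∧ nval x (y 2) = m4W f 2 ∧ nval x (y 3) = m4W f 3 ∧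
      nval x (y 4) = m4W f 4 ∧ nval x (y 5) = m4W f 5 ∧ nval x (y 6) = m4W f 6 ∧
      nval x (y 7) = m4W f 7 ∧ nval x (y 8) = m4W f 8 ∧ nval x (y 9) = m4W f 9) := by
    simp only [EM4]
    iterate 9 rw [map_add, map_pow]
    rw [map_pow, ten_sq_eq_zero]
    simp only [map_add, map_sub, map_mul, map_neg, map_pow, map_one, map_ofNat, ev_val, hm, h₄, p₁,
      p₂, p₃, p₄, p₅, p₆, h₁, m4W]
    rw [← hq₁, ← hq₂', hM]
    have hu1 : (nval x (y 1) : ℤ) - q₁ + 1 = 0 ↔ nval x (y 1) = 2 ^ (2 * (4 * f + 5)) - 1 := by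
      have := @Nat.one_le_two_pow (2 * (4 * f + 5))
      rw [hq₁]; zify [this]; constructor <;> intro h <;> linarith
    have hu2 : (nval x (y 2) : ℤ) - q₁ ^ (4 * f + 1) + 1 = 0 ↔
        nval x (y 2) = 2 ^ (2 * (4 * f + 5) * (4 * f + 1)) - 1 := by
      have := @Nat.one_le_two_pow (2 * (4 * f + 5) * (4 * f + 1))
      rw [← hq₂, hq₂']; zify [this]; constructor <;> intro h <;> linarith
    constructor
    · rintro ⟨e0, e9, e1, e2, e3, e6, e7, e4, e8, e5⟩
      have c1 : (nval x (y 1) : ℤ) = q₁ - 1 := by linarith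
      have c2 : (nval x (y 2) : ℤ) = q₂ - 1 := by rw [hq₂]; linarith
      rw [c1] at e3 e4 e5
      rw [c2] at e3 e6 e7 e8
      have d3 := t3.1 (by linear_combination e3)
      have d4 := t4.1 (by linear_combination e4)
      have d5 := t5.1 (by linear_combination e5)
      have d6 := t6.1 (by linear_combination e6)
      have d7 := t7.1 (by linear_combination e7)
      have d8 := t8.1 (by linear_combination e8)
      have d9 := t9.1 (by linear_combination e9)
      refine ⟨?_, hu1.1 e1, hu2.1 e2, d3, d4, d5, d6, d7, d8, d9⟩
      rw [d3, d4, d5, d6, d7, d8, d9] at e0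
      simp only [Int.toNat_of_nonneg (geomG_nonneg _ hq₁0 _),
        Int.toNat_of_nonneg (geomG_nonneg _ hq₂0 _), Int.toNat_of_nonneg hC0] at e0
      linarith
    · rintro ⟨e0, e1, e2, d3, d4, d5, d6, d7, d8, d9⟩
      have b1 := hu1.2 e1
      have b2 := hu2.2 e2
      have c1 : (nval x (y 1) : ℤ) = q₁ - 1 := by linarith
      have c2 : (nval x (y 2) : ℤ) = q₂ - 1 := by rw [hq₂]; linarith
      have e3 := t3.2 d3
      have e4 := t4.2 d4
      have e5 := t5.2 d5
      have e6 := t6.2 d6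
      have e7 := t7.2 d7
      have e8 := t8.2 d8
      have e9 := t9.2 d9
      refine ⟨?_, by linear_combination e9, b1, b2, ?_, ?_, ?_, ?_, ?_, ?_⟩
      · rw [d3, d4, d5, d6, d7, d8, d9]
        simp only [Int.toNat_of_nonneg (geomG_nonneg _ hq₁0 _),
          Int.toNat_of_nonneg (geomG_nonneg _ hq₂0 _), Int.toNat_of_nonneg hC0]
        linarith
      · rw [c1, c2]; linear_combination e3
      · rw [c2]; linear_combination e6
      · rw [c2]; linear_combination e7
      · rw [c1]; linear_combination e4
      · rw [c2]; linear_combination e8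
      · rw [c1]; linear_combination e5
  rw [key]
  constructor
  · rintro ⟨e0, e1, e2, e3, e4, e5, e6, e7, e8, e9⟩
    refine ⟨fun j hj1 hj2 => ?_, e0⟩
    interval_cases j
    exacts [e1, e2, e3, e4, e5, e6, e7, e8, e9]
  · rintro ⟨h, e0⟩
    exact ⟨e0, h 1 (by norm_num) (by norm_num), h 2 (by norm_num) (by norm_num),
      h 3 (by norm_num) (by norm_num), h 4 (by norm_num) (by norm_num),
      h 5 (by norm_num) (by norm_num), h 6 (by norm_num) (by norm_num),
      h 7 (by norm_num) (by norm_num), h 8 (by norm_num) (by norm_num),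
      h 9 (by norm_num) (by norm_num)⟩

end Relations

/-! ### The zeros of `F̂` -/

/-- The coordinates of the zero of `F̂` with first coordinate `a`. -/
def zeroW (n a : ℕ) : ℕ → ℕ
  | 1 => a
  | 2 => a.factorial
  | 3 => a.factorial ^ 2
  | 4 => a.factorial ^ 3
  | 5 => 4 * a.factorial + 1
  | 6 => (mInt a.factorial).toNat
  | 7 => HW (mInt a.factorial).toNat
  | 8 => 2 ^ n - 2 ^ (Nat.primeCounting a + 1)
  | i => if i ≤ 21 then factW a (i - 8) else if i ≤ 30 then m4W a.factorial (i - 21) else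
      hwW (mInt a.factorial).toNat (i - 30)

theorem ev_Fhat (p : Fin 42 → ℕ) (n : ℕ) :
    ev p (Fhat n) = ev p (EFact (x 1) (fun j => x (8 + j)) (x 2).val)
      + ((nval p (x 3) : ℤ) - (nval p (x 2) : ℤ) ^ 2) ^ 2
      + ((nval p (x 4) : ℤ) - nval p (x 2) * nval p (x 3)) ^ 2
      + ((nval p (x 5) : ℤ) - 4 * nval p (x 2) - 1) ^ 2
      + ev p (EM4 (x 2) (x 3) (x 4) (x 5).val (fun j => x (21 + j)) (x 6).val)
      + ev p (EHW (x 6) (fun j => x (30 + j)) (x 7))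
      + ((nval p (x 7) : ℤ) + (4 * nval p (x 2) + 5) *
          (-(nval p (x 5) : ℤ) ^ 2 + nval p (x 8) - 2 ^ n)) ^ 2 := by
  rw [Fhat]
  simp only [map_add, map_sub, map_mul, map_neg, map_pow, map_one, map_ofNat, ev_val]

theorem ev_Fhat_nonneg (p : Fin 42 → ℕ) (n : ℕ) : 0 ≤ ev p (Fhat n) := by
  rw [ev_Fhat]
  have h1 := ev_EFact_nonneg p (x 1) (fun j => x (8 + j)) (x 2).val
  have h2 := ev_EM4_nonneg p (x 2) (x 3) (x 4) (x 5).val (fun j => x (21 + j)) (x 6).val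
  have h3 := ev_EHW_nonneg p (x 6) (fun j => x (30 + j)) (x 7)
  exact add_nonneg (add_nonneg (add_nonneg (add_nonneg (add_nonneg (add_nonneg h1 (sq_nonneg _))
    (sq_nonneg _)) (sq_nonneg _)) h2) h3) (sq_nonneg _)

theorem add_sq_eq_zero_iff {a b c : ℤ} (ha : 0 ≤ a) (hb : 0 ≤ b) (hc : 0 ≤ c) (p q r s : ℤ) :
    a + p ^ 2 + q ^ 2 + r ^ 2 + b + c + s ^ 2 = 0 ↔
      a = 0 ∧ p = 0 ∧ q = 0 ∧ r = 0 ∧ b = 0 ∧ c = 0 ∧ s = 0 := by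
  have hp := sq_nonneg p
  have hq := sq_nonneg q
  have hr := sq_nonneg r
  have hs := sq_nonneg s
  rw [← sq_eq_zero_iff (a := p), ← sq_eq_zero_iff (a := q), ← sq_eq_zero_iff (a := r),
    ← sq_eq_zero_iff (a := s)]
  omega

theorem last_square_iff {f b r d n : ℕ} (hb : b = (4 * f + 5) * ((4 * f + 1) ^ 2 + r)) :
    (b : ℤ) + (4 * f + 5) * (-(4 * f + 1) ^ 2 + d - 2 ^ n) = 0 ↔ r + d = 2 ^ n := by
  have h : (b : ℤ) + (4 * f + 5) * (-(4 * f + 1) ^ 2 + d - 2 ^ n) =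
      (4 * f + 5) * ((r : ℤ) + d - 2 ^ n) := by
    rw [hb]; push_cast; ring
  rw [h, mul_eq_zero, or_iff_right (by positivity), sub_eq_zero]
  exact_mod_cast Iff.rfl

/-- The relations determine every coordinate from `a` in turn. The only obstruction to solvability
is the last square, which asks for a natural number `d` with `2^(π(a)+1) + d = 2^n`. -/
theorem ev_Fhat_eq_zero_iff (p : Fin 42 → ℕ) (n : ℕ) :
    ev p (Fhat n) = 0 ↔
      (∀ i, 1 ≤ i → i ≤ 42 → nval p (x i) = zeroW n (nval p (x 1)) i) ∧
        2 ^ (Nat.primeCounting (nval p (x 1)) + 1) ≤ 2 ^ n := by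
  set a := nval p (x 1) with ha
  have hf : 1 ≤ a.factorial := Nat.factorial_pos a
  obtain ⟨hM0, hMHW, -⟩ := mInt_spec hf
  rw [sqrtOneCount_four_mul_factorial] at hMHW
  have hMc : (((mInt a.factorial).toNat : ℕ) : ℤ) = mInt a.factorial := Int.toNat_of_nonneg hM0
  rw [ev_Fhat, add_sq_eq_zero_iff
    (ev_EFact_nonneg p (x 1) (fun j => x (8 + j)) (x 2).val)
    (ev_EM4_nonneg p (x 2) (x 3) (x 4) (x 5).val (fun j => x (21 + j)) (x 6).val)
    (ev_EHW_nonneg p (x 6) (fun j => x (30 + j)) (x 7)),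
    ev_EFact_eq_zero_iff p _ _ (ev_val p (x 2)), ev_EHW_eq_zero_iff, ← ha]
  constructor
  · rintro ⟨⟨h1, e2⟩, e3, e4, e5, h6, ⟨h7, e7⟩, e8⟩
    have e3' : nval p (x 3) = a.factorial ^ 2 := by
      rw [sub_eq_zero, e2] at e3; exact_mod_cast e3
    have e4' : nval p (x 4) = a.factorial ^ 3 := by
      rw [sub_eq_zero, e2, e3'] at e4
      have : nval p (x 4) = a.factorial * a.factorial ^ 2 := by exact_mod_cast e4
      rw [this]; ring
    have e5' : nval p (x 5) = 4 * a.factorial + 1 := by rw [e2] at e5; omega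
    have e5c : ev p (x 5).val = 4 * (a.factorial : ℤ) + 1 := by
      rw [ev_val, e5']; push_cast; rfl
    rw [ev_EM4_eq_zero_iff p _ e2 e3' e4' e5c (ev_val p (x 6))] at h6
    have e6 : nval p (x 6) = (mInt a.factorial).toNat := by
      rw [← hMc] at h6; exact_mod_cast h6.2
    rw [e6] at h7 e7
    rw [e5', e2] at e8
    push_cast at e8
    rw [last_square_iff (e7.trans hMHW)] at e8
    refine ⟨fun i hi1 hi2 => ?_, by omega⟩
    rcases le_or_gt i 8 with hi | hi
    · interval_cases i
      · exact ha.symm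
      · exact e2
      · exact e3'
      · exact e4'
      · exact e5'
      · exact e6
      · exact e7
      · change nval p (x 8) = 2 ^ n - 2 ^ (Nat.primeCounting a + 1)
        omega
    · have hW : zeroW n a i = if i ≤ 21 then factW a (i - 8) else
          if i ≤ 30 then m4W a.factorial (i - 21) else
          hwW (mInt a.factorial).toNat (i - 30) := by
        obtain ⟨j, rfl⟩ := Nat.exists_eq_add_of_le' (show 9 ≤ i by omega)
        rfl
      rw [hW]
      split_ifs with c1 c2
      · have := h1 (i - 8) (by omega) (by omega)
        rwa [show 8 + (i - 8) = i by omega] at this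
      · have := h6.1 (i - 21) (by omega) (by omega)
        rwa [show 21 + (i - 21) = i by omega] at this
      · have := h7 (i - 30) (by omega) (by omega)
        rwa [show 30 + (i - 30) = i by omega] at this
  · rintro ⟨h, hle⟩
    have e2 : nval p (x 2) = a.factorial := h 2 (by norm_num) (by norm_num)
    have e3 : nval p (x 3) = a.factorial ^ 2 := h 3 (by norm_num) (by norm_num)
    have e4 : nval p (x 4) = a.factorial ^ 3 := h 4 (by norm_num) (by norm_num)
    have e5 : nval p (x 5) = 4 * a.factorial + 1 := h 5 (by norm_num) (by norm_num)
    have e6 : nval p (x 6) = (mInt a.factorial).toNat := h 6 (by norm_num) (by norm_num)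
    have e7 : nval p (x 7) = HW (mInt a.factorial).toNat := h 7 (by norm_num) (by norm_num)
    have e8 : nval p (x 8) = 2 ^ n - 2 ^ (Nat.primeCounting a + 1) := h 8 (by norm_num) (by norm_num)
    have e5c : ev p (x 5).val = 4 * (a.factorial : ℤ) + 1 := by
      rw [ev_val, e5]; push_cast; rfl
    have hW : ∀ i, 9 ≤ i → zeroW n a i = if i ≤ 21 then factW a (i - 8) else
          if i ≤ 30 then m4W a.factorial (i - 21) else
          hwW (mInt a.factorial).toNat (i - 30) := by
      intro i hi
      obtain ⟨j, rfl⟩ := Nat.exists_eq_add_of_le' hi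
      rfl
    rw [ev_EM4_eq_zero_iff p _ e2 e3 e4 e5c (ev_val p (x 6))]
    refine ⟨⟨fun j hj1 hj2 => ?_, e2⟩, ?_, ?_, ?_, ⟨fun j hj1 hj2 => ?_, ?_⟩,
      ⟨fun j hj1 hj2 => ?_, ?_⟩, ?_⟩
    · rw [h _ (by omega) (by omega), hW _ (by omega), if_pos (by omega), Nat.add_sub_cancel_left]
    · rw [e3, e2]; push_cast; ring
    · rw [e4, e3, e2]; push_cast; ring
    · rw [e5, e2]; push_cast; ring
    · rw [h _ (by omega) (by omega), hW _ (by omega), if_neg (by omega), if_pos (by omega),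
        Nat.add_sub_cancel_left]
    · rw [e6]; exact hMc
    · rw [h _ (by omega) (by omega), hW _ (by omega), if_neg (by omega), if_neg (by omega),
        Nat.add_sub_cancel_left, e6]
    · rw [e7, e6]
    · rw [e5, e2]
      push_cast
      -- The subtraction in the witness for `d` is not truncated, by `hle`.
      rw [last_square_iff (e7.trans hMHW), e8]
      omega

/-- `Nat.nth` counts from `0`, so the index `n - 1` is that of `p(n)`; the positivity of `n` keeps
`π(a) + 1 ≤ n` equivalent to `π(a) ≤ n - 1`. -/
theorem primeCounting_add_one_le_iff {n a : ℕ} (hn : 0 < n) :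
    2 ^ (Nat.primeCounting a + 1) ≤ 2 ^ n ↔ a < Nat.nth Nat.Prime (n - 1) := by
  have h : Nat.primeCounting a ≤ n - 1 ↔ a + 1 ≤ Nat.nth Nat.Prime (n - 1) :=
    Nat.count_le_iff_le_nth Nat.infinite_setOfPred_prime
  rw [Nat.pow_le_pow_iff_right (by norm_num), ← Nat.succ_le_iff (m := a), Nat.succ_eq_add_one, ← h]
  omega

theorem card_zeros {n t : ℕ} (hn : 0 < n)
    (hbound : ∀ a < Nat.nth Nat.Prime (n - 1), ∀ i, 1 ≤ i → i ≤ 42 → zeroW n a i < t) :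
    (Finset.univ.filter fun q : Fin 42 → Fin t => ev (fun i => (q i : ℕ)) (Fhat n) = 0).card =
      Nat.nth Nat.Prime (n - 1) := by
  have hx : ∀ (p : Fin 42 → ℕ) (i : Fin 42), nval p (x ((i : ℕ) + 1)) = p i := by
    intro p i
    rw [x, nval_var, Nat.add_sub_cancel]
    congr 1
    exact Fin.ext (Nat.mod_eq_of_lt i.2)
  have hx1 : ∀ p : Fin 42 → ℕ, nval p (x 1) = p 0 := fun p => hx p 0
  have hiff : ∀ p : Fin 42 → ℕ, ev p (Fhat n) = 0 ↔
      (∀ i : Fin 42, p i = zeroW n (p 0) ((i : ℕ) + 1)) ∧ p 0 < Nat.nth Nat.Prime (n - 1) := by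
    intro p
    rw [ev_Fhat_eq_zero_iff, primeCounting_add_one_le_iff hn, hx1]
    refine and_congr ⟨fun h i => ?_, fun h i hi1 hi2 => ?_⟩ Iff.rfl
    · rw [← hx p i]; exact h _ (by omega) (by omega)
    · have := h ⟨i - 1, by omega⟩
      rw [← hx p ⟨i - 1, by omega⟩] at this
      simpa [Nat.sub_add_cancel hi1] using this
  symm
  rw [← Finset.card_range (Nat.nth Nat.Prime (n - 1))]
  refine Finset.card_bij (fun a ha i => ⟨zeroW n a ((i : ℕ) + 1),
    hbound a (Finset.mem_range.1 ha) _ (by omega) (by omega)⟩) ?_ ?_ ?_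
  · intro a ha
    simp only [Finset.mem_filter, Finset.mem_univ, true_and, hiff]
    exact ⟨fun i => rfl, Finset.mem_range.1 ha⟩
  · intro a _ b _ h
    exact congrArg Fin.val (congrFun h 0)
  · intro q hq
    simp only [Finset.mem_filter, Finset.mem_univ, true_and, hiff] at hq
    refine ⟨q 0, Finset.mem_range.2 hq.2, ?_⟩
    funext i
    exact Fin.ext (hq.1 i).symm

/-! ### Bounds for the primes and for the zeros of `F̂` -/

/-- The lcm is a product over the primes up to `m` of their largest powers not exceeding `m`. -/
theorem lcmUpto_le_pow (m : ℕ) : Nat.lcmUpto m ≤ m ^ Nat.primeCounting m := by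
  rw [Nat.lcmUpto_eq_prod_pow_log, ← Nat.primesLE_card_eq_primeCounting]
  refine Finset.prod_le_pow_card _ _ _ fun p hp => ?_
  refine Nat.pow_log_le_self p ?_
  have := Nat.mem_primesLE.1 hp
  have := this.2.pos
  omega

/-- Chebyshev's argument. If `π(n²+1) ≤ n - 1`, the lower bound for the lcm of `1, …, n²+1` gives
`2^(n²+1) ≤ (n²+2)(n²+1)^(n-1)`. For `n ≥ 5` one has `n² + 2 ≤ 2^n`, which makes the right side at
most `2^(n²)`. -/
theorem le_primeCounting_sq_add_one {n : ℕ} (hn : 0 < n) : n ≤ Nat.primeCounting (n ^ 2 + 1) := by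
  rcases Nat.lt_or_ge n 5 with h | h
  · interval_cases n <;> decide
  · by_contra hlt
    have h1 := Chebyshev.two_pow_le_mul_lcmUpto (n ^ 2 + 1)
    have h2 := lcmUpto_le_pow (n ^ 2 + 1)
    have h3 : (n ^ 2 + 1) ^ Nat.primeCounting (n ^ 2 + 1) ≤ (n ^ 2 + 1) ^ (n - 1) :=
      Nat.pow_le_pow_right (by omega) (by omega)
    have h4 : n ^ 2 + 2 ≤ 2 ^ n := by
      clear h1 h2 h3 hlt hn
      induction n, h using Nat.le_induction with
      | base => norm_num
      | succ n hn ih => rw [pow_succ 2]; nlinarith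
    have h5 : (n ^ 2 + 1 + 1) * (n ^ 2 + 1) ^ (n - 1) ≤ 2 ^ (n ^ 2) := by
      calc (n ^ 2 + 1 + 1) * (n ^ 2 + 1) ^ (n - 1) ≤ 2 ^ n * (2 ^ n) ^ (n - 1) :=
            Nat.mul_le_mul h4 (Nat.pow_le_pow_left (by omega) _)
        _ = 2 ^ (n ^ 2) := by
            rw [← pow_succ', ← pow_mul, Nat.sub_add_cancel hn, sq]
    have h6 : 2 ^ (n ^ 2 + 1) ≤ 2 ^ (n ^ 2) :=
      h1.trans ((Nat.mul_le_mul_left _ (h2.trans h3)).trans h5)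
    have h7 : 2 ^ (n ^ 2) < 2 ^ (n ^ 2 + 1) := Nat.pow_lt_pow_right (by norm_num) (by omega)
    omega

theorem le_sq_of_lt_nth {n a : ℕ} (hn : 0 < n) (ha : a < Nat.nth Nat.Prime (n - 1)) : a ≤ n ^ 2 := by
  rw [← primeCounting_add_one_le_iff hn, Nat.pow_le_pow_iff_right (by norm_num)] at ha
  by_contra h
  have := Nat.monotone_primeCounting (show n ^ 2 + 1 ≤ a by omega)
  have := le_primeCounting_sq_add_one hn
  omega

/-- The source of the exponent `2n⁴` in `tPar`: `(n²)^(3n²) = (n³)^(2n²)` and `n³ ≤ 2^(n²)`. -/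
theorem factorial_pow_three_le {n a : ℕ} (hn : 0 < n) (ha : a ≤ n ^ 2) :
    a.factorial ^ 3 ≤ 2 ^ (2 * n ^ 4) := by
  have h1 : n ^ 3 ≤ 2 ^ (n ^ 2) := by
    have h : n ≤ 2 ^ (n - 1) := by
      have : n - 1 < 2 ^ (n - 1) := Nat.lt_two_pow_self
      omega
    refine (Nat.pow_le_pow_left h 3).trans ?_
    rw [← pow_mul]
    refine Nat.pow_le_pow_right (by norm_num) ?_
    obtain ⟨w, rfl⟩ : ∃ w, n = w + 1 := ⟨n - 1, by omega⟩
    rw [Nat.add_sub_cancel]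
    nlinarith [sq_nonneg ((w : ℤ) - 1), Nat.le_self_pow (n := 2) (by norm_num) w]
  calc a.factorial ^ 3 ≤ ((n ^ 2) ^ (n ^ 2)) ^ 3 := by
        refine Nat.pow_le_pow_left ?_ 3
        refine (Nat.factorial_le_pow a).trans ((Nat.pow_le_pow_left ha a).trans ?_)
        exact Nat.pow_le_pow_right (by positivity) ha
    _ = (n ^ 3) ^ (2 * n ^ 2) := by rw [← pow_mul, ← pow_mul, ← pow_mul]; congr 1; ring
    _ ≤ (2 ^ (n ^ 2)) ^ (2 * n ^ 2) := Nat.pow_le_pow_left h1 _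
    _ = 2 ^ (2 * n ^ 4) := by rw [← pow_mul]; congr 1; ring

theorem binW_le (N j : ℕ) (hj : j ≤ N) (i : ℕ) : binW N j i ≤ 2 ^ (8 * (N + 1) ^ 3) := by
  have h1 : binE₁ N j ≤ 8 * (N + 1) ^ 3 := by
    have : N * j ≤ N * N := Nat.mul_le_mul_left _ hj
    unfold binE₁
    nlinarith
  have h2 : binE₂ N ≤ binE₁ N j := by
    unfold binE₂ binE₁
    have := Nat.zero_le (N ^ 3)
    have := Nat.zero_le (N * j)
    nlinarith
  have h3 : 2 ^ binE₁ N j ≤ 2 ^ (8 * (N + 1) ^ 3) := Nat.pow_le_pow_right (by norm_num) h1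
  have h4 : 2 ^ binE₂ N ≤ 2 ^ binE₁ N j := Nat.pow_le_pow_right (by norm_num) h2
  have h5 : binE₁ N j < 2 ^ binE₁ N j := Nat.lt_two_pow_self
  have hD := binD_add N
  have h6 : 2 ^ binE₁ N j / binD N ≤ 2 ^ binE₁ N j := Nat.div_le_self _ _
  have h7 := Nat.mod_lt (2 ^ binE₁ N j) hD.2
  have h8 := Nat.div_le_self (2 ^ binE₁ N j / binD N) (2 ^ (2 * N + 4))
  have h9 : 0 < 2 ^ (2 * N + 4) := by positivity
  unfold binW
  split <;> omega

theorem geomG_le (r t : ℕ) {q : ℤ} (hq : 2 ≤ q) : geomG r q t ≤ (t : ℤ) ^ r * q ^ t := by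
  have h1 : geomG r q t ≤ ∑ j ∈ Finset.range t, (t : ℤ) ^ r * q ^ j := by
    refine Finset.sum_le_sum fun j hj => ?_
    have : (j : ℤ) ≤ t := by exact_mod_cast (Finset.mem_range.1 hj).le
    gcongr
  refine h1.trans ?_
  rw [← Finset.mul_sum]
  refine mul_le_mul_of_nonneg_left ?_ (by positivity)
  have h2 := geom_sum_mul q t
  have h3 : 0 ≤ ∑ j ∈ Finset.range t, q ^ j := Finset.sum_nonneg fun j _ => by positivity
  nlinarith

theorem geomG_toNat_le {r f e : ℕ} (hr : r ≤ 4) {s : ℕ} (hs0 : s ≠ 0) (hs : s * (4 * f + 1) ≤ e) :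
    (geomG r (2 ^ s) (4 * f + 1)).toNat ≤ 2 ^ (16 * f + e) := by
  have h := geomG_le r (4 * f + 1) (q := 2 ^ s) (by exact_mod_cast Nat.le_self_pow hs0 2)
  have h2 : ((4 * f + 1 : ℕ) : ℤ) ^ r * (2 ^ s) ^ (4 * f + 1) ≤ 2 ^ (16 * f + e) := by
    have h3 : 4 * f + 1 ≤ 2 ^ (4 * f) := Nat.lt_two_pow_self
    have h4 : (4 * f + 1) ^ r ≤ 2 ^ (16 * f) :=
      calc (4 * f + 1) ^ r ≤ (4 * f + 1) ^ 4 := Nat.pow_le_pow_right (by omega) hr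
        _ ≤ (2 ^ (4 * f)) ^ 4 := Nat.pow_le_pow_left h3 4
        _ = 2 ^ (16 * f) := by rw [← pow_mul]; congr 1; ring
    have h5 : (2 ^ s) ^ (4 * f + 1) ≤ 2 ^ e := by
      rw [← pow_mul]; exact Nat.pow_le_pow_right (by norm_num) hs
    have h6 : (4 * f + 1) ^ r * (2 ^ s) ^ (4 * f + 1) ≤ 2 ^ (16 * f + e) := by
      rw [pow_add 2]
      exact Nat.mul_le_mul h4 h5
    exact_mod_cast h6
  rw [Int.toNat_le]
  exact_mod_cast h.trans h2

theorem m4W_le (f i : ℕ) : m4W f i ≤ 2 ^ (16 * f + 2 * (4 * f + 5) * (4 * f + 1) ^ 2) := by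
  have hpow : ∀ s, s ≤ 2 * (4 * f + 5) * (4 * f + 1) ^ 2 →
      2 ^ s - 1 ≤ 2 ^ (16 * f + 2 * (4 * f + 5) * (4 * f + 1) ^ 2) := fun s hs =>
    (Nat.sub_le _ _).trans (Nat.pow_le_pow_right (by norm_num) (by omega))
  have e1 : 2 * (4 * f + 5) * (4 * f + 1) ≤ 2 * (4 * f + 5) * (4 * f + 1) ^ 2 :=
    Nat.mul_le_mul_left _ (Nat.le_self_pow (by norm_num) _)
  have e2 : 2 * (4 * f + 5) ≤ 2 * (4 * f + 5) * (4 * f + 1) := Nat.le_mul_of_pos_right _ (by omega)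
  have e3 : 2 * (4 * f + 5) * (4 * f + 1) * (4 * f + 1) ≤ 2 * (4 * f + 5) * (4 * f + 1) ^ 2 :=
    le_of_eq (by ring)
  have n1 : 2 * (4 * f + 5) ≠ 0 := by omega
  have n2 : 2 * (4 * f + 5) * (4 * f + 1) ≠ 0 := by positivity
  unfold m4W
  split
  · exact hpow _ (by omega)
  · exact hpow _ e1
  · exact geomG_toNat_le (by norm_num) n1 e1
  · exact geomG_toNat_le (by norm_num) n1 e1
  · exact geomG_toNat_le (by norm_num) n1 e1
  · exact geomG_toNat_le (by norm_num) n2 e3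
  · exact geomG_toNat_le (by norm_num) n2 e3
  · exact geomG_toNat_le (by norm_num) n2 e3
  · have h := hypercubeC_mul 2 1 (4 * f + 1) (4 * f + 5)
    have h0 := hypercubeC_one_nonneg 2 (4 * f + 1) (4 * f + 5)
    have hu : (1 : ℤ) ≤ 2 ^ (4 * f + 5) := one_le_pow₀ (by norm_num)
    have h1 : hypercubeC 2 1 (4 * f + 1) (4 * f + 5) ≤ 2 ^ (2 * (4 * f + 5) * (4 * f + 1) ^ 2) := by
      by_contra hlt
      push Not at hlt
      have h2 : (2 : ℤ) ^ (2 * (4 * f + 5) * (4 * f + 1) ^ 2) > 0 := by positivity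
      nlinarith
    have h2 : (2 : ℤ) ^ (2 * (4 * f + 5) * (4 * f + 1) ^ 2) ≤
        2 ^ (16 * f + 2 * (4 * f + 5) * (4 * f + 1) ^ 2) :=
      pow_le_pow_right₀ (by norm_num) (by omega)
    rw [Int.toNat_le]
    exact_mod_cast h1.trans h2

theorem HW_le (m : ℕ) : HW m ≤ m := by
  rw [HW_eq_sum_digits]; exact Nat.digit_sum_le 2 m

theorem two_pow_HW_succ_le (m : ℕ) : 2 ^ (HW m + 1) ≤ 2 ^ (2 * m + 1) := by
  have := HW_le m
  exact Nat.pow_le_pow_right (by norm_num) (by omega)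

theorem hwW_le {m e : ℕ} (hm : m < 2 ^ e) (i : ℕ) : hwW m i ≤ 2 ^ (2 ^ (3 * e + 6)) := by
  have hexp : 2 * m + 1 ≤ 2 ^ (e + 1) := by rw [pow_succ]; omega
  have hexp2 : 2 ^ (e + 1) ≤ 2 ^ (3 * e + 6) := Nat.pow_le_pow_right (by norm_num) (by omega)
  have h1 : (2 * m).choose m ≤ 2 ^ (2 * m + 1) :=
    (Nat.choose_le_two_pow _ _).trans (Nat.pow_le_pow_right (by norm_num) (by omega))
  have h2 : 2 ^ (2 * m + 1) ≤ 2 ^ (2 ^ (3 * e + 6)) :=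
    Nat.pow_le_pow_right (by norm_num) (hexp.trans hexp2)
  have h3 := two_pow_HW_succ_le m
  have h4 := Nat.div_le_self ((2 * m).choose m) (2 ^ HW m)
  have h5 := Nat.div_le_self ((2 * m).choose m) (2 ^ (HW m + 1))
  have h6 := Nat.mod_le ((2 * m).choose m) (2 ^ (HW m + 1))
  unfold hwW
  split
  · omega
  · omega
  · omega
  · omega
  · omega
  · refine (binW_le (2 * m) m (by omega) _).trans (Nat.pow_le_pow_right (by norm_num) ?_)
    calc 8 * (2 * m + 1) ^ 3 ≤ 8 * (2 ^ (e + 1)) ^ 3 :=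
          Nat.mul_le_mul_left _ (Nat.pow_le_pow_left hexp 3)
      _ = 2 ^ (3 * e + 6) := by ring

theorem factW_le (a i : ℕ) : factW a i ≤ 2 ^ (2 ^ (9 * a ^ 2 + 6)) := by
  set N := 2 ^ (3 * a ^ 2) with hN
  have haN : a ≤ N := le_two_pow_three_mul_sq a
  have h1 : N ≤ 2 ^ (9 * a ^ 2 + 6) := Nat.pow_le_pow_right (by norm_num) (by omega)
  have h2 : (2 : ℕ) ^ (9 * a ^ 2 + 6) < 2 ^ (2 ^ (9 * a ^ 2 + 6)) := Nat.lt_two_pow_self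
  have h3 : N.choose a ≤ 2 ^ (2 ^ (9 * a ^ 2 + 6)) :=
    (Nat.choose_le_two_pow _ _).trans (Nat.pow_le_pow_right (by norm_num) h1)
  have h4 := Nat.mod_lt (2 ^ (3 * a ^ 3)) (Nat.choose_pos haN)
  have h5 : a ^ 2 < 2 ^ (a ^ 2) := Nat.lt_two_pow_self
  have h6 : 2 ^ (a ^ 2) ≤ 2 ^ (9 * a ^ 2 + 6) := Nat.pow_le_pow_right (by norm_num) (by omega)
  have h7 : a ^ 3 ≤ 2 ^ (9 * a ^ 2 + 6) := by
    have e1 : a ^ 3 = a ^ 2 * a := by ring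
    have e2 : a ≤ a ^ 2 := Nat.le_self_pow (by norm_num) _
    calc a ^ 3 = a ^ 2 * a := e1
      _ ≤ 2 ^ (a ^ 2) * 2 ^ (a ^ 2) := Nat.mul_le_mul h5.le (e2.trans h5.le)
      _ = 2 ^ (2 * a ^ 2) := by rw [two_mul, pow_add]
      _ ≤ 2 ^ (9 * a ^ 2 + 6) := Nat.pow_le_pow_right (by norm_num) (by omega)
  unfold factW
  rw [← hN]
  split
  · omega
  · omega
  · omega
  · omega
  · omega
  · omega
  · refine (binW_le N a haN _).trans (Nat.pow_le_pow_right (by norm_num) ?_)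
    have : 1 ≤ N := Nat.one_le_two_pow
    calc 8 * (N + 1) ^ 3 ≤ 8 * (2 * N) ^ 3 :=
          Nat.mul_le_mul_left _ (Nat.pow_le_pow_left (by omega) 3)
      _ = 2 ^ (9 * a ^ 2 + 6) := by rw [hN]; ring

/-- Let `G = (a!)³` and `K = 2^(2n⁴+16)`, so that `t(n) = 2^(2^K)` and `65536 G ≤ K`. Apart from
`d`, which is at most `2^n` with `n < K`, the coordinates are bounded by at most two exponentials of
a quantity linear in `G`, and the factor `65536` absorbs the constants. The second exponential comes
from the binomial coefficients in the factorial and Hamming weight relations. -/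
theorem zeroW_lt {n : ℕ} (hn : 0 < n) (a : ℕ) (ha : a < Nat.nth Nat.Prime (n - 1)) (i : ℕ) :
    zeroW n a i < tPar n := by
  set f := a.factorial with hf
  have hf1 : 1 ≤ f := Nat.factorial_pos a
  have haf : a ≤ f := Nat.self_le_factorial a
  set G := f ^ 3 with hG
  have hG1 : 1 ≤ G := Nat.one_le_pow _ _ hf1
  obtain ⟨K, hK⟩ : ∃ K, K = 2 ^ (2 * n ^ 4 + 16) := ⟨_, rfl⟩
  have hKG : 65536 * G ≤ K := by
    have := factorial_pow_three_le hn (le_sq_of_lt_nth hn ha)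
    rw [← hf, ← hG] at this
    rw [hK, pow_add]
    omega
  have hnK : n < K := by
    have h1 : n < 2 ^ n := Nat.lt_two_pow_self
    have h2 : n ≤ n ^ 4 := Nat.le_self_pow (by norm_num) _
    have h3 : 2 ^ n ≤ 2 ^ (2 * n ^ 4 + 16) := Nat.pow_le_pow_right (by norm_num) (by omega)
    omega
  have hKK : K < 2 ^ K := Nat.lt_two_pow_self
  have ht : tPar n = 2 ^ 2 ^ K := by rw [tPar, hK]
  have key : ∀ z w : ℕ, w < K → z ≤ 2 ^ 2 ^ w → z < tPar n := fun z w hw hz => by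
    rw [ht]
    exact hz.trans_lt (Nat.pow_lt_pow_right (by norm_num) (Nat.pow_lt_pow_right (by norm_num) hw))
  have key' : ∀ z w : ℕ, w < K → z ≤ 2 ^ w → z < tPar n := fun z w hw hz =>
    key z w hw (hz.trans (Nat.pow_le_pow_right (by norm_num) Nat.lt_two_pow_self.le))
  have key'' : ∀ z : ℕ, z < K → z < tPar n := fun z hz => key' z z hz Nat.lt_two_pow_self.le
  have hfG : f ≤ G := Nat.le_self_pow (by norm_num) _
  have hf2 : f ^ 2 ≤ G := Nat.pow_le_pow_right hf1 (by norm_num)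
  have ha2 : a ^ 2 ≤ G := (Nat.pow_le_pow_left haf 2).trans hf2
  -- The length in binary digits of `mInt f`, bounded using `4f + 5 ≤ 9f` and `4f + 1 ≤ 5f`; it
  -- governs the largest witnesses through `hwW_le`.
  have he : 2 * (4 * f + 5) * (4 * f + 1) ^ 2 ≤ 450 * G := by
    calc 2 * (4 * f + 5) * (4 * f + 1) ^ 2 ≤ 2 * (9 * f) * (5 * f) ^ 2 := by
          refine Nat.mul_le_mul (by omega) (Nat.pow_le_pow_left (by omega) 2)
      _ = 450 * G := by rw [hG]; ring
  obtain ⟨hM0, -, hM2⟩ := mInt_spec hf1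
  have hM : (mInt f).toNat < 2 ^ (2 * (4 * f + 5) * (4 * f + 1) ^ 2) := by
    rw [Int.toNat_lt hM0]; exact_mod_cast hM2
  have hMt : (mInt f).toNat < tPar n := key' _ _ (by omega) hM.le
  unfold zeroW
  simp only [← hf]
  split
  · exact key'' _ (by omega)
  · exact key'' _ (by omega)
  · exact key'' _ (by omega)
  · exact key'' _ (by omega)
  · exact key'' _ (by omega)
  · exact hMt
  · exact (HW_le _).trans_lt hMt
  · exact key' _ n hnK (Nat.sub_le _ _)
  · split_ifs
    · exact key _ _ (by omega) (factW_le a _)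
    · exact key' _ _ (by omega) (m4W_le f _)
    · exact key _ _ (by omega) (hwW_le hM _)

/-! ### An upper bound for `F̂` on the cube -/

section Bounds

variable {k : ℕ}

/-- The absolute value of `P` at the point `p` is at most `2 ^ e`. -/
def EvBound (p : Fin k → ℕ) (P : ExpPoly k) (e : ℕ) : Prop := |ev p P| ≤ 2 ^ e

variable {p : Fin k → ℕ} {P Q : ExpPoly k} {d e : ℕ}

theorem EvBound.mono (h : EvBound p P d) (hde : d ≤ e) : EvBound p P e :=
  le_trans h (pow_le_pow_right₀ (by norm_num) hde)

/-- Deliberately crude: with it the exponents of bounds simply add along the syntax tree of an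
expression, and no maxima occur. -/
theorem two_pow_add_two_pow_le (d e : ℕ) : (2 : ℤ) ^ d + 2 ^ e ≤ 2 ^ (d + e + 1) := by
  have h1 : (1 : ℤ) ≤ 2 ^ d := one_le_pow₀ (by norm_num)
  have h2 : (1 : ℤ) ≤ 2 ^ e := one_le_pow₀ (by norm_num)
  rw [pow_succ, pow_add]
  nlinarith

theorem EvBound.add (hP : EvBound p P d) (hQ : EvBound p Q e) : EvBound p (P + Q) (d + e + 1) := by
  rw [EvBound, map_add]
  exact (abs_add_le _ _).trans ((add_le_add hP hQ).trans (two_pow_add_two_pow_le d e))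

theorem EvBound.neg (hP : EvBound p P d) : EvBound p (-P) d := by
  rwa [EvBound, map_neg, abs_neg]

theorem EvBound.sub (hP : EvBound p P d) (hQ : EvBound p Q e) : EvBound p (P - Q) (d + e + 1) := by
  rw [sub_eq_add_neg]; exact hP.add hQ.neg

theorem EvBound.mul (hP : EvBound p P d) (hQ : EvBound p Q e) : EvBound p (P * Q) (d + e) := by
  rw [EvBound, map_mul, abs_mul, pow_add]
  exact mul_le_mul hP hQ (abs_nonneg _) (by positivity)

theorem EvBound.pow (hP : EvBound p P d) (r : ℕ) : EvBound p (P ^ r) (d * r) := by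
  rw [EvBound, map_pow, abs_pow, pow_mul]
  exact pow_le_pow_left₀ (abs_nonneg _) hP r

theorem EvBound.one : EvBound p (1 : ExpPoly k) 0 := by simp [EvBound]

theorem EvBound.ofNat (c : ℕ) [c.AtLeastTwo] :
    EvBound p (OfNat.ofNat c : ExpPoly k) (OfNat.ofNat c) := by
  have h : c ≤ 2 ^ c := Nat.lt_two_pow_self.le
  have hc : ev p (OfNat.ofNat c : ExpPoly k) = (c : ℤ) := map_ofNat _ c
  rw [EvBound, hc, Nat.abs_cast]
  exact_mod_cast h

variable {l : LinForm k} {c : ℕ}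

theorem EvBound.val (h : nval p l ≤ c) : EvBound p l.val c := by
  have h2 : nval p l ≤ 2 ^ c := h.trans Nat.lt_two_pow_self.le
  rw [EvBound, ev_val, abs_of_nonneg (by positivity)]
  exact_mod_cast h2

theorem EvBound.pow2 (h : nval p l ≤ c) : EvBound p (pow2 l) c := by
  rw [EvBound, ev_pow2, abs_of_nonneg (by positivity)]
  exact pow_le_pow_right₀ (by norm_num) h

theorem nval_add_le {l' : LinForm k} {c' : ℕ} (h : nval p l ≤ c) (h' : nval p l' ≤ c') :
    nval p (l + l') ≤ c + c' := by
  rw [nval_add]; exact add_le_add h h'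

theorem nval_smul_le (r : ℕ) (h : nval p l ≤ c) : nval p (r • l) ≤ r * c := by
  rw [nval_smul]; exact Nat.mul_le_mul_left _ h

end Bounds

/-- On the cube unknowns are at most `t`, and each exponent of `2` is linear in them, so every
subexpression is bounded by `2` to a linear expression in `t`. -/
theorem evBound_Fhat {p : Fin 42 → ℕ} {n t : ℕ} (hp : ∀ i, p i ≤ t) (hn : n ≤ t) (ht : 1 ≤ t) :
    EvBound p (Fhat n) (1000000 * t) := by
  have hx : ∀ i, nval p (x i) ≤ t := fun i => by rw [x, nval_var]; exact hp _
  have h1 : EvBound p (EFact (x 1) (fun j => x (8 + j)) (x 2).val) (100000 * t) := by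
    simp only [EFact, EBinom, EDiv, EMod]
    apply EvBound.mono
    -- The bound is left as a metavariable, which this traversal of the expression fills in; `omega`
    -- then compares the resulting expression with the claimed multiple of `t`.
    · repeat' with_reducible first
        | exact hx _ | exact EvBound.one | exact EvBound.ofNat _ | exact (nval_cst p _).le
        | apply EvBound.add | apply EvBound.sub | apply EvBound.neg | apply EvBound.mul
        | apply EvBound.pow | apply EvBound.val | apply EvBound.pow2
        | apply nval_add_le | apply nval_smul_le
    · omega
  have h2 : EvBound p (EM4 (x 2) (x 3) (x 4) (x 5).val (fun j => x (21 + j)) (x 6).val)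
      (500000 * t) := by
    simp only [EM4]
    apply EvBound.mono
    · repeat' with_reducible first
        | exact hx _ | exact EvBound.one | exact EvBound.ofNat _ | exact (nval_cst p _).le
        | apply EvBound.add | apply EvBound.sub | apply EvBound.neg | apply EvBound.mul
        | apply EvBound.pow | apply EvBound.val | apply EvBound.pow2
        | apply nval_add_le | apply nval_smul_le
    · omega
  have h3 : EvBound p (EHW (x 6) (fun j => x (30 + j)) (x 7)) (100000 * t) := by
    simp only [EHW, ENu, EDvd, ENotDvd, EBinom, EDiv, EMod]
    apply EvBound.mono
    · repeat' with_reducible first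
        | exact hx _ | exact EvBound.one | exact EvBound.ofNat _ | exact (nval_cst p _).le
        | apply EvBound.add | apply EvBound.sub | apply EvBound.neg | apply EvBound.mul
        | apply EvBound.pow | apply EvBound.val | apply EvBound.pow2
        | apply nval_add_le | apply nval_smul_le
    · omega
  rw [Fhat]
  apply EvBound.mono
  · repeat' with_reducible first
      | exact hx _ | exact h1 | exact h2 | exact h3 | exact EvBound.one | exact EvBound.ofNat _
      | apply EvBound.add | apply EvBound.sub | apply EvBound.neg | apply EvBound.mul
      | apply EvBound.pow | apply EvBound.val
  · omega

/-- Enough because `512 * 256 * 9 > 1000000`, with factors coming from the summands `9` and `8` and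
from `9 * t < 2^(9t)`. -/
theorem mul_le_uPar (t : ℕ) : 1000000 * t ≤ 2 ^ (2 ^ (9 * t + 8) + 9) := by
  have h1 : 9 * t < 2 ^ (9 * t) := Nat.lt_two_pow_self
  have h2 : 2 ^ (9 * t + 8) < 2 ^ 2 ^ (9 * t + 8) := Nat.lt_two_pow_self
  rw [pow_add 2 (9 * t) 8] at h2
  rw [pow_add 2 (2 ^ (9 * t + 8)) 9, pow_add 2 (9 * t) 8]
  omega

theorem le_tPar (n : ℕ) : n ≤ tPar n := by
  have h : ∀ m, m ≤ 2 ^ m := fun m => Nat.lt_two_pow_self.le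
  have h4 : n ≤ 2 * n ^ 4 + 16 := by
    have := Nat.le_self_pow (n := 4) (by norm_num) n
    omega
  exact h4.trans ((h _).trans ((h _).trans (h _)))

theorem ev_Fhat_le (n : ℕ) (q : Fin 42 → Fin (tPar n)) :
    ev (fun i => (q i : ℕ)) (Fhat n) ≤ 2 ^ uPar n :=
  (le_abs_self _).trans ((evBound_Fhat (fun i => (q i).2.le) (le_tPar n) (tPar_pos n)).mono
    (mul_le_uPar (tPar n)))

theorem Qhat_spec {n : ℕ} (hn : 0 < n) : 0 ≤ Qhat n ∧
    HW (Qhat n).toNat = uPar n * (tPar n ^ 42 + Nat.nth Nat.Prime (n - 1)) := by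
  have h := HW_sum_cube_int 42 (tPar n) (uPar n) (fun q => ev (fun i => (q i : ℕ)) (Fhat n))
    (fun q => ⟨ev_Fhat_nonneg _ n, ev_Fhat_le n q⟩) (Qhat n) (hypercubeTerm_eq_sum _ _ _)
  rw [card_zeros hn fun a ha i _ _ => zeroW_lt hn a ha i] at h
  exact ⟨h.1, h.2.1⟩

end NthPrime

end

/-! ### The theorem -/

open NthPrime in
theorem mainTheorem1 :
    (IsArithmeticTerm tPar ∧ IsArithmeticTerm uPar ∧
      IsArithmeticTerm (fun n => (Qhat n).toNat) ∧
      IsArithmeticTerm (fun n => HW (Qhat n).toNat / uPar n - tPar n ^ 42)) ∧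
    ∀ n : ℕ, 0 < n →
      0 ≤ Qhat n ∧
      (Nat.nth Nat.Prime (n - 1) : ℚ) = (HW (Qhat n).toNat : ℚ) / uPar n - (tPar n : ℚ) ^ 42 := by
  refine ⟨⟨isArithmeticTerm_tPar, isArithmeticTerm_uPar, isIntTerm_Qhat.toNat,
    isArithmeticTerm_rhs⟩, fun n hn => ?_⟩
  obtain ⟨h0, h⟩ := Qhat_spec hn
  refine ⟨h0, ?_⟩
  have hu : (uPar n : ℚ) ≠ 0 := Nat.cast_ne_zero.2 (uPar_pos n).ne'
  rw [h, Nat.cast_mul, Nat.cast_add, Nat.cast_pow, mul_div_cancel_left₀ _ hu, add_sub_cancel_left]
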